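/- Let $n\ge 1$ and let $W$ be a compact, simply connected (in particular path-connected), Hausdorff $2n$-dimensional topological manifold with boundary, together with a homeomorphism $h\colon S^{2n-1}\to\partial W$. For $\epsilon>0$ let $W_\epsilon=W\cup_h (S^{2n-1}\times(-\epsilon,0])$, where $h(s)\in\partial W$ is identified with $(s,0)$. For $N\ge 2n+1$ write $\mathbb R^N=\mathbb R^{N-1}\times\mathbb R$ and let $\mathrm{std}\colon S^{2n-1}\times(-\epsilon,0]\to\mathbb R^{2n}\times(-\infty,0]\subset\mathbb R^{N-1}\times\mathbb R$ be the standard inclusion. A $k$-simplex of the simplicial set $\mathrm{Emb}^{\mathrm{lf}}_\epsilon(W,\mathbb R^N)$ is a map $e\colon\Delta^k\times W_\epsilon\to\Delta^k\times\mathbb R^{N-1}\times\mathbb R$ over $\Delta^k$ such that - $e$ is a locally flat embedding over $\Delta^k$: it is a homeomorphism onto its image, and every $(t,x)\in\Delta^k\times W_\epsilon$ has open neighbourhoods $t\in U\subset\Delta^k$, $x\in V\subset W_\epsilon$ and a map $U\times V\times\mathbb R^{N-2n}\to\Delta^k\times\mathbb R^N$ over $\Delta^k$ that is a homeomorphism onto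 its image and restricts to $e$ on $U\times V\times\{0\}$; - $e=\mathrm{id}\times\mathrm{std}$ on $\Delta^k\times S^{2n-1}\times(-\epsilon,0]$; - $e^{-1}(\Delta^k\times\mathbb R^{N-1}\times(-\infty,0])=\Delta^k\times S^{2n-1}\times(-\epsilon,0]$. Let $\mathrm{Emb}^{\mathrm{lf}}_\partial(W,\mathbb R^\infty)=\operatorname{colim}_{N\to\infty}\operatorname{colim}_{\epsilon\to0}\mathrm{Emb}^{\mathrm{lf}}_\epsilon(W,\mathbb R^N)$, where $\mathbb R^{N-1}\times\mathbb R\hookrightarrow\mathbb R^{N}\times\mathbb R$ is standard on the first factor and the identity on the second. Let $\mathrm{Top}_\partial(W)$ be the simplicial group whose $k$-simplices are the homeomorphisms of $\Delta^k\times W$ over $\Delta^k$ that are the identity on $\Delta^k\times\partial W$. It acts on $\mathrm{Emb}^{\mathrm{lf}}_\partial(W,\mathbb R^\infty)$ by $\varphi\cdot e=e\circ\varphi^{-1}$, where $\varphi$ is extended by the identity over the collar. For a simplicial group $G$ let $EG$ be the simplicial set with $(EG)_k=G_k^{k+1}$ (the diagonal of the levelwise homogeneous bar construction), with $G$ acting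 by left multiplication, and let $BG=EG/G$. Then: 1. $\mathrm{Emb}^{\mathrm{lf}}_\partial(W,\mathbb R^\infty)$ is weakly contractible: its geometric realization is non-empty and all its homotopy groups (and $\pi_0$) are trivial. 2. The quotient $\mathrm{Emb}^{\mathrm{lf}}_\partial(W,\mathbb R^\infty)/\mathrm{Top}_\partial(W)$ is a classifying space for $\mathrm{Top}_\partial(W)$: the action is free in every simplicial degree, and there is a $\mathrm{Top}_\partial(W)$-equivariant map $\mathrm{Emb}^{\mathrm{lf}}_\partial(W,\mathbb R^\infty)\to E\mathrm{Top}_\partial(W)$ whose induced map of quotients $\mathrm{Emb}^{\mathrm{lf}}_\partial(W,\mathbb R^\infty)/\mathrm{Top}_\partial(W)\to B\mathrm{Top}_\partial(W)$ realizes to a homotopy equivalence. -/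

import Mathlib

open CategoryTheory Opposite Simplicial Topology

universe u

noncomputable section

namespace LFEmb

/-! ### Locally flat embeddings over a base -/

section LocallyFlat

variable {B B' M M' N : Type*} [TopologicalSpace B] [TopologicalSpace B'] [TopologicalSpace M]
  [TopologicalSpace M'] [TopologicalSpace N]

/-- A map `B × M → B × N` over `B` is recorded by its second component `g : B × M → N`; the map
itself is `(b, m) ↦ (b, g (b, m))`. The predicate says that it is a locally flat embedding over `B`
of codimension `c`: it is a homeomorphism onto its image, and each `(b, m)` has a product
neighbourhood `U × V` with a map `U × V × ℝᶜ → B × N` over `B` which is a homeomorphism onto its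
image and restricts to the given map on `U × V × {0}`. -/
structure IsLocallyFlatEmbeddingOver (c : ℕ) (g : B × M → N) : Prop where
  isEmbedding : IsEmbedding (fun p : B × M => (p.1, g p))
  flat : ∀ (b : B) (m : M), ∃ (U : Set B) (V : Set M),
    IsOpen U ∧ b ∈ U ∧ IsOpen V ∧ m ∈ V ∧
    ∃ F : (U × V) × (Fin c → ℝ) → N,
      IsEmbedding (fun p : (U × V) × (Fin c → ℝ) => ((p.1.1 : B), F p)) ∧
      ∀ (x : U) (v : V), F ((x, v), 0) = g (x, v)

theorem isEmbedding_of_leftInverse {X Y : Type*} [TopologicalSpace X] [TopologicalSpace Y]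
    {f : X → Y} {r : Y → X} (hf : Continuous f) (hr : Continuous r) (h : ∀ x, r (f x) = x) :
    IsEmbedding f := by
  refine IsEmbedding.of_comp hf hr ?_
  have : r ∘ f = id := funext h
  rw [this]; exact IsEmbedding.id

/-- Local flatness is preserved by base change along `α` and by precomposition with embeddings
over the base. -/
theorem IsLocallyFlatEmbeddingOver.precomp {c : ℕ} {g : B × M → N}
    (hg : IsLocallyFlatEmbeddingOver c g) (α : B' → B) (hα : Continuous α)
    (E : B' × M' → M) (hE : IsEmbedding (fun p : B' × M' => (p.1, E p))) :
    IsLocallyFlatEmbeddingOver c (fun p : B' × M' => g (α p.1, E p)) := by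
  have hEc : Continuous E := continuous_snd.comp hE.continuous
  have hgc : Continuous g := continuous_snd.comp hg.isEmbedding.continuous
  refine ⟨?_, fun b m => ?_⟩
  · refine IsEmbedding.of_comp (g := fun q : B' × N => (q.1, (α q.1, q.2)))
      (by fun_prop) (by fun_prop) ?_
    have h1 : IsEmbedding (fun p : B' × M' => (p.1, (α p.1, E p))) := by
      refine IsEmbedding.of_comp (g := fun q : B' × (B × M) => (q.1, q.2.2))
        (by fun_prop) (by fun_prop) ?_
      exact hE
    exact (IsEmbedding.id.prodMap hg.isEmbedding).comp h1
  · obtain ⟨U, V, hU, hbU, hV, hmV, F, hF, hF0⟩ := hg.flat (α b) (E (b, m))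
    have hopen : E ⁻¹' V ∈ 𝓝 (b, m) := (hV.preimage hEc).mem_nhds hmV
    obtain ⟨U₁, V₁, hU₁, hbU₁, hV₁, hmV₁, hsub⟩ := mem_nhds_prod_iff'.1 hopen
    have hFc : Continuous F := continuous_snd.comp hF.continuous
    refine ⟨U₁ ∩ α ⁻¹' U, V₁, hU₁.inter (hU.preimage hα), ⟨hbU₁, hbU⟩, hV₁, hmV₁, ?_⟩
    let L : ((U₁ ∩ α ⁻¹' U : Set B') × V₁) × (Fin c → ℝ) → (U × V) × (Fin c → ℝ) :=
      fun p => ((⟨α p.1.1, p.1.1.2.2⟩, ⟨E (p.1.1, p.1.2), hsub ⟨p.1.1.2.1, p.1.2.2⟩⟩), p.2)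
    have hL : Continuous L := by
      refine Continuous.prodMk (Continuous.prodMk ?_ ?_) continuous_snd
      · exact Continuous.subtype_mk (by fun_prop) _
      · exact Continuous.subtype_mk (by fun_prop) _
    refine ⟨fun p => F (L p), ?_, fun x v => hF0 _ _⟩
    refine IsEmbedding.of_comp (g := fun q : B' × N => (q.1, (α q.1, q.2)))
      (by fun_prop) (by fun_prop) ?_
    have h1 : IsEmbedding (fun p : ((U₁ ∩ α ⁻¹' U : Set B') × V₁) × (Fin c → ℝ) =>
        ((p.1.1 : B'), L p)) := by
      refine IsEmbedding.of_comp
        (g := fun q : B' × ((U × V) × (Fin c → ℝ)) => ((q.1, (q.2.1.2 : M)), q.2.2))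
        (by fun_prop) (by fun_prop) ?_
      exact (hE.comp (IsEmbedding.subtypeVal.prodMap IsEmbedding.subtypeVal)).prodMap
        IsEmbedding.id
    exact (IsEmbedding.id.prodMap hF).comp h1

end LocallyFlat

/-- The standard inclusion `ℝᵃ → ℝᵇ` by zero coordinates (for `a ≤ b`). -/
def pad {a b : ℕ} (x : Fin a → ℝ) : Fin b → ℝ :=
  fun i => if h : (i : ℕ) < a then x ⟨i, h⟩ else 0

theorem pad_self {a : ℕ} (x : Fin a → ℝ) : (pad x : Fin a → ℝ) = x := by
  funext i; simp [pad]

theorem pad_pad {a b c : ℕ} (hab : a ≤ b) (x : Fin a → ℝ) :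
    (pad (pad x : Fin b → ℝ) : Fin c → ℝ) = pad x := by
  funext i
  simp only [pad]
  split_ifs <;> first | rfl | omega

theorem continuous_pad {a b : ℕ} : Continuous (pad : (Fin a → ℝ) → (Fin b → ℝ)) := by
  refine continuous_pi fun i => ?_
  unfold pad
  split_ifs <;> fun_prop

/-- The inclusion `ℝᵃ × ℝ → ℝᵇ × ℝ` which is standard on the first factor and preserves the last
coordinate. -/
def stab {a b : ℕ} (x : (Fin a → ℝ) × ℝ) : (Fin b → ℝ) × ℝ := (pad x.1, x.2)

theorem continuous_stab {a b : ℕ} : Continuous (stab : (Fin a → ℝ) × ℝ → (Fin b → ℝ) × ℝ) :=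
  (continuous_pad.comp continuous_fst).prodMk continuous_snd

/-- Local flatness is preserved by `ℝᵐ⁺ᶜ × ℝ → ℝᵐ⁺ᵈ × ℝ`, for `c ≤ d`. -/
theorem IsLocallyFlatEmbeddingOver.stab {B M : Type*} [TopologicalSpace B] [TopologicalSpace M]
    {m c d : ℕ} (hcd : c ≤ d) {g : B × M → (Fin (m + c) → ℝ) × ℝ}
    (hg : IsLocallyFlatEmbeddingOver (c + 1) g) :
    IsLocallyFlatEmbeddingOver (d + 1)
      (fun p => (LFEmb.stab (g p) : (Fin (m + d) → ℝ) × ℝ)) := by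
  have hgc : Continuous g := continuous_snd.comp hg.isEmbedding.continuous
  have hle : m + c ≤ m + d := by omega
  refine ⟨?_, fun b x => ?_⟩
  · refine IsEmbedding.of_comp
      (g := fun q : B × ((Fin (m + d) → ℝ) × ℝ) =>
        (q.1, ((fun i : Fin (m + c) => q.2.1 (Fin.castLE hle i)), q.2.2)))
      (continuous_fst.prodMk (continuous_stab.comp hgc)) (by fun_prop) ?_
    convert hg.isEmbedding using 1
    funext p
    refine Prod.ext rfl (Prod.ext ?_ rfl)
    funext i
    simp [LFEmb.stab, pad]
  · obtain ⟨U, V, hU, hbU, hV, hmV, F, hF, hF0⟩ := hg.flat b x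
    have hFc : Continuous F := continuous_snd.comp hF.continuous
    refine ⟨U, V, hU, hbU, hV, hmV, ?_⟩
    let hd : (Fin (d + 1) → ℝ) → (Fin (c + 1) → ℝ) :=
      fun s i => s (Fin.castLE (by omega) i)
    let tl : (Fin (d + 1) → ℝ) → (Fin (d - c) → ℝ) :=
      fun s i => s ⟨c + 1 + i, by omega⟩
    have hhd : Continuous hd := by fun_prop
    have htl : Continuous tl := by fun_prop
    let F' : (U × V) × (Fin (d + 1) → ℝ) → (Fin (m + d) → ℝ) × ℝ := fun p =>
      ((fun i => if h : (i : ℕ) < m + c then (F (p.1, hd p.2)).1 ⟨i, h⟩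
          else tl p.2 ⟨i - (m + c), by omega⟩), (F (p.1, hd p.2)).2)
    have hF' : Continuous F' := by
      refine Continuous.prodMk (continuous_pi fun i => ?_) (by fun_prop)
      split_ifs <;> fun_prop
    refine ⟨F', ?_, ?_⟩
    · refine IsEmbedding.of_comp
        (g := fun q : B × ((Fin (m + d) → ℝ) × ℝ) =>
          ((q.1, ((fun i : Fin (m + c) => q.2.1 (Fin.castLE hle i)), q.2.2)),
            fun i : Fin (d - c) => q.2.1 ⟨m + c + i, by omega⟩))
        (by fun_prop) (by fun_prop) ?_
      have h1 : IsEmbedding (fun p : (U × V) × (Fin (d + 1) → ℝ) =>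
          ((p.1, hd p.2), tl p.2)) := by
        refine isEmbedding_of_leftInverse
          (r := fun q => (q.1.1, fun i : Fin (d + 1) =>
            if h : (i : ℕ) < c + 1 then q.1.2 ⟨i, h⟩ else q.2 ⟨i - (c + 1), by omega⟩))
          (by fun_prop) ?_ ?_
        · refine Continuous.prodMk (by fun_prop) (continuous_pi fun i => ?_)
          split_ifs <;> fun_prop
        · intro p
          refine Prod.ext rfl ?_
          funext i
          by_cases h : (i : ℕ) < c + 1
          · simp [h, hd]
          · simp only [h, dif_neg, not_false_eq_true, tl]
            exact congrArg p.2 (Fin.ext (by simp only; omega))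
      convert (hF.prodMap (IsEmbedding.id (X := Fin (d - c) → ℝ))).comp h1 using 1
      funext p
      refine Prod.ext (Prod.ext rfl (Prod.ext ?_ rfl)) ?_
      · funext i
        simp [F']
      · funext i
        simp [F']
    · intro y v
      have h0 : hd 0 = 0 := rfl
      have h0' : tl 0 = 0 := rfl
      simp only [F', h0, h0', hF0, LFEmb.stab]
      rfl

/-! ### Manifolds with boundary a sphere, and collars -/

/-- The boundary of a `d`-dimensional topological manifold with boundary `W`: the points that have
no neighbourhood homeomorphic to an open subset of `ℝᵈ`. -/
def manifoldBoundary (d : ℕ) (W : Type*) [TopologicalSpace W] : Set W :=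
  {x | ∀ e : OpenPartialHomeomorph W (EuclideanSpace ℝ (Fin d)), x ∉ e.source}

/-- The unit sphere `S²ⁿ⁻¹` in `ℝ²ⁿ`. -/
abbrev BdrySphere (n : ℕ) : Type := Metric.sphere (0 : EuclideanSpace ℝ (Fin (2 * n))) 1

/-- The topological simplex `Δᵏ`. -/
abbrev Simp (k : SimplexCategory) : Type := stdSimplex ℝ (Fin (k.len + 1))

/-- The map `Δʲ → Δᵏ` induced by a morphism `[j] → [k]`. -/
abbrev simpMap {j k : SimplexCategory} (θ : j ⟶ k) : Simp j → Simp k := stdSimplex.map θ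

section Collar

variable {n : ℕ} {W : Type u} [TopologicalSpace W]

/-- The gluing relation identifying `h s ∈ ∂W` with `(s, 0)`. -/
def CollarRel (h : BdrySphere n ≃ₜ manifoldBoundary (2 * n) W)
    (x y : W ⊕ (BdrySphere n × Set.Iic (0 : ℝ))) : Prop :=
  ∃ s : BdrySphere n, x = Sum.inl (h s : W) ∧ y = Sum.inr (s, ⟨0, Set.mem_Iic.2 le_rfl⟩)

/-- `W ∪ (S²ⁿ⁻¹ × (-∞, 0])`, glued along `h : S²ⁿ⁻¹ ≅ ∂W`, with the quotient topology. -/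
def Collared (h : BdrySphere n ≃ₜ manifoldBoundary (2 * n) W) : Type u := Quot (CollarRel h)

instance (h : BdrySphere n ≃ₜ manifoldBoundary (2 * n) W) : TopologicalSpace (Collared h) :=
  inferInstanceAs (TopologicalSpace (Quot (CollarRel h)))

variable (h : BdrySphere n ≃ₜ manifoldBoundary (2 * n) W)

def Collared.inl (w : W) : Collared h := Quot.mk _ (Sum.inl w)

def Collared.inr (p : BdrySphere n × Set.Iic (0 : ℝ)) : Collared h := Quot.mk _ (Sum.inr p)

/-- The collar `S²ⁿ⁻¹ × (-ε, 0]`. -/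
def collar (ε : ℝ) : Set (Collared h) :=
  {x | ∃ p : BdrySphere n × Set.Iic (0 : ℝ), -ε < (p.2 : ℝ) ∧ x = Collared.inr h p}

/-- `W ∪ (S²ⁿ⁻¹ × (-ε, 0])`, as a subspace of `W ∪ (S²ⁿ⁻¹ × (-∞, 0])`. -/
def collared (ε : ℝ) : Set (Collared h) := Set.range (Collared.inl h) ∪ collar h ε

/-- The collar coordinate, extended by `0` to `W`. -/
def height : Collared h → ℝ :=
  Quot.lift (Sum.elim (fun _ => 0) (fun p => (p.2 : ℝ))) (by rintro _ _ ⟨s, rfl, rfl⟩; rfl)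

theorem collar_mono {ε ε' : ℝ} (hε : ε' ≤ ε) : collar h ε' ⊆ collar h ε := by
  rintro _ ⟨p, hp, rfl⟩
  exact ⟨p, by linarith, rfl⟩

theorem collared_mono {ε ε' : ℝ} (hε : ε' ≤ ε) : collared h ε' ⊆ collared h ε :=
  Set.union_subset_union_right _ (collar_mono h hε)

theorem mem_collar_of_mem {ε ε' : ℝ} (hε' : 0 < ε') {x : Collared h} (hx : x ∈ collared h ε')
    (hx' : x ∈ collar h ε) : x ∈ collar h ε' := by
  rcases hx with ⟨w, rfl⟩ | hx
  · obtain ⟨p, -, hp⟩ := hx'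
    refine ⟨p, ?_, hp⟩
    have : (0 : ℝ) = p.2 := congrArg (height h) hp
    linarith
  · exact hx

end Collar

/-! ### The simplicial group of homeomorphisms -/

section Homeo

variable (d : ℕ) (W : Type u) [TopologicalSpace W]

/-- The group of homeomorphisms of `Δᵏ × W` over `Δᵏ` that are the identity on `Δᵏ × ∂W`. -/
def topBdry (k : SimplexCategory) : Subgroup ((Simp k × W) ≃ₜ (Simp k × W)) where
  carrier := {φ | (∀ p, (φ p).1 = p.1) ∧ ∀ p, p.2 ∈ manifoldBoundary d W → φ p = p}
  mul_mem' := by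
    rintro φ ψ ⟨h1, h2⟩ ⟨h3, h4⟩
    refine ⟨fun p => ?_, fun p hp => ?_⟩
    · change (φ (ψ p)).1 = p.1
      rw [h1, h3]
    · change φ (ψ p) = p
      rw [h4 p hp, h2 p hp]
  one_mem' := ⟨fun _ => rfl, fun _ _ => rfl⟩
  inv_mem' := by
    rintro φ ⟨h1, h2⟩
    refine ⟨fun p => ?_, fun p hp => ?_⟩
    · change (φ.symm p).1 = p.1
      rw [← h1 (φ.symm p), φ.apply_symm_apply]
    · change φ.symm p = p
      rw [φ.symm_apply_eq, h2 p hp]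

variable {d W}

theorem topBdry.eta {k : SimplexCategory} (φ : topBdry d W k) (t : Simp k) (w : W) :
    φ.1 (t, w) = (t, (φ.1 (t, w)).2) :=
  Prod.ext (φ.2.1 (t, w)) rfl

theorem topBdry.mul_snd {k : SimplexCategory} (φ ψ : topBdry d W k) (t : Simp k) (w : W) :
    ((φ * ψ).1 (t, w)).2 = (φ.1 (t, (ψ.1 (t, w)).2)).2 := by
  change (φ.1 (ψ.1 (t, w))).2 = _
  rw [topBdry.eta ψ]

theorem topBdry.inv_snd {k : SimplexCategory} (φ : topBdry d W k) (t : Simp k) (w : W) :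
    (φ.1 (t, ((φ⁻¹).1 (t, w)).2)).2 = w := by
  rw [← topBdry.mul_snd, mul_inv_cancel]; rfl

theorem topBdry.inv_snd' {k : SimplexCategory} (φ : topBdry d W k) (t : Simp k) (w : W) :
    ((φ⁻¹).1 (t, (φ.1 (t, w)).2)).2 = w := by
  rw [← topBdry.mul_snd, inv_mul_cancel]; rfl

theorem topBdry.ext_snd {k : SimplexCategory} {φ ψ : topBdry d W k}
    (h : ∀ t w, (φ.1 (t, w)).2 = (ψ.1 (t, w)).2) : φ = ψ := by
  refine Subtype.ext (Homeomorph.ext fun p => ?_)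
  obtain ⟨t, w⟩ := p
  rw [topBdry.eta, topBdry.eta ψ, h]

/-- Restriction of a family of homeomorphisms along `Δʲ → Δᵏ`. -/
def topBdry.pullback {j k : SimplexCategory} (θ : j ⟶ k) : topBdry d W k →* topBdry d W j where
  toFun φ :=
    ⟨{ toFun := fun p => (p.1, (φ.1 (simpMap θ p.1, p.2)).2)
       invFun := fun p => (p.1, ((φ⁻¹).1 (simpMap θ p.1, p.2)).2)
       left_inv := fun p => Prod.ext rfl (topBdry.inv_snd' φ _ _)
       right_inv := fun p => Prod.ext rfl (topBdry.inv_snd φ _ _)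
       continuous_toFun := by
         have := stdSimplex.continuous_map (S := ℝ) θ
         have := φ.1.continuous
         fun_prop
       continuous_invFun := by
         have := stdSimplex.continuous_map (S := ℝ) θ
         have := (φ⁻¹).1.continuous
         fun_prop },
      fun _ => rfl, fun p hp => Prod.ext rfl (by
        change (φ.1 (simpMap θ p.1, p.2)).2 = p.2
        rw [φ.2.2 _ hp])⟩
  map_one' := rfl
  map_mul' φ ψ := topBdry.ext_snd fun t w => topBdry.mul_snd φ ψ _ _

variable (d W) in
/-- The simplicial group `Top_∂(W)`. -/
def TopBdry : SimplicialObject GrpCat.{u} where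
  obj k := GrpCat.of (topBdry d W k.unop)
  map θ := GrpCat.ofHom (topBdry.pullback θ.unop)
  map_id k := by
    refine GrpCat.hom_ext (MonoidHom.ext fun φ => topBdry.ext_snd fun t w => ?_)
    change (φ.1 (stdSimplex.map id t, w)).2 = _
    rw [stdSimplex.map_id_apply]; rfl
  map_comp {j k l} θ η := by
    refine GrpCat.hom_ext (MonoidHom.ext fun φ => topBdry.ext_snd fun t w => ?_)
    change (φ.1 (stdSimplex.map (θ.unop ∘ η.unop) t, w)).2 =
      (φ.1 (stdSimplex.map θ.unop (stdSimplex.map η.unop t), w)).2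
    rw [stdSimplex.map_comp_apply]

end Homeo

/-! ### Extending homeomorphisms over the collar -/

section Extend

variable {n : ℕ} {W : Type u} [TopologicalSpace W]
  (h : BdrySphere n ≃ₜ manifoldBoundary (2 * n) W)

/-- The extension of `φ` to `W ∪ (S²ⁿ⁻¹ × (-∞, 0])` by the identity on the collar. -/
def extend {k : SimplexCategory} (φ : topBdry (2 * n) W k) (t : Simp k) :
    Collared h → Collared h :=
  Quot.lift (Sum.elim (fun w => Collared.inl h (φ.1 (t, w)).2) (fun p => Collared.inr h p)) (by
    rintro _ _ ⟨s, rfl, rfl⟩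
    simp only [Sum.elim_inl, Sum.elim_inr]
    rw [φ.2.2 (t, (h s : W)) (h s).2]
    exact Quot.sound ⟨s, rfl, rfl⟩)

@[simp] theorem extend_inl {k : SimplexCategory} (φ : topBdry (2 * n) W k) (t : Simp k) (w : W) :
    extend h φ t (Collared.inl h w) = Collared.inl h (φ.1 (t, w)).2 := rfl

@[simp] theorem extend_inr {k : SimplexCategory} (φ : topBdry (2 * n) W k) (t : Simp k)
    (p : BdrySphere n × Set.Iic (0 : ℝ)) :
    extend h φ t (Collared.inr h p) = Collared.inr h p := rfl

theorem Collared.cases {P : Collared h → Prop} (h1 : ∀ w, P (Collared.inl h w))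
    (h2 : ∀ p, P (Collared.inr h p)) (x : Collared h) : P x := by
  obtain ⟨x, rfl⟩ := Quot.exists_rep x
  cases x with
  | inl w => exact h1 w
  | inr p => exact h2 p

theorem extend_mul {k : SimplexCategory} (φ ψ : topBdry (2 * n) W k) (t : Simp k)
    (x : Collared h) : extend h (φ * ψ) t x = extend h φ t (extend h ψ t x) := by
  refine Collared.cases h (P := fun x => extend h (φ * ψ) t x = extend h φ t (extend h ψ t x))
    (fun w => ?_) (fun p => rfl) x
  simp only [extend_inl, topBdry.mul_snd]

theorem extend_one {k : SimplexCategory} (t : Simp k) (x : Collared h) :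
    extend h (1 : topBdry (2 * n) W k) t x = x :=
  Collared.cases h (P := fun x => extend h (1 : topBdry (2 * n) W k) t x = x)
    (fun _ => rfl) (fun _ => rfl) x

theorem extend_mem {k : SimplexCategory} (φ : topBdry (2 * n) W k) (t : Simp k) {ε : ℝ}
    {x : Collared h} (hx : x ∈ collared h ε) : extend h φ t x ∈ collared h ε := by
  rcases hx with ⟨w, rfl⟩ | ⟨p, hp, rfl⟩
  · exact Or.inl ⟨_, rfl⟩
  · exact Or.inr ⟨p, hp, rfl⟩

theorem extend_mem_collar {k : SimplexCategory} (φ : topBdry (2 * n) W k) (t : Simp k) {ε : ℝ}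
    {x : Collared h} (hx : x ∈ collar h ε) : extend h φ t x = x := by
  rcases hx with ⟨p, hp, rfl⟩
  rfl

theorem continuous_extend {k : SimplexCategory} (φ : topBdry (2 * n) W k) :
    Continuous (fun p : Simp k × Collared h => extend h φ p.1 p.2) := by
  have hq : IsQuotientMap (Quot.mk (CollarRel h)) := isQuotientMap_quot_mk
  have : CompactSpace (Simp k) := isCompact_iff_compactSpace.1 (isCompact_stdSimplex ℝ _)
  refine hq.continuous_lift_prod_right (Y := Simp k) (X := Collared h)
    (g := fun p : Simp k × Collared h => extend h φ p.1 p.2) ?_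
  have hφ := φ.1.continuous
  have hmk : Continuous (Quot.mk (CollarRel h)) := continuous_quot_mk
  have key : Continuous
      ((fun p : Simp k × (W ⊕ (BdrySphere n × Set.Iic (0 : ℝ))) =>
        extend h φ p.1 (Quot.mk _ p.2)) ∘ Homeomorph.prodSumDistrib.symm) := by
    refine continuous_sum_dom.2 ⟨?_, ?_⟩
    · exact hmk.comp (continuous_inl.comp (continuous_snd.comp hφ))
    · exact hmk.comp (continuous_inr.comp continuous_snd)
  exact (Homeomorph.comp_continuous_iff' _).1 key

/-- The extension of `φ`, restricted to `W ∪ (S²ⁿ⁻¹ × (-ε, 0])`. -/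
def extendOn {k : SimplexCategory} (φ : topBdry (2 * n) W k) (ε : ℝ)
    (p : Simp k × collared h ε) : collared h ε :=
  ⟨extend h φ p.1 p.2, extend_mem h φ p.1 p.2.2⟩

theorem isEmbedding_extendOn {k : SimplexCategory} (φ : topBdry (2 * n) W k) (ε : ℝ) :
    IsEmbedding (fun p : Simp k × collared h ε => (p.1, extendOn h φ ε p)) := by
  have hc : ∀ ψ : topBdry (2 * n) W k,
      Continuous (fun p : Simp k × collared h ε => (p.1, extendOn h ψ ε p)) := fun ψ =>
    continuous_fst.prodMk (Continuous.subtype_mk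
      ((continuous_extend h ψ).comp (continuous_fst.prodMk (by fun_prop))) _)
  refine isEmbedding_of_leftInverse (hc φ) (hc φ⁻¹) fun p => ?_
  refine Prod.ext rfl (Subtype.ext ?_)
  change extend h φ⁻¹ p.1 (extend h φ p.1 p.2) = p.2
  rw [← extend_mul, inv_mul_cancel, extend_one]

end Extend

/-! ### The simplicial set of embeddings -/

section Emb

variable {n : ℕ} {W : Type u} [TopologicalSpace W]
  (h : BdrySphere n ≃ₜ manifoldBoundary (2 * n) W)

/-- The standard embedding `S²ⁿ⁻¹ × (-∞, 0] → ℝ²ⁿ × (-∞, 0] → ℝ²ⁿ⁺ᶜ × ℝ`. -/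
def std (c : ℕ) (p : BdrySphere n × Set.Iic (0 : ℝ)) : (Fin (2 * n + c) → ℝ) × ℝ :=
  (pad (fun i => p.1.1 i), p.2)

/-- The `k`-simplices of `Emb^lf_ε(W, ℝᴺ)` for `N = 2n + c + 1`, with `ℝᴺ` written as `ℝᴺ⁻¹ × ℝ`:
locally flat embeddings `e` of `Δᵏ × (W ∪ (S²ⁿ⁻¹ × (-ε, 0]))` into `Δᵏ × ℝᴺ⁻¹ × ℝ` over `Δᵏ` (given
by their second component) which are standard on the collar, and such that the preimage of
`Δᵏ × ℝᴺ⁻¹ × (-∞, 0]` is the collar. -/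
@[ext]
structure EmbSimplex (c : ℕ) (ε : ℝ) (k : SimplexCategory) where
  toFun : Simp k × collared h ε → (Fin (2 * n + c) → ℝ) × ℝ
  locallyFlat : IsLocallyFlatEmbeddingOver (c + 1) toFun
  eq_std : ∀ (t : Simp k) (p : BdrySphere n × Set.Iic (0 : ℝ)) (hp : -ε < (p.2 : ℝ)),
    toFun (t, ⟨Collared.inr h p, Or.inr ⟨p, hp, rfl⟩⟩) = std c p
  nonpos_iff : ∀ (t : Simp k) (x : collared h ε),
    (toFun (t, x)).2 ≤ 0 ↔ (x : Collared h) ∈ collar h ε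

variable {h}

/-- Restriction along `Δʲ → Δᵏ`. -/
def EmbSimplex.pullback {c : ℕ} {ε : ℝ} {j k : SimplexCategory} (θ : j ⟶ k)
    (e : EmbSimplex h c ε k) : EmbSimplex h c ε j where
  toFun p := e.toFun (simpMap θ p.1, p.2)
  locallyFlat := e.locallyFlat.precomp (simpMap θ) (stdSimplex.continuous_map θ) Prod.snd
    IsEmbedding.id
  eq_std _ := fun p hp => e.eq_std _ p hp
  nonpos_iff _ _ := e.nonpos_iff _ _

/-- Restriction to a smaller collar, and the inclusion into a larger Euclidean space. -/
def EmbSimplex.transition {c c' : ℕ} {ε ε' : ℝ} (hc : c ≤ c') (hε' : 0 < ε') (hε : ε' ≤ ε)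
    {k : SimplexCategory}
    (e : EmbSimplex h c ε k) : EmbSimplex h c' ε' k where
  toFun p := stab (e.toFun (p.1, Set.inclusion (collared_mono h hε) p.2))
  locallyFlat := (e.locallyFlat.precomp id continuous_id
    (fun p => Set.inclusion (collared_mono h hε) p.2)
    (IsEmbedding.id.prodMap (IsEmbedding.inclusion (collared_mono h hε)))).stab hc
  eq_std t p hp := by
    change stab (e.toFun (t, ⟨Collared.inr h p, _⟩)) = _
    rw [e.eq_std t p (by linarith)]
    exact Prod.ext (pad_pad (by omega) _) rfl
  nonpos_iff t x := by
    refine (e.nonpos_iff t _).trans ⟨fun hx => mem_collar_of_mem h hε' x.2 hx,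
      fun hx => collar_mono h hε hx⟩

/-- The action of a family of homeomorphisms, `φ • e = e ∘ φ⁻¹`, where `φ` is extended by the
identity on the collar. -/
def EmbSimplex.act {c : ℕ} {ε : ℝ} {k : SimplexCategory} (φ : topBdry (2 * n) W k)
    (e : EmbSimplex h c ε k) : EmbSimplex h c ε k where
  toFun p := e.toFun (p.1, extendOn h φ⁻¹ ε p)
  locallyFlat := e.locallyFlat.precomp id continuous_id (extendOn h φ⁻¹ ε)
    (isEmbedding_extendOn h φ⁻¹ ε)
  eq_std t p hp := e.eq_std t p hp
  nonpos_iff t x := by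
    refine (e.nonpos_iff t _).trans ⟨fun hx => ?_, fun hx => ?_⟩
    · have := extend_mem_collar h φ t hx
      change extend h φ t (extend h φ⁻¹ t x) = extend h φ⁻¹ t x at this
      rw [← extend_mul, mul_inv_cancel, extend_one] at this
      rw [this]; exact hx
    · change extend h φ⁻¹ t x ∈ _
      rw [extend_mem_collar h φ⁻¹ t hx]; exact hx

theorem EmbSimplex.pullback_id {c : ℕ} {ε : ℝ} {k : SimplexCategory} (e : EmbSimplex h c ε k) :
    e.pullback (𝟙 k) = e := by
  refine EmbSimplex.ext (funext fun p => ?_)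
  change e.toFun (stdSimplex.map id p.1, p.2) = _
  rw [stdSimplex.map_id_apply]

theorem EmbSimplex.pullback_comp {c : ℕ} {ε : ℝ} {i j k : SimplexCategory} (η : i ⟶ j) (θ : j ⟶ k)
    (e : EmbSimplex h c ε k) : e.pullback (η ≫ θ) = (e.pullback θ).pullback η := by
  refine EmbSimplex.ext (funext fun p => ?_)
  change e.toFun (stdSimplex.map (θ ∘ η) p.1, p.2) =
    e.toFun (stdSimplex.map θ (stdSimplex.map η p.1), p.2)
  rw [stdSimplex.map_comp_apply]

theorem EmbSimplex.act_one {c : ℕ} {ε : ℝ} {k : SimplexCategory} (e : EmbSimplex h c ε k) :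
    e.act 1 = e := by
  refine EmbSimplex.ext (funext fun p => ?_)
  refine congrArg (fun y => e.toFun (p.1, y)) (Subtype.ext ?_)
  change extend h (1 : topBdry (2 * n) W k)⁻¹ p.1 p.2 = p.2
  rw [inv_one, extend_one]

theorem EmbSimplex.act_mul {c : ℕ} {ε : ℝ} {k : SimplexCategory} (φ ψ : topBdry (2 * n) W k)
    (e : EmbSimplex h c ε k) : e.act (φ * ψ) = (e.act ψ).act φ := by
  refine EmbSimplex.ext (funext fun p => ?_)
  refine congrArg (fun y => e.toFun (p.1, y)) (Subtype.ext ?_)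
  change extend h (φ * ψ)⁻¹ p.1 p.2 = extend h ψ⁻¹ p.1 (extend h φ⁻¹ p.1 p.2)
  rw [mul_inv_rev, extend_mul]

theorem EmbSimplex.pullback_act {c : ℕ} {ε : ℝ} {j k : SimplexCategory} (θ : j ⟶ k)
    (φ : topBdry (2 * n) W k) (e : EmbSimplex h c ε k) :
    (e.act φ).pullback θ = (e.pullback θ).act (topBdry.pullback θ φ) := by
  refine EmbSimplex.ext (funext fun p => ?_)
  refine congrArg (fun y => e.toFun (simpMap θ p.1, y)) (Subtype.ext ?_)
  change extend h φ⁻¹ (simpMap θ p.1) p.2 = extend h (topBdry.pullback θ φ)⁻¹ p.1 p.2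
  rw [← map_inv]
  exact Collared.cases h (P := fun x => extend h φ⁻¹ (simpMap θ p.1) x =
    extend h (topBdry.pullback θ φ⁻¹) p.1 x) (fun _ => rfl) (fun _ => rfl) _

/-- The index set of the colimit over `N = 2n + c + 1 → ∞` and `ε → 0`. -/
abbrev Idx : Type := ℕ × {ε : ℝ // 0 < ε}ᵒᵈ

/-- The transition maps of the directed system of `k`-simplices. -/
def embTransition (k : SimplexCategory) (i j : Idx) (hij : i ≤ j) :
    TypeCat.Fun (EmbSimplex h i.1 i.2.ofDual.1 k) (EmbSimplex h j.1 j.2.ofDual.1 k) :=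
  ⟨fun e => e.transition hij.1 j.2.ofDual.2 hij.2⟩

instance (k : SimplexCategory) : DirectedSystem
    (fun i : Idx => EmbSimplex h i.1 i.2.ofDual.1 k) (embTransition (h := h) k · · ·) where
  map_self i e := by
    refine EmbSimplex.ext (funext fun p => ?_)
    exact Prod.ext (pad_self _) rfl
  map_map k j i hij hjk e := by
    refine EmbSimplex.ext (funext fun p => ?_)
    exact Prod.ext (pad_pad (Nat.add_le_add_left hij.1 _) _) rfl

variable (h) in
/-- The `k`-simplices of `Emb^lf_∂(W, ℝ^∞)`: the colimit of the sets of `k`-simplices of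
`Emb^lf_ε(W, ℝᴺ)` as `ε → 0` and `N → ∞`. -/
abbrev EmbInfSimplex (k : SimplexCategory) : Type u :=
  DirectLimit (fun i : Idx => EmbSimplex h i.1 i.2.ofDual.1 k) (embTransition k)

/-- Restriction along `Δʲ → Δᵏ` in the colimit. -/
def EmbInfSimplex.pullback {j k : SimplexCategory} (θ : j ⟶ k) :
    EmbInfSimplex h k → EmbInfSimplex h j :=
  DirectLimit.map (embTransition k) (embTransition j)
    (fun _ e => e.pullback θ) (fun _ _ _ _ => rfl)

variable (h) in
/-- The simplicial set `Emb^lf_∂(W, ℝ^∞)`. -/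
def EmbInf : SSet.{u} where
  obj k := EmbInfSimplex h k.unop
  map θ := TypeCat.ofHom (EmbInfSimplex.pullback θ.unop)
  map_id k := by
    ext x
    obtain ⟨i, e, rfl⟩ := DirectLimit.exists_eq_mk _ x
    exact congrArg (fun y => (⟦⟨i, y⟩⟧ : EmbInfSimplex h k.unop)) e.pullback_id
  map_comp {j k l} θ η := by
    ext x
    obtain ⟨i, e, rfl⟩ := DirectLimit.exists_eq_mk _ x
    exact congrArg (fun y => (⟦⟨i, y⟩⟧ : EmbInfSimplex h l.unop)) (e.pullback_comp η.unop θ.unop)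

/-- The action of `Top_∂(W)_k` on the `k`-simplices of `Emb^lf_∂(W, ℝ^∞)`. -/
def EmbInfSimplex.act {k : SimplexCategory} (φ : topBdry (2 * n) W k) :
    EmbInfSimplex h k → EmbInfSimplex h k :=
  DirectLimit.map (embTransition k) (embTransition k)
    (fun _ e => e.act φ) (fun _ _ _ _ => rfl)

end Emb

/-! ### Actions of simplicial groups and classifying spaces -/

section Classifying

/-- An action of a simplicial group on a simplicial set. -/
class SimplicialAction (G : SimplicialObject GrpCat.{u}) (X : SSet.{u}) where
  mulAction : ∀ k, MulAction (G.obj k) (X.obj k)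
  map_smul : ∀ {k l : SimplexCategoryᵒᵖ} (θ : k ⟶ l) (g : G.obj k) (x : X.obj k),
    X.map θ (g • x) = G.map θ g • X.map θ x

attribute [reducible, instance] SimplicialAction.mulAction

variable (G : SimplicialObject GrpCat.{u}) (X Y : SSet.{u}) [SimplicialAction G X]
  [SimplicialAction G Y]

/-- The action is free in each simplicial degree. -/
def IsLevelwiseFree : Prop :=
  ∀ (k : SimplexCategoryᵒᵖ) (g : G.obj k) (x : X.obj k), g • x = x → g = 1

/-- The quotient simplicial set `X / G`. -/
def orbitSpace : SSet.{u} where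
  obj k := MulAction.orbitRel.Quotient (G.obj k) (X.obj k)
  map {k l} θ := TypeCat.ofHom (Quotient.map' (s₁ := MulAction.orbitRel (G.obj k) (X.obj k))
    (s₂ := MulAction.orbitRel (G.obj l) (X.obj l)) (X.map θ) (by
      rintro _ y ⟨g, rfl⟩
      exact ⟨G.map θ g, (SimplicialAction.map_smul θ g y).symm⟩))
  map_id k := by
    ext x
    induction x using Quotient.inductionOn' with
    | _ x => exact congrArg Quotient.mk'' (by simp)
  map_comp θ η := by
    ext x
    induction x using Quotient.inductionOn' with
    | _ x => exact congrArg Quotient.mk'' (by simp)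

variable {X Y} in
/-- Equivariance of a map of simplicial sets with `G`-action. -/
def IsEquivariant (F : X ⟶ Y) : Prop :=
  ∀ (k : SimplexCategoryᵒᵖ) (g : G.obj k) (x : X.obj k), F.app k (g • x) = g • F.app k x

variable {X Y} in
/-- The map `X / G ⟶ Y / G` induced by an equivariant map. -/
def orbitMap (F : X ⟶ Y) (hF : IsEquivariant G F) : orbitSpace G X ⟶ orbitSpace G Y where
  app k := TypeCat.ofHom (Quotient.map' (s₁ := MulAction.orbitRel (G.obj k) (X.obj k))
    (s₂ := MulAction.orbitRel (G.obj k) (Y.obj k)) (F.app k) (by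
      rintro _ y ⟨g, rfl⟩
      exact ⟨g, (hF k g y).symm⟩))
  naturality k l θ := by
    ext x
    induction x using Quotient.inductionOn' with
    | _ x => exact congrArg Quotient.mk'' (NatTrans.naturality_apply F θ x)

/-- The universal `G`-space `EG`: the diagonal of the bisimplicial set obtained by applying to each
group `G_k` the construction with `p`-simplices `G_k^{p+1}`. So `(EG)_k = G_k^{k+1}`, and
`θ : [l] → [k]` sends `(g_0, …, g_k)` to `(θ^* g_{θ 0}, …, θ^* g_{θ l})`. -/
def EG : SSet.{u} where
  obj k := Fin (k.unop.len + 1) → G.obj k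
  map θ := TypeCat.ofHom fun g i => G.map θ (g (θ.unop i))
  map_id k := by
    ext g i
    simp
  map_comp θ η := by
    ext g i
    simp

/-- `G` acts on `EG` by simultaneous left multiplication. -/
instance : SimplicialAction G (EG G) where
  mulAction k := inferInstanceAs (MulAction (G.obj k) (Fin (k.unop.len + 1) → G.obj k))
  map_smul θ g x := funext fun i => map_mul (G.map θ).hom g (x (θ.unop i))

/-- The classifying space `BG = EG / G`. It is the diagonal of the bisimplicial set obtained by
taking the nerve of each group `G_k`. -/
def BG : SSet.{u} := orbitSpace G (EG G)

end Classifying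

/-- `Top_∂(W)` acts on `Emb^lf_∂(W, ℝ^∞)`, by `φ • e = e ∘ φ⁻¹`. -/
instance {n : ℕ} {W : Type u} [TopologicalSpace W]
    (h : BdrySphere n ≃ₜ manifoldBoundary (2 * n) W) :
    SimplicialAction (TopBdry (2 * n) W) (EmbInf h) where
  mulAction k :=
    { smul := fun φ x => EmbInfSimplex.act (k := k.unop) φ x
      one_smul := fun x => by
        obtain ⟨i, e, rfl⟩ := DirectLimit.exists_eq_mk _ x
        exact congrArg (fun y => (⟦⟨i, y⟩⟧ : EmbInfSimplex h k.unop)) e.act_one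
      mul_smul := fun φ ψ x => by
        obtain ⟨i, e, rfl⟩ := DirectLimit.exists_eq_mk _ x
        exact congrArg (fun y => (⟦⟨i, y⟩⟧ : EmbInfSimplex h k.unop)) (e.act_mul φ ψ) }
  map_smul {k l} θ φ x := by
    obtain ⟨i, e, rfl⟩ := DirectLimit.exists_eq_mk _ x
    exact congrArg (fun y => (⟦⟨i, y⟩⟧ : EmbInfSimplex h l.unop)) (e.pullback_act θ.unop φ)

/-! ### Weak contractibility and weak equivalences -/

/-- A simplicial set is weakly contractible if its geometric realization is non-empty and has
trivial homotopy groups (including `π₀`) at all base points. -/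
def IsWeaklyContractible (X : SSet.{u}) : Prop :=
  Nonempty |X| ∧ ∀ (m : ℕ) (x : |X|), Subsingleton (HomotopyGroup.Pi m |X| x)

/-- A map of simplicial sets is an equivalence if its geometric realization is a homotopy
equivalence. (Realizations are CW complexes, for which weak equivalences are homotopy
equivalences.) -/
def IsRealizationEquiv {X Y : SSet.{u}} (f : X ⟶ Y) : Prop :=
  ∃ e : ContinuousMap.HomotopyEquiv |X| |Y|, e.toFun = (SSet.toTop.map f).hom

end LFEmb

end

/-! The heart of the matter is that the space of embeddings is trivially fibrant over the point:
every family over `∂Δᵏ` extends over `Δᵏ` (`isTrivFib_EmbInf`). Both conclusions follow formally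
from this and from freeness.

In `ℝ^∞` an embedding carries no more information than a continuous injection. Compactness of `W`
turns continuous injections into embeddings, and the collar is standard, so a simplex of the colimit
amounts to an `IsStableFamily` of maps `W → ℝ^ℕ × ℝ` (`IsStableFamily.exists_stable_eq`). Local
flatness comes for free after adding `2n` coordinates (`isLocallyFlatEmbeddingOver_stab`): a local
injection of the manifold into `ℝ²ⁿ` is extended by Tietze from the image to the ambient space, and
the shear along the graph of this extension straightens the embedding.

To fill a boundary, the families on the faces are glued, and Tietze extends the result to a map that
need not be injective in the interior of `Δᵏ`. Injectivity is restored by adding `l(t) ι(w)` in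
fresh coordinates, where `l` vanishes exactly on `∂Δᵏ`, and `ι` vanishes on `∂W` and is injective on
the interior of `W` (`IsStableFamily.exists_extension`).

The action is free because embeddings are injective. For the classifying map, `EG` is also trivially
fibrant, by Moore's argument that simplicial groups satisfy the Kan condition (`isTrivFib_EG`).
Hence both projections of `X × EG` are trivial fibrations, and they remain so after dividing by `G`
(`isTrivFib_orbitMap`). A section of `(X × EG)/G → X/G`, followed by the map to `BG`, is an
equivalence, and by freeness it lifts to an equivariant map `X → EG` (`exists_classifyingMap`).

Lifting against monomorphisms yields simplicial homotopies. They are realized through the prism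
decomposition of `Δᵏ × I` (`homotopic_toTop_map`), so trivial fibrations become homotopy
equivalences, and a space trivially fibrant over the point has contractible realization. -/

noncomputable section

namespace LFEmb

/-! ### Points of geometric realizations -/

section Realization

open MonoidalCategory

variable {X Y : SSet.{u}}

/-- The characteristic map `Δᵏ → |X|` of a `k`-simplex `x` of `X`. -/
def charMap {k : SimplexCategory} (x : X.obj (op k)) : C(Simp k, |X|) :=
  TopCat.toSSetObjEquiv |X| (op k) ((sSetTopAdj.unit.app X).app (op k) x)

theorem charMap_map {j k : SimplexCategory} (θ : j ⟶ k) (x : X.obj (op k)) (t : Simp j) :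
    charMap (X.map θ.op x) t = charMap x (simpMap θ t) := by
  have h := ConcreteCategory.congr_hom ((sSetTopAdj.unit.app X).naturality θ.op) x
  exact congrArg (fun y => TopCat.toSSetObjEquiv |X| (op j) y t) h

theorem toTop_map_charMap (f : X ⟶ Y) {k : SimplexCategory} (x : X.obj (op k)) (t : Simp k) :
    SSet.toTop.map f (charMap x t) = charMap (f.app (op k) x) t := by
  have h := sSetTopAdj.unit.naturality f
  have h2 := congrArg (fun g => TopCat.toSSetObjEquiv |Y| (op k) (g.app (op k) x) t) h
  exact h2.symm

/-- A compatible family of maps `Δᵏ → T` glues to a map `|X| → T`. -/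
theorem exists_toTop_desc {T : TopCat.{u}}
    (φ : ∀ {k : SimplexCategory}, X.obj (op k) → C(Simp k, T))
    (hφ : ∀ {j k : SimplexCategory} (θ : j ⟶ k) (x : X.obj (op k)) (t : Simp j),
      φ (X.map θ.op x) t = φ x (simpMap θ t)) :
    ∃ g : |X| ⟶ T, ∀ {k : SimplexCategory} (x : X.obj (op k)) (t : Simp k),
      g (charMap x t) = φ x t := by
  -- The compatible family is a simplicial map to the singular set of `T`; its adjoint is the
  -- required map.
  let s : X ⟶ TopCat.toSSet.obj T :=
    { app := fun k => TypeCat.ofHom fun x => (TopCat.toSSetObjEquiv T k).symm (φ x)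
      naturality := fun k l θ => by
        ext x
        apply (TopCat.toSSetObjEquiv T l).injective
        ext t
        exact hφ θ.unop x t }
  refine ⟨(sSetTopAdj.homEquiv X T).symm s, fun {k} x t => ?_⟩
  have h := (sSetTopAdj.homEquiv_unit X T ((sSetTopAdj.homEquiv X T).symm s)).symm.trans
    (Equiv.apply_symm_apply _ _)
  have h2 := congrArg (fun g => TopCat.toSSetObjEquiv T (op k) (g.app (op k) x) t) h
  exact h2

theorem toTop_hom_ext {T : TopCat.{u}} {f g : |X| ⟶ T}
    (h : ∀ {k : SimplexCategory} (x : X.obj (op k)) (t : Simp k),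
      f (charMap x t) = g (charMap x t)) : f = g := by
  apply (sSetTopAdj.homEquiv X T).injective
  rw [Adjunction.homEquiv_unit, Adjunction.homEquiv_unit]
  ext k x
  apply (TopCat.toSSetObjEquiv T k).injective
  ext t
  exact h x t

end Realization

/-! ### Points of simplices as measures on the vertices -/

section Simplex

/-- Change of variables for the pushforward of a measure, by grouping the sum along the fibres of
`f`. With `eq_of_sum_mul_eq` it reduces identities between points of simplices to computations with
a test function `g`. -/
theorem sum_map_mul {A B : Type*} [Fintype A] [Fintype B] (f : A → B) (t : stdSimplex ℝ A)
    (g : B → ℝ) : ∑ b, stdSimplex.map f t b * g b = ∑ a, t a * g (f a) := by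
  classical
  simp only [stdSimplex.map_coe, FunOnFinite.linearMap_apply_apply, Finset.sum_mul]
  rw [← Finset.sum_fiberwise (s := Finset.univ) (g := f)]
  refine Finset.sum_congr rfl fun b _ => ?_
  refine Finset.sum_congr rfl fun a ha => ?_
  rw [(Finset.mem_filter.1 ha).2]

theorem eq_of_sum_mul_eq {B : Type*} [Fintype B] {t t' : stdSimplex ℝ B}
    (h : ∀ g : B → ℝ, ∑ b, t b * g b = ∑ b, t' b * g b) : t = t' := by
  classical
  refine stdSimplex.ext (funext fun b => ?_)
  simpa [Pi.single_apply] using h (Pi.single b 1)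

end Simplex

/-! ### Simplicial homotopies and geometric realization -/

section Prism

variable {k : SimplexCategory}

/-- The sum of the barycentric coordinates of index `< j`. -/
def cumLT (j : Fin (k.len + 1)) (t : Simp k) : ℝ := ∑ i, t i * if i < j then 1 else 0

/-- The sum of the barycentric coordinates of index `≤ j`. -/
def cumLE (j : Fin (k.len + 1)) (t : Simp k) : ℝ := ∑ i, t i * if i ≤ j then 1 else 0

theorem cumLE_eq (j : Fin (k.len + 1)) (t : Simp k) : cumLE j t = cumLT j t + t j := by
  have : t j = ∑ i, t i * if i = j then 1 else 0 := by simp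
  rw [this, cumLE, cumLT, ← Finset.sum_add_distrib]
  refine Finset.sum_congr rfl fun i _ => ?_
  rw [← mul_add]
  congr 1
  rcases lt_trichotomy i j with h | h | h
  · simp [h, h.le, h.ne]
  · simp [h]
  · simp [h.ne', h.not_ge, h.not_gt]

/-- The pieces of the prism `Δᵏ × I`. -/
def prismPiece (k : SimplexCategory) (j : Fin (k.len + 1)) : Set (Simp k × unitInterval) :=
  {p | cumLT j p.1 ≤ p.2 ∧ (p.2 : ℝ) ≤ cumLE j p.1}

theorem continuous_coord (i : Fin (k.len + 1)) : Continuous (fun t : Simp k => t i) :=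
  (continuous_apply i).comp continuous_subtype_val

theorem continuous_cumLE (j : Fin (k.len + 1)) : Continuous (cumLE (k := k) j) :=
  continuous_finsetSum _ fun i _ => (continuous_coord i).mul continuous_const

theorem continuous_cumLT (j : Fin (k.len + 1)) : Continuous (cumLT (k := k) j) :=
  continuous_finsetSum _ fun i _ => (continuous_coord i).mul continuous_const

theorem isClosed_prismPiece (j : Fin (k.len + 1)) : IsClosed (prismPiece k j) := by
  have h1 := continuous_cumLE (k := k) j
  have h2 := continuous_cumLT (k := k) j
  have h3 : Continuous (fun p : Simp k × unitInterval => (p.2 : ℝ)) := by fun_prop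
  exact (isClosed_le (h2.comp continuous_fst) h3).inter (isClosed_le h3 (h1.comp continuous_fst))

theorem exists_mem_prismPiece (p : Simp k × unitInterval) : ∃ j, p ∈ prismPiece k j := by
  obtain ⟨t, s⟩ := p
  by_contra! hcon
  -- Consecutive pieces share a wall, so a height in no piece lies above every wall; but the last
  -- wall has height `1`.
  have key : ∀ m : ℕ, ∀ hm : m < k.len + 1, cumLE ⟨m, hm⟩ t < s := by
    intro m
    induction m with
    | zero =>
      intro hm
      have h0 : cumLT (⟨0, hm⟩ : Fin (k.len + 1)) t = 0 :=
        Finset.sum_eq_zero fun i _ => by simp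
      have := hcon ⟨0, hm⟩
      simp only [prismPiece, Set.mem_ofPred_eq, h0, not_and, not_le] at this
      exact this s.2.1
    | succ m ih =>
      intro hm
      have h0 : cumLT (⟨m + 1, hm⟩ : Fin (k.len + 1)) t = cumLE ⟨m, by omega⟩ t := by
        refine Finset.sum_congr rfl fun i _ => ?_
        simp [Fin.lt_def, Fin.le_def]
      have := hcon ⟨m + 1, hm⟩
      simp only [prismPiece, Set.mem_ofPred_eq, h0, not_and, not_le] at this
      exact this (ih _).le
  have h1 := key k.len (by omega)
  have h2 : cumLE (⟨k.len, by omega⟩ : Fin (k.len + 1)) t = 1 := by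
    rw [← stdSimplex.sum_eq_one t]
    refine Finset.sum_congr rfl fun i _ => ?_
    rw [if_pos, mul_one]
    rw [Fin.le_def]; simp only; omega
  exact absurd s.2.2 (by rw [← h2]; exact not_le.2 h1)

/-- Vertex `j` is doubled, and its mass `t j` is divided into `s - cumLT j t` on `j.castSucc` and
`cumLE j t - s` on `j.succ`. The two hypotheses say that these masses are nonnegative. -/
theorem prismPt_mem (j : Fin (k.len + 1)) (t : Simp k) (s : ℝ) (h1 : cumLT j t ≤ s)
    (h2 : s ≤ cumLE j t) : (fun a => stdSimplex.map j.succ.succAbove t a + (cumLE j t - s) *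
      ((if a = j.succ then 1 else 0) - if a = j.castSucc then 1 else 0)) ∈
        stdSimplex ℝ (Fin (k.len + 2)) := by
  refine ⟨fun a => ?_, ?_⟩
  · have h0 := stdSimplex.zero_le (stdSimplex.map j.succ.succAbove t) a
    by_cases ha : a = j.castSucc
    · subst ha
      have h3 : stdSimplex.map j.succ.succAbove t j.castSucc = t j := by
        have h4 := sum_map_mul j.succ.succAbove t (Pi.single j.castSucc 1)
        have h5 : ∀ i, j.succ.succAbove i = j.castSucc ↔ i = j := fun i => by
          rw [← Fin.succAbove_succ_self j, Fin.succAbove_right_inj]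
        simpa only [Pi.single_apply, h5, mul_ite, mul_one, mul_zero, Finset.sum_ite_eq',
          Finset.mem_univ, if_true] using h4
      rw [cumLE_eq] at h2
      simp only [h3, if_true, (Fin.castSucc_lt_succ (i := j)).ne, if_false, cumLE_eq]
      linarith
    · simp only [ha, if_false]
      split_ifs
      · linarith
      · simpa using h0
  · rw [Finset.sum_add_distrib, ← Finset.mul_sum, Finset.sum_sub_distrib,
      stdSimplex.sum_eq_one]
    simp

/-- The point of `Δᵏ⁺¹` which corresponds to a point of the `j`-th piece of the prism. -/
def prismPt (j : Fin (k.len + 1)) (p : prismPiece k j) : Simp ⦋k.len + 1⦌ :=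
  ⟨fun a => stdSimplex.map j.succ.succAbove p.1.1 a +
    (cumLE j p.1.1 - p.1.2) * ((if a = j.succ then 1 else 0) - if a = j.castSucc then 1 else 0),
    prismPt_mem j p.1.1 p.1.2 p.2.1 p.2.2⟩

theorem sum_prismPt (j : Fin (k.len + 1)) (p : prismPiece k j) (g : Fin (k.len + 2) → ℝ) :
    ∑ a, prismPt j p a * g a =
      ∑ i, p.1.1 i * (g (j.succ.succAbove i) +
        (if i ≤ j then 1 else 0) * (g j.succ - g j.castSucc)) -
      p.1.2 * (g j.succ - g j.castSucc) := by
  change ∑ a, (stdSimplex.map j.succ.succAbove p.1.1 a +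
    (cumLE j p.1.1 - p.1.2) * ((if a = j.succ then 1 else 0) -
      if a = j.castSucc then 1 else 0)) * g a = _
  simp only [add_mul, Finset.sum_add_distrib, mul_add, sum_map_mul]
  have h1 : ∀ c : ℝ, ∑ a, c * ((if a = j.succ then (1 : ℝ) else 0) -
      if a = j.castSucc then 1 else 0) * g a = c * (g j.succ - g j.castSucc) := fun c => by
    simp only [mul_assoc, ← Finset.mul_sum, sub_mul, Finset.sum_sub_distrib]
    simp
  rw [h1]
  simp only [cumLE, ← mul_assoc, ← Finset.sum_mul]
  ring

theorem continuous_prismPt (j : Fin (k.len + 1)) : Continuous (prismPt (k := k) j) := by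
  refine Continuous.subtype_mk (continuous_pi fun a => ?_) _
  have h1 := continuous_cumLE (k := k) j
  have h2 := stdSimplex.continuous_map (S := ℝ) j.succ.succAbove
  have h3 : Continuous (fun t : Simp k => stdSimplex.map j.succ.succAbove t a) :=
    (continuous_coord (k := ⦋k.len + 1⦌) a).comp h2
  fun_prop

/-- The degeneracy `[k + 1] → [k]` which takes the value `j` twice. -/
def prismDeg (j : Fin (k.len + 1)) : ⦋k.len + 1⦌ ⟶ k :=
  SimplexCategory.Hom.mk (Fin.predAboveOrderHom j)

/-- The map `[k + 1] → [1]` which is `0` exactly on the indices `≤ j`. -/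
def prismStep (j : Fin (k.len + 1)) : Fin (k.len + 2) →o Fin 2 where
  toFun a := if a ≤ j.castSucc then 0 else 1
  monotone' a b hab := by
    dsimp only
    split_ifs with h1 h2
    · exact le_rfl
    · exact Fin.zero_le _
    · exact absurd (hab.trans ‹_›) h1
    · exact le_rfl

/-- The map of `(k + 1)`-simplices of prisms induced by `θ`. -/
def prismMor {l k : SimplexCategory} (θ : l ⟶ k) (j : Fin (l.len + 1)) :
    (⦋l.len + 1⦌ : SimplexCategory) ⟶ ⦋k.len + 1⦌ :=
  SimplexCategory.Hom.mk
    { toFun := fun a => if a ≤ j.castSucc then (θ (j.predAbove a)).castSucc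
        else (θ (j.predAbove a)).succ
      monotone' := fun a b hab => by
        have h : θ (j.predAbove a) ≤ θ (j.predAbove b) :=
          θ.toOrderHom.monotone (Fin.predAbove_right_monotone j hab)
        dsimp only
        split_ifs with h1 h2
        · exact Fin.castSucc_le_castSucc_iff.2 h
        · exact (Fin.castSucc_le_castSucc_iff.2 h).trans Fin.castSucc_lt_succ.le
        · exact absurd (hab.trans ‹_›) h1
        · exact Fin.succ_le_succ_iff.2 h }

theorem predAbove_le {m : ℕ} {j : Fin m} {a : Fin (m + 1)} (h : a ≤ j.castSucc) :
    j.predAbove a ≤ j := by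
  rw [Fin.predAbove_of_le_castSucc _ _ h]
  exact h

theorem le_predAbove {m : ℕ} {j : Fin m} {a : Fin (m + 1)} (h : j.castSucc < a) :
    j ≤ j.predAbove a := by
  rw [Fin.predAbove_of_castSucc_lt _ _ h, Fin.le_def, Fin.val_pred]
  rw [Fin.lt_def, Fin.val_castSucc] at h
  omega

/-- The `j`-th simplex of the prism is the chain `a ↦ (j.predAbove a, prismStep j a)` in `[l] ×
[1]`. The map `θ × id` carries it into the chain of index `θ j`, and `prismMor` is the
factorization. This lemma and the next one check its two components. -/
theorem prismMor_comp_prismDeg {l k : SimplexCategory} (θ : l ⟶ k) (j : Fin (l.len + 1)) :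
    prismMor θ j ≫ prismDeg (θ j) = prismDeg j ≫ θ := by
  ext a : 3
  change (θ j).predAbove (if a ≤ j.castSucc then (θ (j.predAbove a)).castSucc
        else (θ (j.predAbove a)).succ) = θ (j.predAbove a)
  split_ifs with h
  · refine Fin.predAbove_castSucc_of_le _ _ (θ.toOrderHom.monotone ?_)
    exact predAbove_le h
  · refine Fin.predAbove_succ_of_le _ _ (θ.toOrderHom.monotone ?_)
    exact le_predAbove (not_le.1 h)

theorem prismStep_comp_prismMor {l k : SimplexCategory} (θ : l ⟶ k) (j : Fin (l.len + 1)) :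
    (prismStep (θ j)).comp (prismMor θ j).toOrderHom = prismStep j := by
  ext a : 2
  change (if (if a ≤ j.castSucc then (θ (j.predAbove a)).castSucc
        else (θ (j.predAbove a)).succ) ≤ (θ j).castSucc then (0 : Fin 2) else 1) =
      if a ≤ j.castSucc then 0 else 1
  by_cases h : a ≤ j.castSucc
  · rw [if_pos h, if_pos h, if_pos]
    refine Fin.castSucc_le_castSucc_iff.2 (θ.toOrderHom.monotone ?_)
    exact predAbove_le h
  · rw [if_neg h, if_neg h, if_neg]
    rw [not_le]
    refine lt_of_le_of_lt (Fin.castSucc_le_castSucc_iff.2 (θ.toOrderHom.monotone ?_))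
      Fin.castSucc_lt_succ
    exact le_predAbove (not_le.1 h)

/-- By monotonicity, `θ i < θ j` implies `i < j`, and `i ≤ j` implies `θ i ≤ θ j`; so the lower wall
can only sink and the upper wall can only rise. -/
theorem prismPiece_map {l k : SimplexCategory} (θ : l ⟶ k) (j : Fin (l.len + 1))
    {t : Simp l} {s : unitInterval} (h : (t, s) ∈ prismPiece l j) :
    (simpMap θ t, s) ∈ prismPiece k (θ j) := by
  refine ⟨le_trans ?_ h.1, h.2.trans ?_⟩
  · change ∑ b, stdSimplex.map θ t b * _ ≤ ∑ i, t i * _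
    rw [sum_map_mul]
    refine Finset.sum_le_sum fun i _ => mul_le_mul_of_nonneg_left ?_ (stdSimplex.zero_le t i)
    split_ifs with h1 h2
    · exact le_rfl
    · exact absurd (θ.toOrderHom.monotone (not_lt.1 h2)) (not_le.2 h1)
    · exact zero_le_one
    · exact le_rfl
  · change ∑ i, t i * _ ≤ ∑ b, stdSimplex.map θ t b * _
    rw [sum_map_mul]
    refine Finset.sum_le_sum fun i _ => mul_le_mul_of_nonneg_left ?_ (stdSimplex.zero_le t i)
    split_ifs with h1 h2
    · exact le_rfl
    · exact absurd (θ.toOrderHom.monotone h1) h2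
    · exact zero_le_one
    · exact le_rfl

theorem simpMap_prismPt {l k : SimplexCategory} (θ : l ⟶ k) (j : Fin (l.len + 1))
    {t : Simp l} {s : unitInterval} (h : (t, s) ∈ prismPiece l j) :
    simpMap (prismMor θ j) (prismPt j ⟨(t, s), h⟩) =
      prismPt (θ j) ⟨(simpMap θ t, s), prismPiece_map θ j h⟩ := by
  refine eq_of_sum_mul_eq fun g => ?_
  rw [sum_map_mul]
  refine (sum_prismPt j ⟨(t, s), h⟩ (fun a => g (prismMor θ j a))).trans
    (Eq.trans ?_ (sum_prismPt (θ j) ⟨(simpMap θ t, s), prismPiece_map θ j h⟩ g).symm)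
  change _ = ∑ b, stdSimplex.map θ t b * _ - _
  rw [sum_map_mul]
  have hs : prismMor θ j j.succ = (θ j).succ := by
    change (if _ then _ else _) = _
    rw [if_neg (not_le.2 Fin.castSucc_lt_succ), Fin.predAbove_succ_self]
  have hc : prismMor θ j j.castSucc = (θ j).castSucc := by
    change (if _ then _ else _) = _
    rw [if_pos le_rfl, Fin.predAbove_castSucc_self]
  rw [hs, hc]
  congr 1
  refine Finset.sum_congr rfl fun i _ => congrArg _ ?_
  by_cases hij : i ≤ j
  · have h3 : θ i ≤ θ j := θ.toOrderHom.monotone hij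
    have h4 : prismMor θ j (j.succ.succAbove i) = (θ i).castSucc := by
      rw [Fin.succAbove_of_castSucc_lt _ _ (Fin.castSucc_lt_succ_iff.2 hij)]
      change (if _ then _ else _) = _
      rw [if_pos (Fin.castSucc_le_castSucc_iff.2 hij), Fin.predAbove_castSucc_of_le _ _ hij]
    rw [h4, if_pos hij, if_pos h3,
      Fin.succAbove_of_castSucc_lt _ _ (Fin.castSucc_lt_succ_iff.2 h3)]
  · have h3 : θ j ≤ θ i := θ.toOrderHom.monotone (not_le.1 hij).le
    have h4 : prismMor θ j (j.succ.succAbove i) = (θ i).succ := by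
      rw [Fin.succAbove_of_le_castSucc _ _ (Fin.succ_le_castSucc_iff.2 (not_le.1 hij))]
      change (if _ then _ else _) = _
      rw [if_neg (not_le.2 (Fin.castSucc_lt_succ_iff.2 (not_le.1 hij).le)),
        Fin.predAbove_succ_of_le _ _ (not_le.1 hij).le]
    rw [h4, if_neg hij]
    -- An index `i > j` may be merged with `j` by `θ`; the correction term `g (succ) - g (castSucc)`
    -- accounts for exactly this case.
    rcases h3.eq_or_lt with h5 | h5
    · rw [← h5, if_pos le_rfl, Fin.succAbove_succ_self]
      ring
    · rw [if_neg (not_le.2 h5), Fin.succAbove_of_le_castSucc _ _ (Fin.succ_le_castSucc_iff.2 h5)]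

end Prism

/-! ### Realizing a simplicial homotopy -/

section Homotopy

open MonoidalCategory

variable {X Y : SSet.{u}} (H : X ⊗ Δ[1] ⟶ Y)

/-- The `j`-th `(k + 1)`-simplex of the prism on `x`. -/
def prismSimplex {k : SimplexCategory} (x : X.obj (op k)) (j : Fin (k.len + 1)) :
    Y.obj (op ⦋k.len + 1⦌) :=
  H.app (op ⦋k.len + 1⦌) (show X.obj _ × (Δ[1] : SSet.{u}).obj _ from
    (X.map (prismDeg j).op x, SSet.stdSimplex.objMk (prismStep j)))

theorem map_prismSimplex {l k : SimplexCategory} (θ : l ⟶ k) (x : X.obj (op k))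
    (j : Fin (l.len + 1)) :
    prismSimplex H (X.map θ.op x) j = Y.map (prismMor θ j).op (prismSimplex H x (θ j)) := by
  unfold prismSimplex
  refine Eq.trans ?_ (ConcreteCategory.congr_hom (H.naturality (prismMor θ j).op) _)
  refine congrArg (H.app _) (Prod.ext ?_ ?_)
  · change X.map (prismDeg j).op (X.map θ.op x) =
      X.map (prismMor θ j).op (X.map (prismDeg (θ j)).op x)
    rw [← ConcreteCategory.comp_apply, ← ConcreteCategory.comp_apply, ← X.map_comp, ← X.map_comp,
      ← op_comp, ← op_comp, prismMor_comp_prismDeg]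
  · exact congrArg SSet.stdSimplex.objMk (prismStep_comp_prismMor θ j).symm

/-- The coface map `[k] → [k + 1]` which omits `a`. -/
def prismFace {k : SimplexCategory} (a : Fin (k.len + 2)) : k ⟶ ⦋k.len + 1⦌ :=
  SimplexCategory.Hom.mk (Fin.succAboveOrderEmb a).toOrderHom

/-- Used for the two walls of a piece, where `a` is one of the two copies of `j`. Then the coface is
a section of the degeneracy, which gives back `x` in the first factor. -/
theorem map_prismFace_prismSimplex {k : SimplexCategory} (x : X.obj (op k)) (j : Fin (k.len + 1))
    {a : Fin (k.len + 2)} (ha : ∀ i, j.predAbove (a.succAbove i) = i)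
    {χ : Fin (k.len + 1) →o Fin 2} (hχ : ∀ i, prismStep j (a.succAbove i) = χ i) :
    Y.map (prismFace a).op (prismSimplex H x j) =
      H.app (op k) (show X.obj _ × (Δ[1] : SSet.{u}).obj _ from
        (x, SSet.stdSimplex.objMk χ)) := by
  unfold prismSimplex
  refine (ConcreteCategory.congr_hom (H.naturality (prismFace a).op) _).symm.trans ?_
  refine congrArg (H.app _) (Prod.ext ?_ ?_)
  · change X.map (prismFace a).op (X.map (prismDeg j).op x) = x
    have h : prismFace a ≫ prismDeg j = 𝟙 k := by
      ext i : 3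
      exact ha i
    rw [← ConcreteCategory.comp_apply, ← X.map_comp, ← op_comp, h]
    simp
  · refine congrArg SSet.stdSimplex.objMk (OrderHom.ext _ _ (funext hχ))

/-- The map `[k] → [1]` which is `0` exactly on the indices `< m`. -/
def stepLT (k : SimplexCategory) (m : ℕ) : Fin (k.len + 1) →o Fin 2 where
  toFun i := if (i : ℕ) < m then 0 else 1
  monotone' a b hab := by
    have hab' : (a : ℕ) ≤ b := hab
    dsimp only
    split_ifs
    · exact le_rfl
    · exact Fin.zero_le _
    · omega
    · exact le_rfl

/-- On the upper wall no mass is moved to `j.succ`, so the point lies on the face omitting it. The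
value depends on `j` only through `stepLT k (j + 1)`, which is also what the lower wall of the next
piece gives. -/
theorem charMap_prismSimplex_of_eq_cumLE {k : SimplexCategory} (x : X.obj (op k))
    (j : Fin (k.len + 1)) (p : prismPiece k j) (hp : (p.1.2 : ℝ) = cumLE j p.1.1) :
    charMap (prismSimplex H x j) (prismPt j p) =
      charMap (H.app (op k) (show X.obj _ × (Δ[1] : SSet.{u}).obj _ from
        (x, SSet.stdSimplex.objMk (stepLT k (j + 1))))) p.1.1 := by
  have h : prismPt j p = simpMap (prismFace j.succ) p.1.1 := by
    refine stdSimplex.ext (funext fun a => ?_)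
    change stdSimplex.map j.succ.succAbove p.1.1 a + (cumLE j p.1.1 - p.1.2) * _ =
      stdSimplex.map j.succ.succAbove p.1.1 a
    rw [hp, sub_self, zero_mul, add_zero]
  rw [h, ← charMap_map, map_prismFace_prismSimplex H x j (fun i => ?_) (fun i => ?_)]
  · by_cases hi : i ≤ j
    · rw [Fin.succAbove_of_castSucc_lt _ _ (Fin.castSucc_lt_succ_iff.2 hi),
        Fin.predAbove_castSucc_of_le _ _ hi]
    · rw [Fin.succAbove_of_le_castSucc _ _ (Fin.succ_le_castSucc_iff.2 (not_le.1 hi)),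
        Fin.predAbove_succ_of_le _ _ (not_le.1 hi).le]
  · change (if _ then _ else _) = (if _ then _ else _)
    refine if_congr ?_ rfl rfl
    rw [Nat.lt_succ_iff]
    by_cases hi : i ≤ j
    · rw [Fin.succAbove_of_castSucc_lt _ _ (Fin.castSucc_lt_succ_iff.2 hi)]
      rfl
    · rw [Fin.succAbove_of_le_castSucc _ _ (Fin.succ_le_castSucc_iff.2 (not_le.1 hi))]
      rw [← Fin.le_def]
      exact iff_of_false (not_le.2 (Fin.castSucc_lt_succ_iff.2 (not_le.1 hi).le)) hi

/-- On the lower wall the whole mass of `j` is moved to `j.succ`, so the point lies on the face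
omitting `j.castSucc`. -/
theorem charMap_prismSimplex_of_eq_cumLT {k : SimplexCategory} (x : X.obj (op k))
    (j : Fin (k.len + 1)) (p : prismPiece k j) (hp : (p.1.2 : ℝ) = cumLT j p.1.1) :
    charMap (prismSimplex H x j) (prismPt j p) =
      charMap (H.app (op k) (show X.obj _ × (Δ[1] : SSet.{u}).obj _ from
        (x, SSet.stdSimplex.objMk (stepLT k j)))) p.1.1 := by
  have h : prismPt j p = simpMap (prismFace j.castSucc) p.1.1 := by
    refine eq_of_sum_mul_eq fun g => (sum_prismPt j p g).trans ?_
    rw [sum_map_mul, hp, cumLT, Finset.sum_mul, ← Finset.sum_sub_distrib]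
    refine Finset.sum_congr rfl fun i _ => ?_
    rw [mul_assoc, ← mul_sub]
    congr 1
    change _ = g (j.castSucc.succAbove i)
    rcases lt_trichotomy i j with hi | hi | hi
    · rw [if_pos hi, if_pos hi.le, Fin.succAbove_of_castSucc_lt _ _ (Fin.castSucc_lt_succ_iff.2
        hi.le), Fin.succAbove_of_castSucc_lt _ _ (Fin.castSucc_lt_castSucc_iff.2 hi)]
      ring
    · rw [hi, if_pos le_rfl, if_neg (lt_irrefl _), Fin.succAbove_succ_self,
        Fin.succAbove_castSucc_self]
      ring
    · rw [if_neg hi.not_ge, if_neg hi.not_gt, Fin.succAbove_of_le_castSucc _ _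
        (Fin.succ_le_castSucc_iff.2 hi), Fin.succAbove_of_le_castSucc _ _
        (Fin.castSucc_le_castSucc_iff.2 hi.le)]
      ring
  rw [h, ← charMap_map, map_prismFace_prismSimplex H x j (fun i => ?_) (fun i => ?_)]
  · by_cases hi : i < j
    · rw [Fin.succAbove_of_castSucc_lt _ _ (Fin.castSucc_lt_castSucc_iff.2 hi),
        Fin.predAbove_castSucc_of_le _ _ hi.le]
    · rw [Fin.succAbove_of_le_castSucc _ _ (Fin.castSucc_le_castSucc_iff.2 (not_lt.1 hi)),
        Fin.predAbove_succ_of_le _ _ (not_lt.1 hi)]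
  · change (if _ then _ else _) = (if _ then _ else _)
    refine if_congr ?_ rfl rfl
    rw [← Fin.lt_def]
    by_cases hi : i < j
    · rw [Fin.succAbove_of_castSucc_lt _ _ (Fin.castSucc_lt_castSucc_iff.2 hi)]
      exact iff_of_true (Fin.castSucc_le_castSucc_iff.2 hi.le) hi
    · rw [Fin.succAbove_of_le_castSucc _ _ (Fin.castSucc_le_castSucc_iff.2 (not_lt.1 hi))]
      exact iff_of_false (not_le.2 (Fin.castSucc_lt_succ_iff.2 (not_lt.1 hi))) hi

theorem cumLT_succ {k : SimplexCategory} {m : ℕ} (hm : m + 1 < k.len + 1) (t : Simp k) :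
    cumLT (⟨m + 1, hm⟩ : Fin (k.len + 1)) t = cumLE ⟨m, by omega⟩ t := by
  refine Finset.sum_congr rfl fun i _ => ?_
  simp [Fin.lt_def, Fin.le_def]

/-- If a point lies in pieces `i ≤ m` and `m + 1`, then `s ≤ cumLE i ≤ cumLE m = cumLT (m + 1) ≤ s`.
So it lies on the common wall of pieces `m` and `m + 1`, and induction passes from one piece to its
neighbour. -/
theorem charMap_prismSimplex_of_le {k : SimplexCategory} (x : X.obj (op k))
    {p : Simp k × unitInterval} {i : Fin (k.len + 1)} (hi : p ∈ prismPiece k i) (m : ℕ)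
    (hm : m < k.len + 1) (him : (i : ℕ) ≤ m) (h2 : p ∈ prismPiece k ⟨m, hm⟩) :
    charMap (prismSimplex H x i) (prismPt i ⟨p, hi⟩) =
      charMap (prismSimplex H x ⟨m, hm⟩) (prismPt _ ⟨p, h2⟩) := by
  induction m with
  | zero =>
    obtain rfl : i = ⟨0, hm⟩ := Fin.ext (by simpa using him)
    rfl
  | succ m ih =>
    rcases him.eq_or_lt with h | h
    · obtain rfl : i = ⟨m + 1, hm⟩ := Fin.ext h
      rfl
    · have h3 : cumLE ⟨m, by omega⟩ p.1 ≤ p.2 := by rw [← cumLT_succ hm]; exact h2.1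
      have h4 : (p.2 : ℝ) = cumLE ⟨m, by omega⟩ p.1 := by
        refine le_antisymm (hi.2.trans ?_) h3
        refine Finset.sum_le_sum fun a _ =>
          mul_le_mul_of_nonneg_left ?_ (stdSimplex.zero_le p.1 a)
        have : ∀ a : Fin (k.len + 1), a ≤ i → a ≤ ⟨m, by omega⟩ := fun a ha =>
          ha.trans (Nat.lt_succ_iff.1 h)
        split_ifs with h5 h6
        · exact le_rfl
        · exact absurd (this _ h5) h6
        · exact zero_le_one
        · exact le_rfl
      have hmem : p ∈ prismPiece k ⟨m, by omega⟩ := by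
        refine ⟨?_, h4.le⟩
        rw [h4, cumLE_eq]
        exact le_add_of_nonneg_right (stdSimplex.zero_le _ _)
      rw [ih (by omega) (Nat.lt_succ_iff.1 h) hmem,
        charMap_prismSimplex_of_eq_cumLE H x _ ⟨p, hmem⟩ h4,
        charMap_prismSimplex_of_eq_cumLT H x _ ⟨p, h2⟩ (h4.trans (cumLT_succ hm _).symm)]

theorem charMap_prismSimplex_eq {k : SimplexCategory} (x : X.obj (op k))
    {p : Simp k × unitInterval} {i j : Fin (k.len + 1)} (hi : p ∈ prismPiece k i)
    (hj : p ∈ prismPiece k j) :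
    charMap (prismSimplex H x i) (prismPt i ⟨p, hi⟩) =
      charMap (prismSimplex H x j) (prismPt j ⟨p, hj⟩) := by
  rcases le_total i j with h | h
  · exact charMap_prismSimplex_of_le H x hi j j.2 h hj
  · exact (charMap_prismSimplex_of_le H x hj i i.2 h hi).symm

/-- The map `Δᵏ × I → |Y|` induced by a simplicial homotopy on a simplex. -/
def prismMap {k : SimplexCategory} (x : X.obj (op k)) (p : Simp k × unitInterval) : |Y| :=
  charMap (prismSimplex H x (exists_mem_prismPiece p).choose)
    (prismPt _ ⟨p, (exists_mem_prismPiece p).choose_spec⟩)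

theorem prismMap_eq {k : SimplexCategory} (x : X.obj (op k)) {p : Simp k × unitInterval}
    {j : Fin (k.len + 1)} (hj : p ∈ prismPiece k j) :
    prismMap H x p = charMap (prismSimplex H x j) (prismPt j ⟨p, hj⟩) :=
  charMap_prismSimplex_eq H x _ hj

theorem continuous_prismMap {k : SimplexCategory} (x : X.obj (op k)) :
    Continuous (prismMap H x) := by
  refine (locallyFinite_of_finite (fun j => prismPiece k j)).continuous
    (Set.iUnion_eq_univ_iff.2 exists_mem_prismPiece) isClosed_prismPiece fun j => ?_
  rw [continuousOn_iff_continuous_domRestrict]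
  have : (prismPiece k j).domRestrict (prismMap H x) =
      charMap (prismSimplex H x j) ∘ prismPt j := funext fun p => prismMap_eq H x p.2
  rw [this]
  exact (charMap (prismSimplex H x j)).continuous.comp (continuous_prismPt j)

theorem prismMap_map {l k : SimplexCategory} (θ : l ⟶ k) (x : X.obj (op k)) (t : Simp l)
    (s : unitInterval) : prismMap H (X.map θ.op x) (t, s) = prismMap H x (simpMap θ t, s) := by
  obtain ⟨j, hj⟩ := exists_mem_prismPiece (t, s)
  rw [prismMap_eq H _ hj, prismMap_eq H _ (prismPiece_map θ j hj), map_prismSimplex, charMap_map,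
    simpMap_prismPt]

/-- Time runs from `ι₁` to `ι₀`: at `s = 0` the point is on the lower wall of piece `0`, where
`stepLT k 0` is constantly `1`. -/
theorem prismMap_zero {k : SimplexCategory} (x : X.obj (op k)) (t : Simp k) :
    prismMap H x (t, 0) = charMap ((SSet.ι₁ ≫ H).app (op k) x) t := by
  have h0 : cumLT (0 : Fin (k.len + 1)) t = 0 := Finset.sum_eq_zero fun i _ => by simp
  have hp : (t, (0 : unitInterval)) ∈ prismPiece k 0 := by
    refine ⟨by rw [h0]; exact le_rfl, ?_⟩
    rw [cumLE_eq, h0, zero_add]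
    exact stdSimplex.zero_le _ _
  rw [prismMap_eq H x hp, charMap_prismSimplex_of_eq_cumLT H x 0 ⟨_, hp⟩ h0.symm]
  rfl

theorem prismMap_one {k : SimplexCategory} (x : X.obj (op k)) (t : Simp k) :
    prismMap H x (t, 1) = charMap ((SSet.ι₀ ≫ H).app (op k) x) t := by
  have h0 : cumLE (Fin.last k.len) t = 1 := by
    rw [← stdSimplex.sum_eq_one t]
    exact Finset.sum_congr rfl fun i _ => by rw [if_pos (Fin.le_last i), mul_one]
  have hp : (t, (1 : unitInterval)) ∈ prismPiece k (Fin.last k.len) := by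
    refine ⟨?_, by rw [h0]; exact le_rfl⟩
    rw [← sub_eq_iff_eq_add.2 (cumLE_eq (Fin.last k.len) t), h0]
    exact sub_le_self _ (stdSimplex.zero_le _ _)
  rw [prismMap_eq H x hp, charMap_prismSimplex_of_eq_cumLE H x _ ⟨_, hp⟩ h0.symm]
  have : stepLT k (Fin.last k.len + 1) = OrderHom.const _ 0 :=
    OrderHom.ext _ _ (funext fun i => if_pos i.2)
  rw [this]
  rfl

/-- A simplicial homotopy induces a homotopy of maps of geometric realizations. -/
theorem homotopic_toTop_map :
    ContinuousMap.Homotopic (SSet.toTop.map (SSet.ι₀ ≫ H)).hom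
      (SSet.toTop.map (SSet.ι₁ ≫ H)).hom := by
  -- Gluing into the path space of `|Y|` needs only the universal property of `|X|`, and avoids
  -- comparing `|X × Δ[1]|` with `|X| × I`. The homotopy is recovered by evaluation, which is
  -- continuous as `I` is locally compact.
  obtain ⟨g, hg⟩ := exists_toTop_desc (X := X) (T := TopCat.of C(unitInterval, |Y|))
    (fun {k} x => ContinuousMap.curry ⟨prismMap H x, continuous_prismMap H x⟩)
    (fun θ x t => ContinuousMap.ext fun s => prismMap_map H θ x t s)
  let ev (s : unitInterval) : TopCat.of C(unitInterval, |Y|) ⟶ |Y| :=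
    TopCat.ofHom ⟨fun f => f s, continuous_eval_const s⟩
  have h0 : g ≫ ev 0 = SSet.toTop.map (SSet.ι₁ ≫ H) := toTop_hom_ext fun x t => by
    rw [toTop_map_charMap, ← prismMap_zero]
    change g (charMap x t) 0 = _
    rw [hg]
    rfl
  have h1 : g ≫ ev 1 = SSet.toTop.map (SSet.ι₀ ≫ H) := toTop_hom_ext fun x t => by
    rw [toTop_map_charMap, ← prismMap_one]
    change g (charMap x t) 1 = _
    rw [hg]
    rfl
  have hc : Continuous (fun p : unitInterval × |X| => g p.2 p.1) := by
    have h2 : Continuous (fun p : unitInterval × |X| => ((g p.2 : C(unitInterval, |Y|)), p.1)) :=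
      (g.hom.continuous.comp continuous_snd).prodMk continuous_fst
    exact continuous_eval.comp h2
  exact ContinuousMap.Homotopic.symm ⟨⟨⟨fun p => g p.2 p.1, hc⟩,
    fun x => ConcreteCategory.congr_hom h0 x, fun x => ConcreteCategory.congr_hom h1 x⟩⟩

end Homotopy

/-! ### Homotopy groups of contractible spaces -/

section Cube

open unitInterval

variable {N : Type*}

/-- The expansion of the cube about its centre by a factor `2`, clamped to the cube. -/
def cubeExpand (y : I^N) : I^N :=
  fun i => Set.projIcc (0 : ℝ) 1 zero_le_one (2 * (y i : ℝ) - 1 / 2)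

/-- A function on the cube which vanishes on the boundary and is `1` wherever `cubeExpand` does not
take values in the boundary. -/
def cubeBump [Fintype N] (y : I^N) : I :=
  ∏ i, Set.projIcc (0 : ℝ) 1 zero_le_one (4 * min (y i : ℝ) (1 - y i))

/-- The straight line in the cube from `y` to `cubeExpand y`. -/
def cubeLine (s : I) (y : I^N) : I^N :=
  fun i => Set.projIcc (0 : ℝ) 1 zero_le_one
    ((1 - (s : ℝ)) * (y i : ℝ) + (s : ℝ) * (cubeExpand y i : ℝ))

theorem continuous_cubeExpand : Continuous (cubeExpand (N := N)) :=
  continuous_pi fun i => continuous_projIcc.comp (by fun_prop)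

theorem continuous_cubeBump [Fintype N] : Continuous (cubeBump (N := N)) :=
  continuous_finsetProd _ fun i _ => continuous_projIcc.comp (by fun_prop)

theorem continuous_cubeLine : Continuous (fun p : I × (I^N) => cubeLine p.1 p.2) := by
  refine continuous_pi fun i => continuous_projIcc.comp ?_
  have := continuous_cubeExpand (N := N)
  have h : Continuous (fun p : I × (I^N) => cubeExpand p.2 i) :=
    (continuous_apply i).comp (this.comp continuous_snd)
  fun_prop

theorem cubeLine_zero (y : I^N) : cubeLine 0 y = y := by
  funext i
  simp [cubeLine]

theorem cubeLine_one (y : I^N) : cubeLine 1 y = cubeExpand y := by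
  funext i
  simp [cubeLine]

theorem cubeBump_of_mem_boundary [Fintype N] {y : I^N} (hy : y ∈ Cube.boundary N) : cubeBump y = 0 := by
  obtain ⟨i, hi⟩ := hy
  refine Finset.prod_eq_zero (Finset.mem_univ i) (Set.projIcc_of_le_left _ ?_)
  rcases hi with hi | hi <;> simp [hi]

theorem cubeLine_mem_boundary (s : I) {y : I^N} (hy : y ∈ Cube.boundary N) :
    cubeLine s y ∈ Cube.boundary N := by
  obtain ⟨i, hi⟩ := hy
  refine ⟨i, ?_⟩
  rcases hi with hi | hi
  · left
    have : cubeExpand y i = 0 := Set.projIcc_of_le_left _ (by simp [hi])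
    simp [cubeLine, hi, this]
  · right
    have : cubeExpand y i = 1 := Set.projIcc_of_right_le _ (by simp only [hi]; norm_num)
    simp [cubeLine, hi, this]

/-- The constants are matched along the cube `[1/4, 3/4]^N`: inside it every factor of the bump is
`1`, and outside it some coordinate `2 y i - 1/2` is clamped to `0` or `1`. -/
theorem cubeBump_eq_one_or [Fintype N] (y : I^N) :
    cubeBump y = 1 ∨ cubeExpand y ∈ Cube.boundary N := by
  by_cases h : ∀ i, 1 ≤ 4 * min (y i : ℝ) (1 - y i)
  · exact Or.inl (Finset.prod_eq_one fun i _ => Set.projIcc_of_right_le _ (h i))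
  · push Not at h
    obtain ⟨i, hi⟩ := h
    refine Or.inr ⟨i, ?_⟩
    rcases le_total (y i : ℝ) (1 - y i) with h1 | h1
    · rw [min_eq_left h1] at hi
      exact Or.inl (Set.projIcc_of_le_left _ (by linarith))
    · rw [min_eq_right h1] at hi
      exact Or.inr (Set.projIcc_of_right_le _ (by linarith))

/-- The homotopy groups of a contractible space are trivial. -/
theorem subsingleton_homotopyGroup [Fintype N] {T : Type*} [TopologicalSpace T] {c : T}
    (H : (ContinuousMap.id T).Homotopy (ContinuousMap.const T c)) (x : T) :
    Subsingleton (HomotopyGroup N T x) := by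
  have key : ∀ f : GenLoop N T x, GenLoop.Homotopic f GenLoop.const := fun f => by
    have hH : ∀ y, H (0, y) = y := fun y => H.map_zero_left y
    have hH1 : ∀ y, H (1, y) = c := fun y => H.map_one_left y
    have hb := continuous_cubeBump (N := N)
    -- The contraction `H` may move the base point, so it is run only up to time `cubeBump y`, which
    -- is `0` on the boundary. The loop `mid` merely follows the track of `x` and back.
    let mid : C(I^N, T) := ⟨fun y => H (cubeBump y, x), by fun_prop⟩
    have h1 : f.1.HomotopicRel mid (Cube.boundary N) := by
      have hl := continuous_cubeLine (N := N)
      have hf := f.1.continuous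
      refine ⟨⟨⟨⟨fun p => H (p.1 * cubeBump p.2, f.1 (cubeLine p.1 p.2)), by fun_prop⟩,
        fun y => ?_, fun y => ?_⟩, fun s y hy => ?_⟩⟩
      · change H (0 * cubeBump y, f.1 (cubeLine 0 y)) = f.1 y
        rw [zero_mul, cubeLine_zero, hH]
      · change H (1 * cubeBump y, f.1 (cubeLine 1 y)) = H (cubeBump y, x)
        rw [one_mul, cubeLine_one]
        -- Where the bump is `1`, both sides have reached `c`; elsewhere the expanded loop already
        -- sits at the base point `x`.
        rcases cubeBump_eq_one_or y with h | h
        · rw [h, hH1, hH1]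
        · rw [f.2 _ h]
      · change H (s * cubeBump y, f.1 (cubeLine s y)) = f.1 y
        rw [cubeBump_of_mem_boundary hy, mul_zero, hH, f.2 _ hy,
          f.2 _ (cubeLine_mem_boundary s hy)]
    -- The track is undone by scaling its running time down to `0`.
    have h2 : mid.HomotopicRel (GenLoop.const (N := N) (x := x)).1 (Cube.boundary N) := by
      refine ⟨⟨⟨⟨fun p => H (σ p.1 * cubeBump p.2, x), by fun_prop⟩,
        fun y => ?_, fun y => ?_⟩, fun s y hy => ?_⟩⟩
      · change H (σ 0 * cubeBump y, x) = H (cubeBump y, x)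
        rw [symm_zero, one_mul]
      · change H (σ 1 * cubeBump y, x) = x
        rw [symm_one, zero_mul, hH]
      · change H (σ s * cubeBump y, x) = H (cubeBump y, x)
        rw [cubeBump_of_mem_boundary hy, mul_zero]
    exact h1.trans h2
  refine ⟨fun a b => ?_⟩
  induction a using Quotient.inductionOn with
  | _ f =>
    induction b using Quotient.inductionOn with
    | _ g => exact Quotient.sound ((key f).trans (key g).symm)

end Cube

/-! ### Trivial fibrations -/

section TrivialFibration

open MonoidalCategory

/-- Trivial fibrations of simplicial sets: the right lifting property against the boundary
inclusions. -/
abbrev IsTrivFib {Y Z : SSet.{u}} (p : Y ⟶ Z) : Prop := SSet.modelCategoryQuillen.I.{u}.rlp p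

theorem IsTrivFib.hasLiftingProperty {Y Z : SSet.{u}} {p : Y ⟶ Z} (hp : IsTrivFib p)
    {A B : SSet.{u}} (i : A ⟶ B) [Mono i] : HasLiftingProperty i p := by
  rw [IsTrivFib, ← SSet.rlp_monomorphisms] at hp
  exact hp i (MorphismProperty.monomorphisms.infer_property i)

/-- Two copies of a simplicial set. -/
def twoCopies (A : SSet.{u}) : SSet.{u} where
  obj k := A.obj k × Bool
  map θ := TypeCat.ofHom fun p => (A.map θ p.1, p.2)
  map_id k := by ext p <;> simp
  map_comp θ η := by ext p <;> simp

/-- The inclusion of both ends of the cylinder. -/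
def twoCopiesIncl (A : SSet.{u}) : twoCopies A ⟶ A ⊗ Δ[1] where
  app k := TypeCat.ofHom fun p => if p.2 then SSet.ι₁.app k p.1 else SSet.ι₀.app k p.1
  naturality k l θ := by
    ext ⟨a, b⟩
    cases b
    · exact ConcreteCategory.congr_hom (SSet.ι₀.naturality θ) a
    · exact ConcreteCategory.congr_hom (SSet.ι₁.naturality θ) a

instance (A : SSet.{u}) : Mono (twoCopiesIncl A) := by
  have : ∀ k, Mono ((twoCopiesIncl A).app k) := fun k => by
    rw [mono_iff_injective]
    rintro ⟨a, b⟩ ⟨a', b'⟩ h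
    have h1 := congrArg Prod.fst h
    have h2 := congrArg (fun q => SSet.stdSimplex.asOrderHom q.2 0) h
    cases b <;> cases b'
    · exact Prod.ext h1 rfl
    · exact absurd (show (0 : Fin 2) = 1 from h2) (by decide)
    · exact absurd (show (1 : Fin 2) = 0 from h2) (by decide)
    · exact Prod.ext h1 rfl
  exact NatTrans.mono_of_mono_app _

/-- Lift against the inclusion of the two ends of the cylinder on `A`: `f` and `g` prescribe the
ends, and the homotopy downstairs is constant. -/
theorem IsTrivFib.exists_homotopy {A Y Z : SSet.{u}} {p : Y ⟶ Z} (hp : IsTrivFib p)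
    {f g : A ⟶ Y} (hfg : f ≫ p = g ≫ p) :
    ∃ H : A ⊗ Δ[1] ⟶ Y, SSet.ι₀ ≫ H = f ∧ SSet.ι₁ ≫ H = g := by
  have := hp.hasLiftingProperty (twoCopiesIncl A)
  let fg : twoCopies A ⟶ Y :=
    { app := fun k => TypeCat.ofHom fun q => if q.2 then g.app k q.1 else f.app k q.1
      naturality := fun k l θ => by
        ext ⟨a, b⟩
        cases b
        · exact ConcreteCategory.congr_hom (f.naturality θ) a
        · exact ConcreteCategory.congr_hom (g.naturality θ) a }
  have sq : CommSq fg (twoCopiesIncl A) p (CartesianMonoidalCategory.fst A Δ[1] ≫ f ≫ p) := ⟨by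
    ext k ⟨a, b⟩
    cases b
    · rfl
    · rw [hfg]; rfl⟩
  refine ⟨sq.lift, ?_, ?_⟩
  · ext k a
    exact ConcreteCategory.congr_hom (NatTrans.congr_app sq.fac_left k) ((a, false) : _ × Bool)
  · ext k a
    exact ConcreteCategory.congr_hom (NatTrans.congr_app sq.fac_left k) ((a, true) : _ × Bool)

theorem IsTrivFib.homotopic {A Y Z : SSet.{u}} {p : Y ⟶ Z} (hp : IsTrivFib p)
    {f g : A ⟶ Y} (hfg : f ≫ p = g ≫ p) :
    ContinuousMap.Homotopic (SSet.toTop.map f).hom (SSet.toTop.map g).hom := by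
  obtain ⟨H, rfl, rfl⟩ := hp.exists_homotopy hfg
  exact homotopic_toTop_map H

/-- The empty simplicial set. -/
def emptySSet : SSet.{u} where
  obj _ := PEmpty
  map _ := 𝟙 _

/-- Lift the identity of `Z` against `∅ → Z`. -/
theorem IsTrivFib.exists_section {Y Z : SSet.{u}} {p : Y ⟶ Z} (hp : IsTrivFib p) :
    ∃ σ : Z ⟶ Y, σ ≫ p = 𝟙 Z := by
  let i : emptySSet.{u} ⟶ Z :=
    { app := fun k => TypeCat.ofHom PEmpty.elim
      naturality := fun k l θ => by ext x; exact x.elim }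
  let j : emptySSet.{u} ⟶ Y :=
    { app := fun k => TypeCat.ofHom PEmpty.elim
      naturality := fun k l θ => by ext x; exact x.elim }
  have : ∀ k, Mono (i.app k) := fun k => by
    rw [mono_iff_injective]
    exact fun x => x.elim
  have : Mono i := NatTrans.mono_of_mono_app _
  have := hp.hasLiftingProperty i
  have sq : CommSq j i p (𝟙 Z) := ⟨by ext k x; exact x.elim⟩
  exact ⟨sq.lift, sq.fac_right⟩

/-- The map to the point. -/
def toPt (X : SSet.{u}) : X ⟶ Δ[0] := SSet.stdSimplex.isTerminalObj₀.from X

/-- A simplicial set that is trivially fibrant over the point is weakly contractible. -/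
theorem isWeaklyContractible_of_isTrivFib {X : SSet.{u}} (hX : IsTrivFib (toPt X)) :
    IsWeaklyContractible X := by
  obtain ⟨σ, -⟩ := hX.exists_section
  have h := hX.homotopic (f := 𝟙 X) (g := toPt X ≫ σ)
    (SSet.stdSimplex.isTerminalObj₀.hom_ext _ _)
  refine ⟨⟨SSet.toTop.map σ default⟩, fun m x => ?_⟩
  rw [CategoryTheory.Functor.map_id, CategoryTheory.Functor.map_comp] at h
  obtain ⟨H⟩ := h
  refine subsingleton_homotopyGroup (c := SSet.toTop.map σ default)
    (H.cast rfl ?_) x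
  ext y
  change SSet.toTop.map σ (SSet.toTop.map (toPt X) y) = SSet.toTop.map σ default
  rw [Subsingleton.elim (SSet.toTop.map (toPt X) y) default]

end TrivialFibration

/-! ### Trivial fibrations in terms of fillings of boundaries -/

section TrivFibSimplices

variable {X Y Z : SSet.{u}}

/-- The simplex of the boundary of `Δ[n]` given by a map to `[n]` which omits a value. -/
def bdrySimplex {m : SimplexCategory} {n : ℕ} (θ : m ⟶ ⦋n⦌) (hθ : ∃ i, ∀ a, θ a ≠ i) :
    (∂Δ[n] : SSet.{u}).obj (op m) :=
  ⟨SSet.stdSimplex.objEquiv.symm θ, fun hs => by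
    obtain ⟨i, hi⟩ := hθ
    obtain ⟨a, ha⟩ := hs i
    exact hi a ha⟩

theorem exists_eq_bdrySimplex {n : ℕ} {m : SimplexCategory} (τ : (∂Δ[n] : SSet.{u}).obj (op m)) :
    ∃ (θ : m ⟶ ⦋n⦌) (hθ : ∃ i, ∀ a, θ a ≠ i), τ = bdrySimplex θ hθ := by
  refine ⟨SSet.stdSimplex.objEquiv τ.1, ?_, rfl⟩
  have h : ¬ Function.Surjective (SSet.stdSimplex.asOrderHom τ.1) := τ.2
  rw [Function.Surjective] at h
  push Not at h
  exact h

theorem map_bdrySimplex {l m : SimplexCategory} {n : ℕ} (η : l ⟶ m) (θ : m ⟶ ⦋n⦌)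
    (hθ : ∃ i, ∀ a, θ a ≠ i) (hθ' : ∃ i, ∀ a, (η ≫ θ) a ≠ i) (b : (∂Δ[n] : SSet.{u}) ⟶ X) :
    b.app _ (bdrySimplex (η ≫ θ) hθ') = X.map η.op (b.app _ (bdrySimplex θ hθ)) :=
  ConcreteCategory.congr_hom (b.naturality η.op) (bdrySimplex θ hθ)

theorem map_yonedaEquiv {m k : SimplexCategory} (θ : m ⟶ k) (f : SSet.stdSimplex.obj k ⟶ X) :
    X.map θ.op (SSet.yonedaEquiv f) = f.app (op m) (SSet.stdSimplex.objEquiv.symm θ) := by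
  obtain ⟨x, rfl⟩ := SSet.yonedaEquiv.symm.surjective f
  rw [Equiv.apply_symm_apply]
  rfl

/-- The lifting property that defines trivial fibrations, in terms of simplices. -/
theorem isTrivFib_iff {p : Y ⟶ Z} : IsTrivFib p ↔
    ∀ (n : ℕ) (b : (∂Δ[n] : SSet.{u}) ⟶ Y) (z : Z.obj (op ⦋n⦌)),
      (∀ {m : SimplexCategory} (θ : m ⟶ ⦋n⦌) (hθ : ∃ i, ∀ a, θ a ≠ i),
        p.app _ (b.app _ (bdrySimplex θ hθ)) = Z.map θ.op z) →
      ∃ y : Y.obj (op ⦋n⦌), p.app _ y = z ∧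
        ∀ {m : SimplexCategory} (θ : m ⟶ ⦋n⦌) (hθ : ∃ i, ∀ a, θ a ≠ i),
          Y.map θ.op y = b.app _ (bdrySimplex θ hθ) := by
  constructor
  · intro hp n b z hz
    have := hp.hasLiftingProperty (∂Δ[n] : (Δ[n] : SSet.{u}).Subcomplex).ι
    have sq : CommSq b (∂Δ[n] : (Δ[n] : SSet.{u}).Subcomplex).ι p (SSet.yonedaEquiv.symm z) := ⟨by
      ext k τ
      obtain ⟨θ, hθ, rfl⟩ := exists_eq_bdrySimplex (m := k.unop) τ
      exact hz θ hθ⟩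
    refine ⟨SSet.yonedaEquiv sq.lift, ?_, fun {m} θ hθ => ?_⟩
    · rw [← SSet.yonedaEquiv_comp, sq.fac_right, Equiv.apply_symm_apply]
    · rw [map_yonedaEquiv]
      exact ConcreteCategory.congr_hom (NatTrans.congr_app sq.fac_left (op m)) (bdrySimplex θ hθ)
  · rintro H _ _ _ ⟨n⟩
    refine ⟨fun {b z} sq => ?_⟩
    obtain ⟨y, hy, hb⟩ := H n b (SSet.yonedaEquiv z) fun {m} θ hθ => by
      rw [map_yonedaEquiv]
      exact ConcreteCategory.congr_hom (NatTrans.congr_app sq.w (op m)) (bdrySimplex θ hθ)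
    refine ⟨⟨⟨SSet.yonedaEquiv.symm y, ?_, ?_⟩⟩⟩
    · ext k τ
      obtain ⟨θ, hθ, rfl⟩ := exists_eq_bdrySimplex (m := k.unop) τ
      exact hb θ hθ
    · rw [SSet.yonedaEquiv_symm_comp, hy, Equiv.symm_apply_apply]

theorem isTrivFib_toPt_iff : IsTrivFib (toPt X) ↔
    ∀ (n : ℕ) (b : (∂Δ[n] : SSet.{u}) ⟶ X), ∃ x : X.obj (op ⦋n⦌),
      ∀ {m : SimplexCategory} (θ : m ⟶ ⦋n⦌) (hθ : ∃ i, ∀ a, θ a ≠ i),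
        X.map θ.op x = b.app _ (bdrySimplex θ hθ) := by
  have hsub : ∀ {m : SimplexCategory} (a b : (Δ[0] : SSet.{u}).obj (op m)), a = b :=
    fun a b => SSet.yonedaEquiv.symm.injective (SSet.stdSimplex.isTerminalObj₀.hom_ext _ _)
  rw [isTrivFib_iff]
  constructor
  · intro H n b
    obtain ⟨x, -, hx⟩ := H n b (SSet.yonedaEquiv (toPt _)) fun _ _ => hsub _ _
    exact ⟨x, hx⟩
  · intro H n b z _
    obtain ⟨x, hx⟩ := H n b
    exact ⟨x, hsub _ _, hx⟩

end TrivFibSimplices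

/-! ### The universal space of a simplicial group -/

section EGContractible

/-- Solving the equations `g i y = a i` in a group one after the other. -/
theorem exists_forall_map_eq {A ι : Type*} [Group A] [Fintype ι] [DecidableEq ι] (D : ι → ℕ)
    (g : ι → A →* A) (a : ι → A) (hga : ∀ i, g i (a i) = a i) (hgg : ∀ i y, g i (g i y) = g i y)
    (h1 : ∀ i i', i ≠ i' → D i ≤ D i' → ∀ y, g i' (g i y) = g i' (g i (g i' y)))
    (h2 : ∀ i i', i ≠ i' → D i ≤ D i' → g i' (g i (a i')) = g i' (a i)) :
    ∃ y, ∀ i, g i y = a i := by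
  suffices H : ∀ s : Finset ι, ∃ y, ∀ i ∈ s, g i y = a i by
    obtain ⟨y, hy⟩ := H Finset.univ
    exact ⟨y, fun i => hy i (Finset.mem_univ i)⟩
  intro s
  -- Because of the order dual, equations with large `D` are solved first: the new index `i`
  -- satisfies `D i ≤ D i'` for every solved `i'`.
  induction s using Finset.induction_on_max_value (fun i => OrderDual.toDual (D i)) with
  | empty => exact ⟨1, by simp⟩
  | insert i s his hmax ih =>
    obtain ⟨y, hy⟩ := ih
    -- Moore's correction. It solves equation `i` by idempotence. Under `g i'`, `h1` lets `y` be
    -- replaced by `a i'` in the middle factor, and by `h2` that factor cancels against the last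
    -- one.
    refine ⟨y * (g i y)⁻¹ * a i, fun i' hi' => ?_⟩
    rcases Finset.mem_insert.1 hi' with rfl | hi'
    · rw [map_mul, map_mul, map_inv, hgg, hga, mul_inv_cancel, one_mul]
    · have hne : i ≠ i' := fun h => his (h ▸ hi')
      have hD : D i ≤ D i' := hmax i' hi'
      rw [map_mul, map_mul, map_inv, h1 i i' hne hD, hy i' hi', h2 i i' hne hD]
      group

/-- The neighbour of `i` in the direction of `j`. -/
def moveTo {n : ℕ} (j i : Fin (n + 1)) : Fin (n + 1) :=
  if h : i < j then ⟨i + 1, by have := j.2; have : (i : ℕ) < j := h; omega⟩ else ⟨i - 1, by omega⟩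

/-- The monotone map which moves `i` one step towards `j` and fixes all other elements. -/
def moveHom {n : ℕ} (j i : Fin (n + 1)) (hij : i ≠ j) : (⦋n⦌ : SimplexCategory) ⟶ ⦋n⦌ :=
  SimplexCategory.Hom.mk
    { toFun := fun m => if m = i then moveTo j i else m
      monotone' := fun a b hab => by
        have hab' : (a : ℕ) ≤ b := hab
        have hij' : (i : ℕ) ≠ j := fun h => hij (Fin.ext h)
        rw [Fin.le_def]
        simp only [moveTo, Fin.ext_iff, Fin.lt_def]
        split_ifs <;> simp <;> omega }

theorem moveHom_apply {n : ℕ} {j i : Fin (n + 1)} (hij : i ≠ j) (m : Fin (n + 1)) :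
    moveHom j i hij m = if m = i then moveTo j i else m := rfl

theorem moveTo_ne {n : ℕ} {j i : Fin (n + 1)} (hij : i ≠ j) : moveTo j i ≠ i := by
  have hij' : (i : ℕ) ≠ j := fun h => hij (Fin.ext h)
  simp only [moveTo, Fin.lt_def, ne_eq, Fin.ext_iff]
  split_ifs <;> dsimp only <;> omega

theorem moveHom_ne {n : ℕ} {j i : Fin (n + 1)} (hij : i ≠ j) (m : Fin (n + 1)) :
    moveHom j i hij m ≠ i := by
  rw [moveHom_apply]
  split_ifs with h
  · exact moveTo_ne hij
  · exact h

theorem moveHom_of_ne {n : ℕ} {j i : Fin (n + 1)} (hij : i ≠ j) {m : Fin (n + 1)} (hm : m ≠ i) :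
    moveHom j i hij m = m := if_neg hm

/-- Thus `moveHom j i` is an idempotent retraction of `[n]` onto the face opposite `i`, and it
replaces the face map: all equations then live in the single group `G_n`. -/
theorem comp_moveHom {n : ℕ} {j i : Fin (n + 1)} (hij : i ≠ j) {m : SimplexCategory}
    {θ : m ⟶ ⦋n⦌} (hθ : ∀ a, θ a ≠ i) : θ ≫ moveHom j i hij = θ := by
  ext a : 3
  exact moveHom_of_ne hij (hθ a)

/-- A step towards `j` brings `i` strictly closer to `j`, so it cannot land on `i'`, which is at
least as far away as `i`. This dictates the order in which the faces are treated. -/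
theorem moveHom_comp_moveHom_ne {n : ℕ} {j i i' : Fin (n + 1)} (hij : i ≠ j) (hij' : i' ≠ j)
    (hD : Nat.dist i j ≤ Nat.dist i' j) (a : Fin (n + 1)) :
    (moveHom j i' hij' ≫ moveHom j i hij) a ≠ i' := by
  change moveHom j i hij (moveHom j i' hij' a) ≠ i'
  rw [moveHom_apply hij]
  split_ifs with h
  · intro h2
    have h3 : (i : ℕ) ≠ j := fun h => hij (Fin.ext h)
    rw [← h2] at hD
    revert hD
    simp only [moveTo, Fin.lt_def, Nat.dist]
    split_ifs <;> simp <;> omega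
  · exact moveHom_ne hij' a

variable (G : SimplicialObject GrpCat.{u})

/-- The universal space of a simplicial group is trivially fibrant over the point. -/
theorem isTrivFib_EG : IsTrivFib (toPt (EG G)) := by
  rw [isTrivFib_toPt_iff]
  intro n b
  let bb {m : SimplexCategory} (θ : m ⟶ ⦋n⦌) (hθ : ∃ i, ∀ a, θ a ≠ i) (a : Fin (m.len + 1)) :
      G.obj (op m) := (show Fin (m.len + 1) → G.obj (op m) from b.app _ (bdrySimplex θ hθ)) a
  have hbb : ∀ {l m : SimplexCategory} (η : l ⟶ m) (θ : m ⟶ ⦋n⦌) (hθ : ∃ i, ∀ a, θ a ≠ i)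
      (hθ' : ∃ i, ∀ a, (η ≫ θ) a ≠ i) (a : Fin (l.len + 1)),
      bb (η ≫ θ) hθ' a = G.map η.op (bb θ hθ (η a)) := fun η θ hθ hθ' a =>
    congrFun (map_bdrySimplex η θ hθ hθ' b) a
  have hcongr : ∀ {m : SimplexCategory} {θ θ' : m ⟶ ⦋n⦌} (h : θ = θ') (hθ : ∃ i, ∀ a, θ a ≠ i)
      (hθ' : ∃ i, ∀ a, θ' a ≠ i) (a : Fin (m.len + 1)), bb θ hθ a = bb θ' hθ' a := by
    rintro m θ _ rfl _ _ _
    rfl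
  have hmap : ∀ {m m' m'' : SimplexCategory} (η : m ⟶ m') (θ : m' ⟶ m'') (y : G.obj (op m'')),
      G.map η.op (G.map θ.op y) = G.map (η ≫ θ).op y := fun η θ y => by
    rw [op_comp, G.map_comp]
    rfl
  -- The entry at vertex `j` of an `n`-simplex of `EG` is constrained only by faces that contain
  -- `j`. So each entry is the filler of a horn in `G`, and the entries can be found independently.
  have key : ∀ j : Fin (n + 1), ∃ y : G.obj (op ⦋n⦌), ∀ i : {i // i ≠ j},
      G.map (moveHom j i i.2).op y = bb (moveHom j i i.2) ⟨i, moveHom_ne i.2⟩ j := by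
    intro j
    have hfix : ∀ i : {i // i ≠ j}, moveHom j i i.2 j = j := fun i => moveHom_of_ne i.2 i.2.symm
    have hbb' : ∀ (i : {i // i ≠ j}) (θ : ⦋n⦌ ⟶ ⦋n⦌) (hθ : θ j = j)
        (h' : ∃ a, ∀ c, (θ ≫ moveHom j i i.2) c ≠ a),
        G.map θ.op (bb (moveHom j i i.2) ⟨i, moveHom_ne i.2⟩ j) =
          bb (θ ≫ moveHom j i i.2) h' j := fun i θ hθ h' => by
      rw [hbb θ _ ⟨i, moveHom_ne i.2⟩ h', hθ]
    have hself : ∀ i : {i // i ≠ j}, moveHom j i i.2 ≫ moveHom j i i.2 = moveHom j i i.2 :=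
      fun i => comp_moveHom i.2 (moveHom_ne i.2)
    refine exists_forall_map_eq (fun i : {i // i ≠ j} => Nat.dist i j)
      (fun i => (G.map (moveHom j i i.2).op).hom)
      (fun i => bb (moveHom j i i.2) ⟨i, moveHom_ne i.2⟩ j) (fun i => ?_) (fun i y => ?_)
      (fun i i' hne hD y => ?_) (fun i i' hne hD => ?_)
    · exact (hbb' i _ (hfix i) (by rw [hself]; exact ⟨i, moveHom_ne i.2⟩)).trans
        (hcongr (hself i) _ _ _)
    · refine (hmap _ _ y).trans ?_
      rw [hself]
    · have h : moveHom j i' i'.2 ≫ moveHom j i i.2 =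
          moveHom j i' i'.2 ≫ moveHom j i i.2 ≫ moveHom j i' i'.2 := by
        rw [← Category.assoc, comp_moveHom i'.2
          (moveHom_comp_moveHom_ne i.2 i'.2 hD)]
      refine (hmap _ _ y).trans ?_
      rw [h, ← hmap, ← hmap]
    · have h := comp_moveHom i'.2
        (moveHom_comp_moveHom_ne i.2 i'.2 hD)
      have hb : ∃ a, ∀ c, (moveHom j i' i'.2 ≫ moveHom j i i.2) c ≠ a :=
        ⟨i, fun c => moveHom_ne i.2 _⟩
      refine (hmap _ _ _).trans ?_
      refine (hbb' i' _ ?_ (by rw [h]; exact hb)).trans ((hcongr h _ hb _).trans ?_)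
      · change moveHom j i i.2 (moveHom j i' i'.2 j) = j
        rw [hfix, hfix]
      · exact (hbb' i _ (hfix i') hb).symm
  choose y hy using key
  refine ⟨y, fun {m} θ hθ => funext fun a => ?_⟩
  change G.map θ.op (y (θ a)) = bb θ hθ a
  obtain ⟨i, hi⟩ := hθ
  have hia : i ≠ θ a := (hi a).symm
  -- A map omitting `i` factors through the retraction that moves `i` towards `θ a`, which is one of
  -- the equations solved for the entry at `θ a`.
  have h := comp_moveHom hia hi
  rw [← hcongr h ⟨i, by rwa [h]⟩ _ a, hbb θ _ ⟨i, moveHom_ne hia⟩, ← hy (θ a) ⟨i, hia⟩]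
  exact (congrArg (fun τ : m ⟶ ⦋n⦌ => G.map τ.op (y (θ a))) h.symm).trans (hmap _ _ _).symm

end EGContractible

/-! ### Quotients by free actions -/

section Quotients

variable (G : SimplicialObject GrpCat.{u})

section

variable {G} {P A : SSet.{u}} [SimplicialAction G P] [SimplicialAction G A]

/-- The class of a simplex in the quotient. -/
def orbitMk (k : SimplexCategoryᵒᵖ) (x : P.obj k) : (orbitSpace G P).obj k :=
  Quotient.mk'' (s₁ := MulAction.orbitRel (G.obj k) (P.obj k)) x

theorem orbitMk_surjective (k : SimplexCategoryᵒᵖ) :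
    Function.Surjective (orbitMk (G := G) (P := P) k) := Quotient.mk''_surjective

theorem orbitMk_eq_iff {k : SimplexCategoryᵒᵖ} {x y : P.obj k} :
    orbitMk (G := G) k x = orbitMk k y ↔ ∃ g : G.obj k, g • y = x :=
  Quotient.eq''

theorem orbitMk_smul {k : SimplexCategoryᵒᵖ} (g : G.obj k) (x : P.obj k) :
    orbitMk (G := G) k (g • x) = orbitMk k x :=
  orbitMk_eq_iff.2 ⟨g, rfl⟩

theorem orbitMk_map {k l : SimplexCategoryᵒᵖ} (θ : k ⟶ l) (x : P.obj k) :
    orbitMk (G := G) l (P.map θ x) = (orbitSpace G P).map θ (orbitMk k x) := rfl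

theorem orbitMap_orbitMk (F : P ⟶ A) (hF : IsEquivariant G F) {k : SimplexCategoryᵒᵖ}
    (x : P.obj k) : (orbitMap G F hF).app k (orbitMk k x) = orbitMk k (F.app k x) := rfl

/-- If `A` is free, the square of quotient maps of an equivariant map `F : P → A` is a pullback. -/
theorem existsUnique_orbitMk_eq (F : P ⟶ A) (hF : IsEquivariant G F) (hA : IsLevelwiseFree G A)
    {k : SimplexCategoryᵒᵖ} (q : (orbitSpace G P).obj k) (a : A.obj k)
    (h : (orbitMap G F hF).app k q = orbitMk k a) :
    ∃! y : P.obj k, orbitMk k y = q ∧ F.app k y = a := by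
  obtain ⟨y, rfl⟩ := orbitMk_surjective k q
  rw [orbitMap_orbitMk, eq_comm, orbitMk_eq_iff] at h
  obtain ⟨g, hg⟩ := h
  refine ⟨g • y, ⟨orbitMk_smul g y, (hF k g y).trans hg⟩, ?_⟩
  rintro y' ⟨h1, h2⟩
  obtain ⟨g', rfl⟩ := orbitMk_eq_iff.1 h1
  rw [hF k g' y, ← hg] at h2
  have : g⁻¹ * g' = 1 := hA k _ (F.app k y) (by rw [mul_smul, h2, inv_smul_smul])
  rw [inv_mul_eq_one.1 this]

/-- The map of quotients induced by an equivariant trivial fibration to a free space is a trivial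
fibration. -/
theorem isTrivFib_orbitMap {F : P ⟶ A} (hF : IsEquivariant G F) (hA : IsLevelwiseFree G A)
    (hp : IsTrivFib F) : IsTrivFib (orbitMap G F hF) := by
  rw [isTrivFib_iff] at hp ⊢
  intro n b z hz
  obtain ⟨a, rfl⟩ := orbitMk_surjective _ z
  -- With the lift `a` of `z` fixed, each boundary simplex of `P / G` has exactly one representative
  -- over the matching face of `a`. Uniqueness makes the representatives a simplicial map to `P`.
  have key : ∀ (k : SimplexCategoryᵒᵖ) (τ : (∂Δ[n] : SSet.{u}).obj k), ∃! y : P.obj k,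
      orbitMk k y = b.app k τ ∧ F.app k y = (SSet.yonedaEquiv.symm a).app k τ.1 := fun k τ => by
    refine existsUnique_orbitMk_eq F hF hA _ _ ?_
    obtain ⟨θ, hθ, rfl⟩ := exists_eq_bdrySimplex (m := k.unop) τ
    exact hz θ hθ
  choose y hy hy' using key
  let b' : (∂Δ[n] : SSet.{u}) ⟶ P :=
    { app := fun k => TypeCat.ofHom (y k)
      naturality := fun k l θ => by
        ext τ
        refine (hy' l _ _ ⟨?_, ?_⟩).symm
        · change orbitMk l (P.map θ (y k τ)) = _
          rw [orbitMk_map, (hy k τ).1]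
          exact (ConcreteCategory.congr_hom (b.naturality θ) τ).symm
        · change F.app l (P.map θ (y k τ)) = _
          rw [NatTrans.naturality_apply, (hy k τ).2]
          exact (ConcreteCategory.congr_hom ((SSet.yonedaEquiv.symm a).naturality θ) τ.1).symm }
  obtain ⟨x, hx, hx'⟩ := hp n b' a fun θ hθ => (hy _ (bdrySimplex θ hθ)).2
  refine ⟨orbitMk _ x, ?_, fun {m} θ hθ => ?_⟩
  · rw [orbitMap_orbitMk, hx]
  · rw [← orbitMk_map, hx' θ hθ]
    exact (hy _ (bdrySimplex θ hθ)).1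

end

/-- A section of a trivial fibration, followed by a trivial fibration, is an equivalence. -/
theorem isRealizationEquiv_section_comp {Q Y Z : SSet.{u}} {p : Q ⟶ Y} {q : Q ⟶ Z}
    (hp : IsTrivFib p) (hq : IsTrivFib q) {σ : Y ⟶ Q} (hσ : σ ≫ p = 𝟙 Y) :
    IsRealizationEquiv (σ ≫ q) := by
  obtain ⟨τ, hτ⟩ := hq.exists_section
  have h1 : ContinuousMap.Homotopic (SSet.toTop.map (σ ≫ q ≫ τ)).hom (SSet.toTop.map σ).hom :=
    hq.homotopic (by simp [hτ])
  have h2 : ContinuousMap.Homotopic (SSet.toTop.map (τ ≫ p ≫ σ)).hom (SSet.toTop.map τ).hom :=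
    hp.homotopic (by simp [hσ])
  -- The inverse is `τ ≫ p`. The maps `σ ≫ q ≫ τ` and `σ` agree after `q`, hence are homotopic, and
  -- composing with `p` gives the identity of `Y`; symmetrically for `Z`.
  refine ⟨⟨(SSet.toTop.map (σ ≫ q)).hom, (SSet.toTop.map (τ ≫ p)).hom, ?_, ?_⟩, rfl⟩
  · have h3 := (ContinuousMap.Homotopic.refl (SSet.toTop.map p).hom).comp h1
    rw [← TopCat.hom_comp, ← TopCat.hom_comp, ← CategoryTheory.Functor.map_comp,
      ← CategoryTheory.Functor.map_comp, hσ, CategoryTheory.Functor.map_id, TopCat.hom_id] at h3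
    rw [← TopCat.hom_comp, ← CategoryTheory.Functor.map_comp]
    simpa only [Category.assoc] using h3
  · have h3 := (ContinuousMap.Homotopic.refl (SSet.toTop.map q).hom).comp h2
    rw [← TopCat.hom_comp, ← TopCat.hom_comp, ← CategoryTheory.Functor.map_comp,
      ← CategoryTheory.Functor.map_comp, hτ, CategoryTheory.Functor.map_id, TopCat.hom_id] at h3
    rw [← TopCat.hom_comp, ← CategoryTheory.Functor.map_comp]
    simpa only [Category.assoc] using h3

/-- The product of two simplicial sets. -/
def prodSSet (A B : SSet.{u}) : SSet.{u} where
  obj k := A.obj k × B.obj k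
  map θ := TypeCat.ofHom fun p => (A.map θ p.1, B.map θ p.2)
  map_id k := by ext p <;> simp
  map_comp θ η := by ext p <;> simp

variable (A B : SSet.{u})

/-- The first projection. -/
def prodFst : prodSSet A B ⟶ A where
  app k := TypeCat.ofHom Prod.fst

/-- The second projection. -/
def prodSnd : prodSSet A B ⟶ B where
  app k := TypeCat.ofHom Prod.snd

variable {A B} in
theorem isTrivFib_prodFst (hB : IsTrivFib (toPt B)) : IsTrivFib (prodFst A B) := by
  rw [isTrivFib_toPt_iff] at hB
  rw [isTrivFib_iff]
  intro n b z hz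
  obtain ⟨x, hx⟩ := hB n (b ≫ prodSnd A B)
  exact ⟨(z, x), rfl, fun {m} θ hθ => Prod.ext (hz θ hθ).symm (hx θ hθ)⟩

variable {A B} in
theorem isTrivFib_prodSnd (hA : IsTrivFib (toPt A)) : IsTrivFib (prodSnd A B) := by
  rw [isTrivFib_toPt_iff] at hA
  rw [isTrivFib_iff]
  intro n b z hz
  obtain ⟨x, hx⟩ := hA n (b ≫ prodFst A B)
  exact ⟨(x, z), rfl, fun {m} θ hθ => Prod.ext (hx θ hθ) (hz θ hθ).symm⟩

/-- The diagonal action on a product. -/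
instance [SimplicialAction G A] [SimplicialAction G B] : SimplicialAction G (prodSSet A B) where
  mulAction k := inferInstanceAs (MulAction (G.obj k) (A.obj k × B.obj k))
  map_smul θ g x := Prod.ext (SimplicialAction.map_smul θ g x.1) (SimplicialAction.map_smul θ g x.2)

theorem isLevelwiseFree_EG : IsLevelwiseFree G (EG G) := fun _ _ _ h =>
  mul_eq_right.1 (congrFun h 0)

/-- A free, trivially fibrant `G`-space maps equivariantly to `EG`, with a homotopy equivalence of
quotients. -/
theorem exists_classifyingMap {X : SSet.{u}} [SimplicialAction G X] (hfree : IsLevelwiseFree G X)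
    (hX : IsTrivFib (toPt X)) :
    ∃ (F : X ⟶ EG G) (hF : IsEquivariant G F),
      IsRealizationEquiv (X := orbitSpace G X) (Y := BG G) (orbitMap G F hF) := by
  have hfst : IsEquivariant G (prodFst X (EG G)) := fun k g x => rfl
  have hsnd : IsEquivariant G (prodSnd X (EG G)) := fun k g x => rfl
  have hp : IsTrivFib (orbitMap G _ hfst) :=
    isTrivFib_orbitMap hfst hfree (isTrivFib_prodFst (isTrivFib_EG G))
  have hq : IsTrivFib (orbitMap G _ hsnd) :=
    isTrivFib_orbitMap hsnd (isLevelwiseFree_EG G) (isTrivFib_prodSnd hX)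
  obtain ⟨σ, hσ⟩ := hp.exists_section
  -- Since `X` is free, the section `σ` of quotients has a unique lift to a section of `X × EG → X`.
  -- Uniqueness gives both naturality and equivariance.
  have key : ∀ (k : SimplexCategoryᵒᵖ) (x : X.obj k), ∃! y : (prodSSet X (EG G)).obj k,
      orbitMk k y = σ.app k (orbitMk k x) ∧ (prodFst X (EG G)).app k y = x := fun k x =>
    existsUnique_orbitMk_eq _ hfst hfree _ _
      (ConcreteCategory.congr_hom (NatTrans.congr_app hσ k) (orbitMk k x))
  choose y hy hy' using key
  let F : X ⟶ EG G :=
    { app := fun k => TypeCat.ofHom fun x => (prodSnd X (EG G)).app k (y k x)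
      naturality := fun k l θ => by
        refine ConcreteCategory.hom_ext _ _ fun x => ?_
        have h : (prodSSet X (EG G)).map θ (y k x) = y l (X.map θ x) := by
          refine hy' l _ _ ⟨?_, ?_⟩
          · rw [orbitMk_map, (hy k x).1, orbitMk_map]
            exact (ConcreteCategory.congr_hom (σ.naturality θ) _).symm
          · exact (ConcreteCategory.congr_hom ((prodFst X (EG G)).naturality θ) (y k x)).trans
              (congrArg (X.map θ) (hy k x).2)
        change (prodSnd X (EG G)).app l (y l (X.map θ x)) = _
        rw [← h]
        rfl }
  have hF : IsEquivariant G F := fun k g x => by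
    have h : g • y k x = y k (g • x) := by
      refine hy' k _ _ ⟨?_, ?_⟩
      · rw [orbitMk_smul, orbitMk_smul, (hy k x).1]
      · rw [hfst k g, (hy k x).2]
    change (prodSnd X (EG G)).app k (y k (g • x)) = _
    rw [← h]
    exact hsnd k g _
  have hFq : orbitMap G F hF = σ ≫ orbitMap G _ hsnd := by
    ext k q
    obtain ⟨x, rfl⟩ := orbitMk_surjective k q
    change orbitMk k (F.app k x) = (orbitMap G _ hsnd).app k (σ.app k (orbitMk k x))
    rw [← (hy k x).1]
    rfl
  refine ⟨F, hF, ?_⟩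
  exact hFq ▸ isRealizationEquiv_section_comp hp hq hσ

end Quotients

/-! ### The collared manifold -/

section CollarGeometry

variable {n : ℕ} {W : Type u} [TopologicalSpace W]
  (h : BdrySphere n ≃ₜ manifoldBoundary (2 * n) W)

theorem Collared.inr_zero (s : BdrySphere n) :
    Collared.inr h (s, ⟨0, Set.mem_Iic.2 le_rfl⟩) = Collared.inl h (h s) :=
  (Quot.sound ⟨s, rfl, rfl⟩).symm

/-- The projection of the collared manifold to `W`. -/
def Collared.retract : Collared h → W :=
  Quot.lift (Sum.elim id (fun p => (h p.1 : W))) (by rintro _ _ ⟨s, rfl, rfl⟩; rfl)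

theorem Collared.retract_inl (w : W) : Collared.retract h (Collared.inl h w) = w := rfl

theorem Collared.inl_injective : Function.Injective (Collared.inl h) :=
  Function.LeftInverse.injective (Collared.retract_inl h)

theorem Collared.continuous_inl : Continuous (Collared.inl h) :=
  continuous_quot_mk.comp _root_.continuous_inl

theorem Collared.continuous_inr : Continuous (Collared.inr h) :=
  continuous_quot_mk.comp _root_.continuous_inr

theorem Collared.continuous_retract : Continuous (Collared.retract h) := by
  refine continuous_quot_lift _ (continuous_sum_dom.2 ⟨continuous_id, ?_⟩)
  change Continuous fun p : BdrySphere n × Set.Iic (0 : ℝ) => (h p.1 : W)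
  fun_prop

theorem continuous_height : Continuous (height h) := by
  refine continuous_quot_lift _ (continuous_sum_dom.2 ⟨continuous_const, ?_⟩)
  change Continuous fun p : BdrySphere n × Set.Iic (0 : ℝ) => (p.2 : ℝ)
  fun_prop

theorem height_nonpos (x : Collared h) : height h x ≤ 0 :=
  Collared.cases h (P := fun x => height h x ≤ 0) (fun _ => le_rfl) (fun p => p.2.2) x

theorem retract_mem_of_height_neg {x : Collared h} (hx : height h x < 0) :
    Collared.retract h x ∈ manifoldBoundary (2 * n) W := by
  revert hx
  exact Collared.cases h (P := fun x => height h x < 0 → Collared.retract h x ∈ _)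
    (fun _ hx => absurd hx (lt_irrefl _)) (fun p _ => (h p.1).2) x

theorem Collared.eq_of_retract_of_height {x y : Collared h}
    (h1 : Collared.retract h x = Collared.retract h y) (h2 : height h x = height h y) : x = y := by
  revert h1 h2
  have key : ∀ (w : W) (p : BdrySphere n × Set.Iic (0 : ℝ)), w = h p.1 → 0 = (p.2 : ℝ) →
      Collared.inl h w = Collared.inr h p := by
    rintro _ ⟨s, u⟩ rfl h2
    rw [← Collared.inr_zero]
    exact congrArg (fun v => Collared.inr h (s, v)) (Subtype.ext h2)
  refine Collared.cases h (P := fun x => Collared.retract h x = Collared.retract h y →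
    height h x = height h y → x = y) (fun w => ?_) (fun p => ?_) x
  · refine Collared.cases h (P := fun y => w = Collared.retract h y → 0 = height h y →
      Collared.inl h w = y) (fun w' h1 _ => congrArg _ h1) (fun p' h1 h2 => key w p' h1 h2) y
  · refine Collared.cases h (P := fun y => (h p.1 : W) = Collared.retract h y →
      (p.2 : ℝ) = height h y → Collared.inr h p = y) (fun w' h1 h2 => ?_) (fun p' h1 h2 => ?_) y
    · exact (key w' p h1.symm h2.symm).symm
    · exact congrArg _ (Prod.ext (h.injective (Subtype.ext h1)) (Subtype.ext h2))

theorem inl_mem_collar_iff {ε : ℝ} (hε : 0 < ε) (w : W) :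
    Collared.inl h w ∈ collar h ε ↔ w ∈ manifoldBoundary (2 * n) W := by
  constructor
  · rintro ⟨p, -, hp⟩
    have : w = h p.1 := congrArg (Collared.retract h) hp
    rw [this]
    exact (h p.1).2
  · intro hw
    obtain ⟨s, hs⟩ := h.surjective ⟨w, hw⟩
    refine ⟨(s, ⟨0, Set.mem_Iic.2 le_rfl⟩), by simpa using hε, ?_⟩
    rw [Collared.inr_zero, hs]

theorem neg_lt_height {ε : ℝ} (hε : 0 < ε) {x : Collared h} (hx : x ∈ collared h ε) :
    -ε < height h x := by
  rcases hx with ⟨w, rfl⟩ | ⟨p, hp, rfl⟩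
  · exact neg_lt_zero.2 hε
  · exact hp

theorem isClosed_manifoldBoundary (d : ℕ) : IsClosed (manifoldBoundary d W) := by
  have : (manifoldBoundary d W)ᶜ =
      ⋃ e : OpenPartialHomeomorph W (EuclideanSpace ℝ (Fin d)), e.source := by
    ext x
    simp [manifoldBoundary]
  rw [← isOpen_compl_iff, this]
  exact isOpen_iUnion fun e => e.open_source

/-- Cutting the collar at a finite depth leaves a closed subset of a union of two compact images. On
such pieces continuous injections into Hausdorff spaces are closed embeddings. -/
theorem isCompact_collar_piece {K : Set W} (hK : IsCompact K) (hK' : IsClosed K) (R : ℝ) :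
    IsCompact (Collared.retract h ⁻¹' K ∩ height h ⁻¹' Set.Ici (-R)) := by
  have h1 : IsCompact ((fun s : BdrySphere n => (h s : W)) ⁻¹' K) :=
    (hK'.preimage (continuous_subtype_val.comp h.continuous)).isCompact
  have h2 : IsCompact ((fun u : Set.Iic (0 : ℝ) => (u : ℝ)) ⁻¹' Set.Icc (-R) 0) :=
    (isClosed_Iic.isClosedEmbedding_subtypeVal).isCompact_preimage isCompact_Icc
  have h3 : IsCompact (Collared.inl h '' K ∪ Collared.inr h '' (((fun s => (h s : W)) ⁻¹' K) ×ˢ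
      ((fun u : Set.Iic (0 : ℝ) => (u : ℝ)) ⁻¹' Set.Icc (-R) 0))) :=
    (hK.image (Collared.continuous_inl h)).union ((h1.prod h2).image (Collared.continuous_inr h))
  refine h3.of_isClosed_subset ((hK'.preimage (Collared.continuous_retract h)).inter
    (isClosed_Ici.preimage (continuous_height h))) fun x => ?_
  refine Collared.cases h (P := fun x => x ∈ Collared.retract h ⁻¹' K ∩ height h ⁻¹' Set.Ici (-R) →
    x ∈ _) (fun w hw => Or.inl ⟨w, hw.1, rfl⟩) (fun p hp => Or.inr ⟨p, ⟨hp.1, hp.2, p.2.2⟩, rfl⟩) x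

/-- Extension over the collar of a family of maps on `W`. -/
def collarDesc {T E : Type*} (f : T × W → E) (g : BdrySphere n × Set.Iic (0 : ℝ) → E)
    (hfg : ∀ t s, f (t, (h s : W)) = g (s, ⟨0, Set.mem_Iic.2 le_rfl⟩)) (p : T × Collared h) : E :=
  Quot.lift (Sum.elim (fun w => f (p.1, w)) g) (by
    rintro _ _ ⟨s, rfl, rfl⟩
    exact hfg p.1 s) p.2

/-- The product of a quotient map with a locally compact space is a quotient map, so continuity may
be tested on `W` and on the collar separately. -/
theorem continuous_collarDesc {T E : Type*} [TopologicalSpace T] [LocallyCompactSpace T]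
    [TopologicalSpace E] {f : T × W → E}
    {g : BdrySphere n × Set.Iic (0 : ℝ) → E} (hf : Continuous f) (hg : Continuous g)
    (hfg : ∀ t s, f (t, (h s : W)) = g (s, ⟨0, Set.mem_Iic.2 le_rfl⟩)) :
    Continuous (collarDesc h f g hfg) := by
  have hq : IsQuotientMap (Quot.mk (CollarRel h)) := isQuotientMap_quot_mk
  refine hq.continuous_lift_prod_right (Y := T) (X := Collared h) ?_
  have key : Continuous ((fun p : T × (W ⊕ (BdrySphere n × Set.Iic (0 : ℝ))) =>
      collarDesc h f g hfg (p.1, Quot.mk _ p.2)) ∘ Homeomorph.prodSumDistrib.symm) :=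
    continuous_sum_dom.2 ⟨hf, hg.comp continuous_snd⟩
  exact (Homeomorph.comp_continuous_iff' _).1 key

end CollarGeometry

/-! ### Charts -/

section Charts

variable {n : ℕ} [NeZero n] {W : Type u} [TopologicalSpace W]
  [ChartedSpace (EuclideanHalfSpace (2 * n)) W]

/-- The coordinates of the chart at `w`. -/
def chartCoord (w x : W) : Fin (2 * n) → ℝ :=
  fun i => (chartAt (EuclideanHalfSpace (2 * n)) w x).1 i

theorem continuousOn_chartCoord (w : W) :
    ContinuousOn (chartCoord (n := n) w) (chartAt (EuclideanHalfSpace (2 * n)) w).source := by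
  have h1 : Continuous (fun y : EuclideanHalfSpace (2 * n) => fun i => y.1 i) := by
    refine continuous_pi fun i => ?_
    have := continuous_subtype_val (p := fun x : EuclideanSpace ℝ (Fin (2 * n)) => 0 ≤ x 0)
    have h2 : Continuous (fun x : EuclideanSpace ℝ (Fin (2 * n)) => x i) := by fun_prop
    exact h2.comp this
  exact h1.comp_continuousOn (chartAt (EuclideanHalfSpace (2 * n)) w).continuousOn

theorem injOn_chartCoord (w : W) :
    Set.InjOn (chartCoord (n := n) w) (chartAt (EuclideanHalfSpace (2 * n)) w).source := by
  intro x hx y hy hxy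
  refine (chartAt (EuclideanHalfSpace (2 * n)) w).injOn hx hy (Subtype.ext ?_)
  ext i
  exact congrFun hxy i

theorem chartCoord_zero_nonneg (w x : W) : 0 ≤ chartCoord (n := n) w x 0 :=
  (chartAt (EuclideanHalfSpace (2 * n)) w x).2

/-- The interior of the half-space as an open partial homeomorphism. -/
def halfSpaceInterior (d : ℕ) [NeZero d] :
    OpenPartialHomeomorph (EuclideanHalfSpace d) (EuclideanSpace ℝ (Fin d)) where
  toFun := modelWithCornersEuclideanHalfSpace d
  invFun := (modelWithCornersEuclideanHalfSpace d).symm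
  source := {x | 0 < x.1 0}
  target := {x | 0 < x 0}
  map_source' x hx := hx
  map_target' x hx := by
    have : modelWithCornersEuclideanHalfSpace d ((modelWithCornersEuclideanHalfSpace d).symm x) = x :=
      (modelWithCornersEuclideanHalfSpace d).right_inv (by
        rw [range_modelWithCornersEuclideanHalfSpace]
        exact (show 0 < x 0 from hx).le)
    change 0 < (modelWithCornersEuclideanHalfSpace d
      ((modelWithCornersEuclideanHalfSpace d).symm x)) 0
    rw [this]
    exact hx
  left_inv' x _ := (modelWithCornersEuclideanHalfSpace d).left_inv x
  right_inv' x hx := (modelWithCornersEuclideanHalfSpace d).right_inv (by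
    rw [range_modelWithCornersEuclideanHalfSpace]
    exact (show 0 < x 0 from hx).le)
  open_source := by
    refine isOpen_lt continuous_const ?_
    have h2 : Continuous (fun x : EuclideanSpace ℝ (Fin d) => x 0) := by fun_prop
    exact h2.comp continuous_subtype_val
  open_target := isOpen_lt continuous_const (by fun_prop)
  continuousOn_toFun := (modelWithCornersEuclideanHalfSpace d).continuous.continuousOn
  continuousOn_invFun := (modelWithCornersEuclideanHalfSpace d).continuous_symm.continuousOn

/-- Were the coordinate positive, the chart followed by the inclusion of the open half-space would
be a Euclidean chart at `x`. -/
theorem chartCoord_zero_of_mem_boundary {w x : W}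
    (hx : x ∈ (chartAt (EuclideanHalfSpace (2 * n)) w).source)
    (hb : x ∈ manifoldBoundary (2 * n) W) : chartCoord (n := n) w x 0 = 0 := by
  by_contra hne
  have hpos := lt_of_le_of_ne (chartCoord_zero_nonneg (n := n) w x) (Ne.symm hne)
  refine hb ((chartAt (EuclideanHalfSpace (2 * n)) w).trans (halfSpaceInterior (2 * n))) ?_
  rw [OpenPartialHomeomorph.trans_source]
  exact ⟨hx, hpos⟩

variable (h : BdrySphere n ≃ₜ manifoldBoundary (2 * n) W)

/-- Each point of the collared manifold has a compact neighbourhood with a continuous injection to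
`ℝ²ⁿ`. -/
theorem exists_collared_chart [T2Space W] [CompactSpace W] (x : Collared h) :
    ∃ (V K : Set (Collared h)) (j : Collared h → Fin (2 * n) → ℝ),
      IsOpen V ∧ x ∈ V ∧ V ⊆ K ∧ IsCompact K ∧ ContinuousOn j K ∧ Set.InjOn j K := by
  set w := Collared.retract h x with hw
  obtain ⟨K, hK, hwK, hKU⟩ := exists_compact_subset
    (chartAt (EuclideanHalfSpace (2 * n)) w).open_source (mem_chart_source _ w)
  -- Chosen so that `x` lies one unit above the cut at height `-R`.
  let R : ℝ := 1 - height h x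
  -- The collar is unfolded into the missing half-space: over it the zeroth chart coordinate
  -- vanishes and the negative height takes its place, while on `W` that coordinate is nonnegative.
  -- So its sign separates the two parts.
  let j : Collared h → Fin (2 * n) → ℝ := fun y =>
    chartCoord w (Collared.retract h y) + height h y • Pi.single 0 1
  have hj0 : ∀ y, j y 0 = chartCoord (n := n) w (Collared.retract h y) 0 + height h y := fun y => by
    simp [j]
  refine ⟨Collared.retract h ⁻¹' interior K ∩ height h ⁻¹' Set.Ioi (-R),
    Collared.retract h ⁻¹' K ∩ height h ⁻¹' Set.Ici (-R), j,
    (isOpen_interior.preimage (Collared.continuous_retract h)).inter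
      (isOpen_Ioi.preimage (continuous_height h)), ⟨hwK, ?_⟩,
    fun y hy => ⟨interior_subset (s := K) hy.1, (show -R < height h y from hy.2).le⟩,
    isCompact_collar_piece h hK hK.isClosed R, ?_, ?_⟩
  · change -(1 - height h x) < height h x
    linarith
  · refine ContinuousOn.add ?_ ?_
    · exact (continuousOn_chartCoord w).comp (Collared.continuous_retract h).continuousOn
        fun y hy => hKU hy.1
    · exact ((continuous_height h).smul continuous_const).continuousOn
  · have hneg : ∀ y, Collared.retract h y ∈ K → height h y < 0 → j y 0 = height h y :=
      fun y hy hy' => by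
        rw [hj0, chartCoord_zero_of_mem_boundary (hKU hy) (retract_mem_of_height_neg h hy'),
          zero_add]
    have hnn : ∀ y, height h y = 0 → 0 ≤ j y 0 := fun y hy => by
      rw [hj0, hy, add_zero]
      exact chartCoord_zero_nonneg _ _
    intro y hy z hz hyz
    have hh : height h y = height h z := by
      rcases (height_nonpos h y).lt_or_eq with h1 | h1 <;>
        rcases (height_nonpos h z).lt_or_eq with h2 | h2
      · rw [← hneg y hy.1 h1, ← hneg z hz.1 h2, hyz]
      · have := hnn z h2
        rw [← hyz, hneg y hy.1 h1] at this
        linarith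
      · have := hnn y h1
        rw [hyz, hneg z hz.1 h2] at this
        linarith
      · rw [h1, h2]
    refine Collared.eq_of_retract_of_height h ?_ hh
    refine injOn_chartCoord (n := n) w (hKU hy.1) (hKU hz.1) ?_
    have : chartCoord (n := n) w (Collared.retract h y) + height h y • Pi.single 0 1 =
      chartCoord w (Collared.retract h z) + height h z • Pi.single 0 1 := hyz
    rw [hh] at this
    exact add_right_cancel this

end Charts

/-! ### Stable local flatness -/

section StableFlat

instance (k : SimplexCategory) : CompactSpace (Simp k) :=
  isCompact_iff_compactSpace.1 (isCompact_stdSimplex ℝ _)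

/-- The coordinates of `ℝᶜ⁺ᵐ⁺¹` as a point of `ℝᵐ⁺ᶜ × ℝ`. -/
def splitLast {m c : ℕ} (s : Fin (c + m + 1) → ℝ) : (Fin (m + c) → ℝ) × ℝ :=
  (fun i => s ⟨i, by omega⟩, s (Fin.last _))

/-- The inverse of `splitLast`. -/
def joinLast {m c : ℕ} (x : (Fin (m + c) → ℝ) × ℝ) : Fin (c + m + 1) → ℝ :=
  fun i => if h : (i : ℕ) < m + c then x.1 ⟨i, h⟩ else x.2

theorem continuous_splitLast {m c : ℕ} : Continuous (splitLast (m := m) (c := c)) := by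
  unfold splitLast
  fun_prop

theorem continuous_joinLast {m c : ℕ} : Continuous (joinLast (m := m) (c := c)) := by
  refine continuous_pi fun i => ?_
  unfold joinLast
  split_ifs <;> fun_prop

theorem joinLast_splitLast {m c : ℕ} (s : Fin (c + m + 1) → ℝ) : joinLast (splitLast s) = s := by
  funext i
  simp only [joinLast, splitLast]
  split_ifs with hi
  · rfl
  · exact congrArg s (Fin.ext (by simp; omega))

/-- Appending coordinates to the first factor of `ℝᵐ⁺ᶜ × ℝ`. -/
def appendCoord {m c : ℕ} (p : ((Fin (m + c) → ℝ) × ℝ) × (Fin m → ℝ)) :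
    (Fin (m + (c + m)) → ℝ) × ℝ :=
  (fun i => if h : (i : ℕ) < m + c then p.1.1 ⟨i, h⟩ else p.2 ⟨i - (m + c), by omega⟩, p.1.2)

/-- The inverse of `appendCoord`. -/
def removeCoord {m c : ℕ} (z : (Fin (m + (c + m)) → ℝ) × ℝ) :
    ((Fin (m + c) → ℝ) × ℝ) × (Fin m → ℝ) :=
  ((fun i => z.1 ⟨i, by omega⟩, z.2), fun i => z.1 ⟨m + c + i, by omega⟩)

theorem continuous_appendCoord {m c : ℕ} : Continuous (appendCoord (m := m) (c := c)) := by
  refine Continuous.prodMk (continuous_pi fun i => ?_) (by fun_prop)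
  split_ifs <;> fun_prop

theorem continuous_removeCoord {m c : ℕ} : Continuous (removeCoord (m := m) (c := c)) := by
  unfold removeCoord
  fun_prop

theorem removeCoord_appendCoord {m c : ℕ} (p : ((Fin (m + c) → ℝ) × ℝ) × (Fin m → ℝ)) :
    removeCoord (appendCoord p) = p := by
  refine Prod.ext (Prod.ext (funext fun i => ?_) rfl) (funext fun i => ?_) <;>
    simp [removeCoord, appendCoord]

theorem appendCoord_zero {m c : ℕ} (x : (Fin (m + c) → ℝ) × ℝ) :
    appendCoord (x, 0) = stab x := rfl

/-- A family of embeddings, of a space that locally embeds in `ℝᵐ`, is locally flat after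
stabilization. -/
theorem isLocallyFlatEmbeddingOver_stab {B M : Type*} [TopologicalSpace B] [CompactSpace B]
    [TopologicalSpace.MetrizableSpace B] [TopologicalSpace M] {m c : ℕ} {S : Set M}
    {e : B × M → (Fin (m + c) → ℝ) × ℝ}
    (he : Continuous e) (hinj : ∀ b, Function.Injective fun x => e (b, x))
    (hchart : ∀ x : M, ∃ (V K : Set M) (j : M → Fin m → ℝ),
      IsOpen V ∧ x ∈ V ∧ V ⊆ K ∧ IsCompact K ∧ ContinuousOn j K ∧ Set.InjOn j K)
    (hS : ∃ K, IsCompact K ∧ S ⊆ K) :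
    IsLocallyFlatEmbeddingOver (c + m + 1)
      (fun p : B × S => (stab (e (p.1, p.2)) : (Fin (m + (c + m)) → ℝ) × ℝ)) := by
  have hclosed : ∀ K : Set M, IsCompact K →
      IsClosedEmbedding (fun p : B × K => (p.1, e (p.1, p.2))) := fun K hK => by
    have := isCompact_iff_compactSpace.1 hK
    refine Continuous.isClosedEmbedding (by fun_prop) ?_
    rintro ⟨b, x⟩ ⟨b', x'⟩ hbx
    obtain ⟨h1, h2⟩ := Prod.ext_iff.1 hbx
    obtain rfl : b = b' := h1
    exact Prod.ext rfl (Subtype.ext (hinj b h2))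
  refine ⟨?_, fun b x => ?_⟩
  · obtain ⟨K, hK, hSK⟩ := hS
    refine IsEmbedding.of_comp
      (g := fun q : B × ((Fin (m + (c + m)) → ℝ) × ℝ) => (q.1, (removeCoord q.2).1)) ?_ ?_ ?_
    · exact continuous_fst.prodMk (continuous_stab.comp (by fun_prop))
    · exact continuous_fst.prodMk
        (continuous_fst.comp (continuous_removeCoord.comp continuous_snd))
    · convert (hclosed K hK).isEmbedding.comp
        (IsEmbedding.id.prodMap (IsEmbedding.inclusion hSK)) using 1
      funext p
      change (p.1, (removeCoord (appendCoord (e (p.1, p.2), 0))).1) = (p.1, e (p.1, p.2))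
      rw [removeCoord_appendCoord]
  · obtain ⟨V, K, j, hV, hxV, hVK, hK, hjc, hji⟩ := hchart x
    have := isCompact_iff_compactSpace.1 hK
    have hjK : IsEmbedding (fun v : K => j v) :=
      (Continuous.isClosedEmbedding (continuousOn_iff_continuous_domRestrict.1 hjc)
        (Set.injOn_iff_injective.1 hji)).isEmbedding
    -- Tietze: `j`, viewed as a function on the closed image of `B × K`, extends to `B` times the
    -- ambient space.
    obtain ⟨J, hJ⟩ := ContinuousMap.exists_extension' (hclosed K hK)
      ⟨fun p : B × K => j p.2, hjK.continuous.comp continuous_snd⟩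
    have hJ' : ∀ b, ∀ v ∈ K, J (b, e (b, v)) = j v := fun b v hv =>
      congrFun hJ (b, ⟨v, hv⟩)
    refine ⟨Set.univ, (fun y : S => (y : M)) ⁻¹' V, isOpen_univ, trivial,
      hV.preimage continuous_subtype_val, hxV, ?_⟩
    set V' : Set S := (fun y : S => (y : M)) ⁻¹' V with hV'
    have hj : IsEmbedding (fun v : V' => j v.1.1) := by
      have h1 : IsEmbedding (fun v : V' => (⟨v.1.1, hVK v.2⟩ : K)) := by
        have h2 : IsEmbedding (fun v : V' => (v.1.1 : M)) :=
          IsEmbedding.subtypeVal.comp IsEmbedding.subtypeVal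
        exact h2.codRestrict K fun v => hVK v.2
      exact hjK.comp h1
    let ξ : (↥(Set.univ : Set B) × V') × (Fin (c + m + 1) → ℝ) → (Fin (m + c) → ℝ) × ℝ :=
      fun p => splitLast p.2 + e (p.1.1, p.1.2.1)
    have hξ : Continuous ξ := (continuous_splitLast.comp continuous_snd).add (by fun_prop)
    -- The normal vector first translates `e` in the old coordinates; the new ones record how far
    -- `J` at the translated point is from `j`. At normal vector `0` this difference vanishes.
    refine ⟨fun p => appendCoord (ξ p, j p.1.2.1.1 - J (p.1.1.1, ξ p)), ?_, fun y v => ?_⟩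
    · have hjc' : Continuous fun p : (↥(Set.univ : Set B) × V') × (Fin (c + m + 1) → ℝ) =>
          j p.1.2.1.1 := hj.continuous.comp (by fun_prop)
      -- The shear adding `J` to the new coordinates turns the map into `(b, v, s) ↦ (b, e + s, j
      -- v)`, which is an embedding because `j` determines `v`, and `e` and `v` then determine `s`.
      refine IsEmbedding.of_comp
        (g := fun q : B × ((Fin (m + (c + m)) → ℝ) × ℝ) => (q.1, ((removeCoord q.2).1,
          (removeCoord q.2).2 + J (q.1, (removeCoord q.2).1)))) ?_ ?_ ?_
      · refine Continuous.prodMk (by fun_prop) (continuous_appendCoord.comp ?_)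
        exact hξ.prodMk (hjc'.sub (J.continuous.comp (Continuous.prodMk (by fun_prop) hξ)))
      · have := continuous_removeCoord (m := m) (c := c)
        fun_prop
      · have h1 : IsEmbedding (fun p : (↥(Set.univ : Set B) × V') × (Fin (c + m + 1) → ℝ) =>
            (p.1, ξ p)) := by
          refine isEmbedding_of_leftInverse (r := fun q : (↥(Set.univ : Set B) × V') ×
            ((Fin (m + c) → ℝ) × ℝ) => (q.1, joinLast (q.2 - e (q.1.1, q.1.2.1)))) (by fun_prop)
            (continuous_fst.prodMk (continuous_joinLast.comp (by fun_prop))) fun p => ?_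
          refine Prod.ext rfl ?_
          change joinLast (splitLast p.2 + e (p.1.1, p.1.2.1) - e (p.1.1, p.1.2.1)) = p.2
          rw [add_sub_cancel_right, joinLast_splitLast]
        have h2 : IsEmbedding (fun q : (↥(Set.univ : Set B) × V') × ((Fin (m + c) → ℝ) × ℝ) =>
            ((q.1.1 : B), (q.2, j q.1.2.1.1))) := by
          have h3 : IsEmbedding (fun q : (↥(Set.univ : Set B) × V') × ((Fin (m + c) → ℝ) × ℝ) =>
              (((q.1.1 : B), j q.1.2.1.1), q.2)) :=
            (IsEmbedding.subtypeVal.prodMap hj).prodMap IsEmbedding.id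
          refine IsEmbedding.of_comp (g := fun q : B × (((Fin (m + c) → ℝ) × ℝ) × (Fin m → ℝ)) =>
            ((q.1, q.2.2), q.2.1)) ?_ (by fun_prop) h3
          have : Continuous fun q : (↥(Set.univ : Set B) × V') × ((Fin (m + c) → ℝ) × ℝ) =>
            j q.1.2.1.1 := hj.continuous.comp (by fun_prop)
          exact Continuous.prodMk (by fun_prop) (Continuous.prodMk (by fun_prop) this)
        convert h2.comp h1 using 1
        funext p
        simp only [Function.comp_apply, removeCoord_appendCoord, sub_add_cancel]
    · have h0 : ξ ((y, v), 0) = e (y, v) := by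
        change splitLast 0 + _ = _
        rw [show splitLast (0 : Fin (c + m + 1) → ℝ) = 0 from rfl, zero_add]
      simp only [h0]
      rw [hJ' _ _ (hVK v.2), sub_self, appendCoord_zero]

end StableFlat

/-! ### Simplices of the colimit as families of maps to `ℝ^∞` -/

section Stable

variable {n : ℕ} {W : Type u} [TopologicalSpace W]

/-- The standard inclusion `ℝᵃ → ℝ^ℕ` by zero coordinates. -/
def padNat {a : ℕ} (x : Fin a → ℝ) : ℕ → ℝ := fun i => if h : i < a then x ⟨i, h⟩ else 0

theorem padNat_injective {a : ℕ} : Function.Injective (padNat (a := a)) := by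
  intro x y hxy
  funext i
  simpa [padNat] using congrFun hxy i

theorem padNat_pad {a b : ℕ} (hab : a ≤ b) (x : Fin a → ℝ) :
    padNat (pad x : Fin b → ℝ) = padNat x := by
  funext i
  simp only [padNat, pad]
  split_ifs <;> first | rfl | omega

theorem continuous_padNat {a : ℕ} : Continuous (padNat (a := a)) := by
  refine continuous_pi fun i => ?_
  unfold padNat
  split_ifs <;> fun_prop

variable (h : BdrySphere n ≃ₜ manifoldBoundary (2 * n) W)

/-- A family over `D` of injections of `W` in a finite-dimensional subspace of `ℝ^ℕ × [0, ∞)`,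
standard on the boundary and with positive last coordinate elsewhere. -/
structure IsStableFamily {T : Type*} [TopologicalSpace T] (D : Set T)
    (f : T × W → (ℕ → ℝ) × ℝ) : Prop where
  continuousOn : ContinuousOn f (D ×ˢ Set.univ)
  bounded : ∃ M : ℕ, ∀ t ∈ D, ∀ w, ∀ i, M ≤ i → (f (t, w)).1 i = 0
  injective : ∀ t ∈ D, Function.Injective fun w => f (t, w)
  boundary : ∀ t ∈ D, ∀ s, f (t, (h s : W)) = (padNat fun i => s.1 i, 0)
  pos : ∀ t ∈ D, ∀ w, w ∉ manifoldBoundary (2 * n) W → 0 < (f (t, w)).2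

variable {h}

/-- The family of maps `W → ℝ^ℕ × ℝ` underlying a simplex of the space of embeddings. -/
def EmbSimplex.stable {c : ℕ} {ε : ℝ} {k : SimplexCategory} (e : EmbSimplex h c ε k)
    (p : Simp k × W) : (ℕ → ℝ) × ℝ :=
  (padNat (e.toFun (p.1, ⟨Collared.inl h p.2, Or.inl ⟨_, rfl⟩⟩)).1,
    (e.toFun (p.1, ⟨Collared.inl h p.2, Or.inl ⟨_, rfl⟩⟩)).2)

/-- Nothing is lost by restricting to `W`, since on the collar every simplex is standard. -/
theorem EmbSimplex.stable_injective {c : ℕ} {ε : ℝ} {k : SimplexCategory} :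
    Function.Injective (EmbSimplex.stable : EmbSimplex h c ε k → _) := by
  intro e e' hee
  refine EmbSimplex.ext (funext fun p => ?_)
  obtain ⟨t, x, ⟨w, rfl⟩ | ⟨q, hq, rfl⟩⟩ := p
  · have := congrFun hee (t, w)
    exact Prod.ext (padNat_injective (Prod.ext_iff.1 this).1) (Prod.ext_iff.1 this).2
  · rw [e.eq_std t q hq, e'.eq_std t q hq]

theorem EmbSimplex.stable_transition {c c' : ℕ} {ε ε' : ℝ} (hc : c ≤ c') (hε' : 0 < ε')
    (hε : ε' ≤ ε) {k : SimplexCategory} (e : EmbSimplex h c ε k) :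
    (e.transition hc hε' hε).stable = e.stable :=
  funext fun _ => Prod.ext (padNat_pad (by omega) _) rfl

theorem EmbSimplex.isStableFamily {c : ℕ} {ε : ℝ} (hε : 0 < ε) {k : SimplexCategory}
    (e : EmbSimplex h c ε k) : IsStableFamily h Set.univ e.stable where
  continuousOn := by
    have h1 : Continuous e.toFun := continuous_snd.comp e.locallyFlat.isEmbedding.continuous
    have h2 : Continuous fun p : Simp k × W =>
        e.toFun (p.1, ⟨Collared.inl h p.2, Or.inl ⟨_, rfl⟩⟩) :=
      h1.comp (continuous_fst.prodMk (Continuous.subtype_mk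
        ((Collared.continuous_inl h).comp continuous_snd) _))
    exact ((continuous_padNat.comp (continuous_fst.comp h2)).prodMk
      (continuous_snd.comp h2)).continuousOn
  bounded := ⟨2 * n + c, fun t _ w i hi => dif_neg (by omega)⟩
  injective t _ w w' hw := by
    obtain ⟨h1, h2⟩ := Prod.ext_iff.1 hw
    have h3 := e.locallyFlat.isEmbedding.injective
      (a₁ := (t, ⟨Collared.inl h w, Or.inl ⟨_, rfl⟩⟩))
      (a₂ := (t, ⟨Collared.inl h w', Or.inl ⟨_, rfl⟩⟩))
      (Prod.ext rfl (Prod.ext (padNat_injective h1) h2))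
    exact Collared.inl_injective h (congrArg Subtype.val (Prod.ext_iff.1 h3).2)
  boundary t _ s := by
    have h1 : e.toFun (t, ⟨Collared.inl h (h s), Or.inl ⟨_, rfl⟩⟩) =
        std c (s, ⟨0, Set.mem_Iic.2 le_rfl⟩) := by
      rw [← e.eq_std t _ (neg_lt_zero.2 hε)]
      exact congrArg e.toFun (Prod.ext rfl (Subtype.ext (Collared.inr_zero h s).symm))
    simp only [EmbSimplex.stable, h1]
    exact Prod.ext (padNat_pad (by omega) _) rfl
  pos t _ w hw := by
    by_contra hneg
    exact hw ((inl_mem_collar_iff h hε w).1 ((e.nonpos_iff t _).1 (not_lt.1 hneg)))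

/-- The family of maps underlying a simplex of the colimit. -/
def EmbInfSimplex.stable {k : SimplexCategory} : EmbInfSimplex h k → Simp k × W → (ℕ → ℝ) × ℝ :=
  DirectLimit.lift (embTransition k) (fun _ e => e.stable)
    (fun _ j hij e => (e.stable_transition hij.1 j.2.ofDual.2 hij.2).symm)

/-- The transition maps become invisible in `ℝ^ℕ`, so equality in the colimit can be tested
pointwise, whatever the stages `N` and `ε`. -/
theorem EmbInfSimplex.stable_injective {k : SimplexCategory} :
    Function.Injective (EmbInfSimplex.stable : EmbInfSimplex h k → _) :=
  DirectLimit.lift_injective _ _ _ fun _ => EmbSimplex.stable_injective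

theorem EmbInfSimplex.isStableFamily {k : SimplexCategory} (x : EmbInfSimplex h k) :
    IsStableFamily h Set.univ x.stable := by
  obtain ⟨i, e, rfl⟩ := DirectLimit.exists_eq_mk _ x
  exact e.isStableFamily i.2.ofDual.2

theorem EmbInfSimplex.stable_pullback {j k : SimplexCategory} (θ : j ⟶ k)
    (x : EmbInfSimplex h k) (t : Simp j) (w : W) :
    (x.pullback θ).stable (t, w) = x.stable (simpMap θ t, w) := by
  obtain ⟨i, e, rfl⟩ := DirectLimit.exists_eq_mk _ x
  rfl

theorem EmbInfSimplex.stable_act {k : SimplexCategory} (φ : topBdry (2 * n) W k)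
    (x : EmbInfSimplex h k) (t : Simp k) (w : W) :
    (x.act φ).stable (t, w) = x.stable (t, ((φ⁻¹).1 (t, w)).2) := by
  obtain ⟨i, e, rfl⟩ := DirectLimit.exists_eq_mk _ x
  rfl

/-- If `e ∘ φ⁻¹ = e` with `e` injective on each fibre, then `φ⁻¹` is the identity. -/
theorem EmbInfSimplex.eq_one_of_act_eq {k : SimplexCategory} {φ : topBdry (2 * n) W k}
    {x : EmbInfSimplex h k} (hx : x.act φ = x) : φ = 1 := by
  refine inv_eq_one.1 (topBdry.ext_snd fun t w => x.isStableFamily.injective t trivial ?_)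
  have h1 := x.stable_act φ t w
  rw [hx] at h1
  exact h1.symm

variable (h) in
theorem isLevelwiseFree_EmbInf : IsLevelwiseFree (TopBdry (2 * n) W) (EmbInf h) :=
  fun _ _ _ hx => EmbInfSimplex.eq_one_of_act_eq hx

theorem std_injective (c : ℕ) : Function.Injective (std (n := n) c) := by
  rintro ⟨s, u⟩ ⟨s', u'⟩ hp
  obtain ⟨h1, h2⟩ := Prod.ext_iff.1 hp
  refine Prod.ext (Subtype.ext ?_) (Subtype.ext h2)
  have h3 := congrArg padNat h1
  simp only [std, padNat_pad (Nat.le_add_right _ _)] at h3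
  ext i
  exact congrFun (padNat_injective h3) i

theorem continuous_std (c : ℕ) : Continuous (std (n := n) c) := by
  refine Continuous.prodMk (continuous_pad.comp (continuous_pi fun i => ?_)) (by fun_prop)
  have h2 : Continuous (fun x : EuclideanSpace ℝ (Fin (2 * n)) => x i) := by fun_prop
  exact h2.comp (continuous_subtype_val.comp continuous_fst)

/-- Every stable family comes from a simplex of the colimit. -/
theorem IsStableFamily.exists_stable_eq [NeZero n] [T2Space W] [CompactSpace W]
    [ChartedSpace (EuclideanHalfSpace (2 * n)) W] {k : SimplexCategory}
    {f : Simp k × W → (ℕ → ℝ) × ℝ} (hf : IsStableFamily h Set.univ f) :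
    ∃ x : EmbInfSimplex h k, x.stable = f := by
  obtain ⟨M, hM⟩ := hf.bounded
  -- The number `2n + M` of coordinates is large enough both for `f` and for the standard sphere.
  let f₀ : Simp k × W → (Fin (2 * n + M) → ℝ) × ℝ := fun p => (fun i => (f p).1 i, (f p).2)
  have hpad : ∀ p, padNat (f₀ p).1 = (f p).1 := fun p => by
    funext i
    simp only [padNat, f₀]
    split_ifs with hi
    · rfl
    · exact (hM p.1 trivial p.2 i (by omega)).symm
  have hfc : Continuous f := by
    have := hf.continuousOn
    rwa [Set.univ_prod_univ, continuousOn_univ] at this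
  have hf₀ : Continuous f₀ := by fun_prop
  have hfg : ∀ t s, f₀ (t, (h s : W)) = std M (s, ⟨0, Set.mem_Iic.2 le_rfl⟩) := fun t s => by
    refine Prod.ext (padNat_injective ?_) ?_
    · rw [hpad, hf.boundary t trivial]
      exact (padNat_pad (by omega) _).symm
    · change (f (t, (h s : W))).2 = 0
      rw [hf.boundary t trivial]
  let e : Simp k × Collared h → (Fin (2 * n + M) → ℝ) × ℝ := collarDesc h f₀ (std M) hfg
  have hel : ∀ t w, e (t, Collared.inl h w) = f₀ (t, w) := fun _ _ => rfl
  have her : ∀ t p, e (t, Collared.inr h p) = std M p := fun _ _ => rfl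
  -- A dichotomy that the last coordinate detects: it is positive at interior points of `W` and
  -- nonpositive on the closed collar.
  have hcases : ∀ x : Collared h, (∃ w, w ∉ manifoldBoundary (2 * n) W ∧ x = Collared.inl h w) ∨
      ∃ p, x = Collared.inr h p := fun x => by
    refine Collared.cases h (P := fun x => (∃ w, w ∉ manifoldBoundary (2 * n) W ∧
      x = Collared.inl h w) ∨ ∃ p, x = Collared.inr h p) (fun w => ?_) (fun p => Or.inr ⟨p, rfl⟩) x
    by_cases hw : w ∈ manifoldBoundary (2 * n) W
    · obtain ⟨p, -, hp⟩ := (inl_mem_collar_iff h one_pos w).2 hw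
      exact Or.inr ⟨p, hp⟩
    · exact Or.inl ⟨w, hw, rfl⟩
  have hstd : ∀ p : BdrySphere n × Set.Iic (0 : ℝ), (std M p).2 ≤ 0 := fun p => p.2.2
  have hinj : ∀ t, Function.Injective fun x => e (t, x) := by
    intro t x y hxy
    rcases hcases x with ⟨w, hw, rfl⟩ | ⟨p, rfl⟩ <;>
      rcases hcases y with ⟨w', hw', rfl⟩ | ⟨p', rfl⟩ <;>
      simp only [hel, her] at hxy
    · refine congrArg _ (hf.injective t trivial ?_)
      refine Prod.ext ?_ (Prod.ext_iff.1 hxy).2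
      rw [← hpad, ← hpad, hxy]
    · have := hf.pos t trivial w hw
      change 0 < (f₀ (t, w)).2 at this
      rw [hxy] at this
      exact absurd this (not_lt.2 (hstd _))
    · have := hf.pos t trivial w' hw'
      change 0 < (f₀ (t, w')).2 at this
      rw [← hxy] at this
      exact absurd this (not_lt.2 (hstd _))
    · exact congrArg _ (std_injective M hxy)
  -- The collar length `1` is an arbitrary choice; any positive length gives a subspace of a compact
  -- piece.
  have hflat := isLocallyFlatEmbeddingOver_stab (m := 2 * n) (c := M) (S := collared h 1)
    (continuous_collarDesc h hf₀ (continuous_std M) hfg) hinj (exists_collared_chart h)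
    ⟨_, isCompact_collar_piece h isCompact_univ isClosed_univ 1,
      fun x hx => ⟨trivial, (neg_lt_height h one_pos hx).le⟩⟩
  let E : EmbSimplex h (M + 2 * n) 1 k :=
    { toFun := fun p => stab (e (p.1, p.2))
      locallyFlat := hflat
      eq_std := fun t p hp => Prod.ext (pad_pad (by omega) _) rfl
      nonpos_iff := fun t x => by
        change (e (t, x)).2 ≤ 0 ↔ _
        obtain ⟨x, ⟨w, rfl⟩ | ⟨p, hp, rfl⟩⟩ := x
        · change (f (t, w)).2 ≤ 0 ↔ Collared.inl h w ∈ _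
          rw [inl_mem_collar_iff h one_pos]
          constructor
          · intro hle
            by_contra hw
            exact absurd (hf.pos t trivial w hw) (not_lt.2 hle)
          · intro hw
            obtain ⟨s, hs⟩ := h.surjective ⟨w, hw⟩
            obtain rfl : (h s : W) = w := congrArg Subtype.val hs
            rw [hf.boundary t trivial]
        · exact ⟨fun _ => ⟨p, hp, rfl⟩, fun _ => hstd p⟩ }
  refine ⟨⟦⟨(M + 2 * n, OrderDual.toDual ⟨1, one_pos⟩), E⟩⟧, ?_⟩
  change E.stable = f
  funext p
  refine Prod.ext ?_ rfl
  change padNat (pad (f₀ p).1) = _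
  rw [padNat_pad (by omega), hpad]

end Stable

/-! ### An embedding of the interior -/

section Interior

/-- A compact manifold with boundary has a continuous injection to some `ℝᵐ`. -/
theorem exists_injective_map (n : ℕ) [NeZero n] (W : Type u) [TopologicalSpace W] [T2Space W]
    [CompactSpace W] [ChartedSpace (EuclideanHalfSpace (2 * n)) W] :
    ∃ (ι : Type u) (_ : Fintype ι) (ψ : W → ι → ℝ),
    Continuous ψ ∧ Function.Injective ψ := by
  -- A Tietze extension `g` of the chart and a bump function `ρ` at `w`, supported where `g` is
  -- still the chart.
  have h1 : ∀ w : W, ∃ (ρ : C(W, ℝ)) (g : C(W, Fin (2 * n) → ℝ)) (U : Set W), IsOpen U ∧ w ∈ U ∧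
      (∀ x ∈ U, ρ x = 1) ∧ ∀ x y, ρ x ≠ 0 → ρ y ≠ 0 → g x = g y → x = y := by
    intro w
    obtain ⟨K, hK, hwK, hKU⟩ := exists_compact_subset
      (chartAt (EuclideanHalfSpace (2 * n)) w).open_source (mem_chart_source _ w)
    obtain ⟨L, hL, hwL, hLK⟩ := exists_compact_subset isOpen_interior hwK
    obtain ⟨g, hg⟩ := ContinuousMap.exists_restrict_eq hK.isClosed
      (⟨fun x : K => chartCoord (n := n) w x, continuousOn_iff_continuous_domRestrict.1
        ((continuousOn_chartCoord w).mono hKU)⟩ : C(K, Fin (2 * n) → ℝ))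
    have hg' : ∀ x ∈ K, g x = chartCoord w x := fun x hx =>
      DFunLike.congr_fun hg ⟨x, hx⟩
    obtain ⟨ρ, hρ0, hρ1, -⟩ := exists_continuous_zero_one_of_isClosed
      (isOpen_interior (s := K)).isClosed_compl hL.isClosed
      (Set.disjoint_compl_left_iff_subset.2 hLK)
    have hρK : ∀ x, ρ x ≠ 0 → x ∈ K := fun x hx => by
      by_contra hxK
      exact hx (hρ0 fun hx' => hxK (interior_subset hx'))
    refine ⟨ρ, g, interior L, isOpen_interior, hwL, fun x hx => hρ1 (interior_subset hx),
      fun x y hx hy hxy => ?_⟩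
    rw [hg' x (hρK x hx), hg' y (hρK y hy)] at hxy
    exact injOn_chartCoord (n := n) w (hKU (hρK x hx)) (hKU (hρK y hy)) hxy
  choose ρ g U hU hwU hρ hg using h1
  obtain ⟨s, hs⟩ := isCompact_univ.elim_finite_subcover U hU fun w _ => Set.mem_iUnion.2 ⟨w, hwU w⟩
  refine ⟨s × Option (Fin (2 * n)), inferInstance, fun x a =>
    a.2.elim (ρ a.1 x) fun i => ρ a.1 x * g a.1 x i, ?_, fun x y hxy => ?_⟩
  · refine continuous_pi fun a => ?_
    obtain ⟨a, _ | i⟩ := a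
    · exact (ρ a).continuous
    · exact (ρ a).continuous.mul ((continuous_apply i).comp (g a).continuous)
  -- Pick a bump function equal to `1` at `x`. It takes the same value at `y`, so dividing by it
  -- gives equal chart coordinates.
  · obtain ⟨w, hw⟩ := Set.mem_iUnion.1 (hs (Set.mem_univ x))
    obtain ⟨hws, hxw⟩ := Set.mem_iUnion.1 hw
    have h2 : ρ w x = ρ w y := congrFun hxy (⟨w, hws⟩, none)
    have h3 : ρ w x = 1 := hρ w x hxw
    refine hg w x y (by rw [h3]; exact one_ne_zero) (by rw [← h2, h3]; exact one_ne_zero)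
      (funext fun i => ?_)
    have h4 : ρ w x * g w x i = ρ w y * g w y i := congrFun hxy (⟨w, hws⟩, some i)
    rwa [← h2, h3, one_mul, one_mul] at h4

/-- There are functions `d` and `ι` that vanish on the boundary, with `d` positive and `ι`
injective on the interior. -/
theorem exists_interior_embedding (n : ℕ) [NeZero n] (W : Type u) [TopologicalSpace W] [T2Space W]
    [CompactSpace W] [ChartedSpace (EuclideanHalfSpace (2 * n)) W]
    (hne : (manifoldBoundary (2 * n) W).Nonempty) :
    ∃ (d : W → ℝ) (m : ℕ) (ι : W → Fin m → ℝ), Continuous d ∧ Continuous ι ∧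
      (∀ w, 0 ≤ d w) ∧ (∀ w, d w = 0 ↔ w ∈ manifoldBoundary (2 * n) W) ∧
      (∀ w ∈ manifoldBoundary (2 * n) W, ι w = 0) ∧
      ∀ w w', w ∉ manifoldBoundary (2 * n) W → ι w = ι w' → w = w' := by
  obtain ⟨κ, _, ψ, hψ, hψi⟩ := exists_injective_map n W
  have hemb := hψ.isClosedEmbedding hψi
  let d : W → ℝ := fun w => Metric.infDist (ψ w) (ψ '' manifoldBoundary (2 * n) W)
  have hd : Continuous d := (Metric.continuous_infDist_pt _).comp hψ
  have hd0 : ∀ w, d w = 0 ↔ w ∈ manifoldBoundary (2 * n) W := fun w => by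
    rw [← (hemb.isClosedMap _ (isClosed_manifoldBoundary (2 * n))).mem_iff_infDist_zero
      (hne.image ψ), hψi.mem_set_image]
  let e := Fintype.equivFin (Option κ)
  -- The map `(d, d ψ)` collapses the boundary to `0`; where `d ≠ 0`, dividing by `d` recovers `ψ`.
  -- Since `d` is itself a coordinate, it suffices that one of the two points is interior.
  let ι : W → Option κ → ℝ := fun w a => a.elim (d w) fun i => d w * ψ w i
  have hι : Continuous ι := by
    refine continuous_pi fun a => ?_
    obtain _ | i := a
    · exact hd
    · exact hd.mul ((continuous_apply i).comp hψ)
  refine ⟨d, Fintype.card (Option κ), fun w a => ι w (e.symm a), hd, by fun_prop,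
    fun w => Metric.infDist_nonneg, hd0, fun w hw => ?_, fun w w' hw hww' => ?_⟩
  · have h0 := (hd0 w).2 hw
    have h1 : ∀ a, ι w a = 0 := by rintro (_ | i) <;> simp [ι, h0]
    exact funext fun a => h1 _
  · have h1 : ι w = ι w' := funext fun a => by simpa using congrFun hww' (e a)
    have h2 : d w = d w' := congrFun h1 none
    have h3 : d w ≠ 0 := fun h0 => hw ((hd0 w).1 h0)
    refine hψi (funext fun i => ?_)
    have h4 : d w * ψ w i = d w' * ψ w' i := congrFun h1 (some i)
    rw [← h2] at h4
    exact mul_left_cancel₀ h3 h4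

end Interior

/-! ### Extension of families -/

section Extension

variable {n : ℕ} {W : Type u} [TopologicalSpace W]
  {h : BdrySphere n ≃ₜ manifoldBoundary (2 * n) W}

theorem nonempty_manifoldBoundary [NeZero n] (h : BdrySphere n ≃ₜ manifoldBoundary (2 * n) W) :
    (manifoldBoundary (2 * n) W).Nonempty := by
  have : Nontrivial (EuclideanSpace ℝ (Fin (2 * n))) := inferInstance
  obtain ⟨x, hx⟩ := NormedSpace.sphere_nonempty (E := EuclideanSpace ℝ (Fin (2 * n))) (x := 0)
    (r := 1) |>.2 zero_le_one
  exact ⟨_, (h ⟨x, hx⟩).2⟩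

/-- Tietze on the closed set `D × W ∪ T × ∂W`: the two prescriptions agree on the overlap because
`f` is standard on the boundary. Neither injectivity nor finite-dimensionality is kept outside `D`.
-/
theorem IsStableFamily.exists_continuous_extension [T2Space W] [CompactSpace W]
    {T : Type*} [TopologicalSpace T] [CompactSpace T] [T2Space T] {D : Set T} (hD : IsClosed D)
    {f : T × W → (ℕ → ℝ) × ℝ}
    (hf : IsStableFamily h D f) : ∃ g : C(T × W, (ℕ → ℝ) × ℝ),
      (∀ t ∈ D, ∀ w, g (t, w) = f (t, w)) ∧ ∀ t s, g (t, (h s : W)) = (padNat fun i => s.1 i, 0) := by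
  classical
  let bd : T × W → (ℕ → ℝ) × ℝ := fun p =>
    if hp : p.2 ∈ manifoldBoundary (2 * n) W then (padNat fun i => (h.symm ⟨p.2, hp⟩).1 i, 0) else 0
  have hbd : ∀ t s, bd (t, (h s : W)) = (padNat fun i => s.1 i, 0) := fun t s => by
    simp [bd]
  have hbdc : ContinuousOn bd (Set.univ ×ˢ manifoldBoundary (2 * n) W) := by
    rw [continuousOn_iff_continuous_domRestrict]
    have h1 : Continuous fun p : ↥((Set.univ : Set T) ×ˢ manifoldBoundary (2 * n) W) =>
        ((padNat fun i => (h.symm ⟨p.1.2, p.2.2⟩).1 i, 0) : (ℕ → ℝ) × ℝ) := by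
      refine Continuous.prodMk (continuous_padNat.comp (continuous_pi fun i => ?_)) continuous_const
      have h2 : Continuous (fun x : EuclideanSpace ℝ (Fin (2 * n)) => x i) := by fun_prop
      exact h2.comp (continuous_subtype_val.comp (h.symm.continuous.comp
        (Continuous.subtype_mk (by fun_prop) _)))
    convert h1 using 1
    funext p
    exact dif_pos p.2.2
  let g₀ : T × W → (ℕ → ℝ) × ℝ := fun p => if p.1 ∈ D then f p else bd p
  have hg₀D : ∀ p ∈ D ×ˢ (Set.univ : Set W), g₀ p = f p := fun p hp => if_pos hp.1
  have hg₀b : ∀ p ∈ (Set.univ : Set T) ×ˢ manifoldBoundary (2 * n) W, g₀ p = bd p := by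
    rintro ⟨t, w⟩ ⟨-, hw⟩
    obtain ⟨s, hs⟩ := h.surjective ⟨w, hw⟩
    obtain rfl : (h s : W) = w := congrArg Subtype.val hs
    by_cases ht : t ∈ D
    · rw [hg₀D _ ⟨ht, trivial⟩, hf.boundary t ht, hbd]
    · exact if_neg ht
  have hA₁ : IsClosed (D ×ˢ (Set.univ : Set W)) := hD.prod isClosed_univ
  have hA₂ : IsClosed ((Set.univ : Set T) ×ˢ manifoldBoundary (2 * n) W) :=
    isClosed_univ.prod (isClosed_manifoldBoundary _)
  have hg₀ : ContinuousOn g₀ (D ×ˢ Set.univ ∪ Set.univ ×ˢ manifoldBoundary (2 * n) W) :=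
    (hf.continuousOn.congr hg₀D).union_of_isClosed (hbdc.congr hg₀b) hA₁ hA₂
  obtain ⟨g, hg⟩ := ContinuousMap.exists_restrict_eq (hA₁.union hA₂)
    ⟨_, continuousOn_iff_continuous_domRestrict.1 hg₀⟩
  have hg' : ∀ p ∈ D ×ˢ Set.univ ∪ Set.univ ×ˢ manifoldBoundary (2 * n) W, g p = g₀ p :=
    fun p hp => DFunLike.congr_fun hg ⟨p, hp⟩
  refine ⟨g, fun t ht w => ?_, fun t s => ?_⟩
  · rw [hg' _ (Or.inl ⟨ht, trivial⟩), hg₀D _ ⟨ht, trivial⟩]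
  · have hs : (t, (h s : W)) ∈ (Set.univ : Set T) ×ˢ manifoldBoundary (2 * n) W :=
      ⟨trivial, (h s).2⟩
    rw [hg' _ (Or.inr hs), hg₀b _ hs, hbd]

/-- A stable family over the zero set of a function extends to a stable family. -/
theorem IsStableFamily.exists_extension [NeZero n] [T2Space W] [CompactSpace W]
    [ChartedSpace (EuclideanHalfSpace (2 * n)) W] {T : Type*} [TopologicalSpace T] [CompactSpace T]
    [T2Space T] {D : Set T} {l : T → ℝ} (hl : Continuous l) (hl0 : ∀ t, 0 ≤ l t)
    (hlD : ∀ t, l t = 0 ↔ t ∈ D) {f : T × W → (ℕ → ℝ) × ℝ} (hf : IsStableFamily h D f) :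
    ∃ F, IsStableFamily h Set.univ F ∧ ∀ t ∈ D, ∀ w, F (t, w) = f (t, w) := by
  have hD : IsClosed D := by
    have : D = l ⁻¹' {0} := Set.ext fun t => (hlD t).symm
    rw [this]
    exact isClosed_singleton.preimage hl
  obtain ⟨g, hgD, hgb⟩ := hf.exists_continuous_extension hD
  obtain ⟨M₀, hM₀⟩ := hf.bounded
  obtain ⟨d, m, ι, hd, hι, hd0, hdb, hιb, hιi⟩ :=
    exists_interior_embedding n W (nonempty_manifoldBoundary h)
  -- From index `M` on, both `f` over `D` and the standard sphere have zero coordinates, so these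
  -- are free for `ι`.
  let M := max M₀ (2 * n)
  -- Truncation at `M` restores finite-dimensionality; the terms with `l` give injectivity and
  -- positivity off `D`, and vanish over `D` and on `∂W`. The absolute value changes nothing over
  -- `D`, where the last coordinate of `f` is already nonnegative.
  let F : T × W → (ℕ → ℝ) × ℝ := fun p =>
    (fun i => if i < M then (g p).1 i else if hi : i - M < m then l p.1 * ι p.2 ⟨i - M, hi⟩ else 0,
      |(g p).2| + l p.1 * d p.2)
  have hFD : ∀ t ∈ D, ∀ w, F (t, w) = f (t, w) := by
    intro t ht w
    have hlt := (hlD t).2 ht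
    refine Prod.ext (funext fun i => ?_) ?_
    · change (if i < M then (g (t, w)).1 i else
        if hi : i - M < m then l t * ι w ⟨i - M, hi⟩ else 0) = _
      rw [hgD t ht, hlt]
      split_ifs with h1 h2
      · rfl
      · rw [zero_mul, hM₀ t ht w i ((le_max_left _ _).trans (not_lt.1 h1))]
      · rw [hM₀ t ht w i ((le_max_left _ _).trans (not_lt.1 h1))]
    · change |(g (t, w)).2| + l t * d w = _
      rw [hgD t ht, hlt, zero_mul, add_zero, abs_of_nonneg]
      by_cases hw : w ∈ manifoldBoundary (2 * n) W
      · obtain ⟨s, hs⟩ := h.surjective ⟨w, hw⟩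
        obtain rfl : (h s : W) = w := congrArg Subtype.val hs
        rw [hf.boundary t ht]
      · exact (hf.pos t ht w hw).le
  have hFb : ∀ t s, F (t, (h s : W)) = (padNat fun i => s.1 i, 0) := by
    intro t s
    refine Prod.ext (funext fun i => ?_) ?_
    · change (if i < M then (g (t, (h s : W))).1 i else
        if hi : i - M < m then l t * ι (h s) ⟨i - M, hi⟩ else 0) = _
      rw [hgb, hιb _ (h s).2]
      split_ifs with h1 h2
      · rfl
      all_goals
        have h3 : ¬ i < 2 * n := not_lt.2 ((le_max_right _ _).trans (not_lt.1 h1))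
        simp [padNat, h3]
    · change |(g (t, (h s : W))).2| + l t * d (h s) = _
      rw [hgb, (hdb _).2 (h s).2]
      simp
  have hFι : ∀ t w w', l t ≠ 0 → F (t, w) = F (t, w') → ι w = ι w' := by
    intro t w w' hlt hww
    funext a
    have h1 := congrFun (Prod.ext_iff.1 hww).1 (M + a)
    have h2 : l t * ι w a = l t * ι w' a := by simpa [F] using h1
    exact mul_left_cancel₀ hlt h2
  refine ⟨F, ⟨?_, ⟨M + m, fun t _ w i hi => ?_⟩, fun t _ w w' hww => ?_, fun t _ s => hFb t s,
    fun t _ w hw => ?_⟩, hFD⟩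
  · refine Continuous.continuousOn (Continuous.prodMk (continuous_pi fun i => ?_) ?_)
    · have := g.continuous
      split_ifs <;> fun_prop
    · have := g.continuous
      fun_prop
  · have h1 : ¬ i < M := by omega
    have h2 : ¬ i - M < m := by omega
    simp [F, h1, h2]
  · change F (t, w) = F (t, w') at hww
    by_cases ht : t ∈ D
    · rw [hFD t ht, hFD t ht] at hww
      exact hf.injective t ht hww
    -- Off `D`, `ι` separates points unless both lie on `∂W`, where the standard sphere does.
    · have hι' := hFι t w w' (fun h0 => ht ((hlD t).1 h0)) hww
      by_cases hw : w ∈ manifoldBoundary (2 * n) W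
      · by_cases hw' : w' ∈ manifoldBoundary (2 * n) W
        · obtain ⟨s, hs⟩ := h.surjective ⟨w, hw⟩
          obtain rfl : (h s : W) = w := congrArg Subtype.val hs
          obtain ⟨s', hs'⟩ := h.surjective ⟨w', hw'⟩
          obtain rfl : (h s' : W) = w' := congrArg Subtype.val hs'
          rw [hFb, hFb] at hww
          have h1 : s = s' := by
            ext i
            exact congrFun (padNat_injective (Prod.ext_iff.1 hww).1) i
          rw [h1]
        · exact (hιi w' w hw' hι'.symm).symm
      · exact hιi w w' hw hι'
  · by_cases ht : t ∈ D
    · rw [hFD t ht]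
      exact hf.pos t ht w hw
    · have h1 : 0 < l t := lt_of_le_of_ne (hl0 t) fun h0 => ht ((hlD t).1 h0.symm)
      have h2 : 0 < d w := lt_of_le_of_ne (hd0 w) fun h0 => hw ((hdb w).1 h0.symm)
      change 0 < |(g (t, w)).2| + l t * d w
      positivity

end Extension

/-! ### Filling boundaries of simplices -/

section Filling

variable {n : ℕ} {W : Type u} [TopologicalSpace W]
  {h : BdrySphere n ≃ₜ manifoldBoundary (2 * n) W}

/-- Finitely many stable families that agree on overlaps glue. -/
theorem exists_isStableFamily_iUnion {T α : Type*} [TopologicalSpace T] [Finite α]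
    {C : α → Set T} (hC : ∀ a, IsClosed (C a)) {g : α → T × W → (ℕ → ℝ) × ℝ}
    (hg : ∀ a, IsStableFamily h Set.univ (g a))
    (hgg : ∀ a b t w, t ∈ C a → t ∈ C b → g a (t, w) = g b (t, w)) :
    ∃ f, IsStableFamily h (⋃ a, C a) f ∧ ∀ a, ∀ t ∈ C a, ∀ w, f (t, w) = g a (t, w) := by
  classical
  have := Fintype.ofFinite α
  let f : T × W → (ℕ → ℝ) × ℝ := fun p =>
    if hp : ∃ a, p.1 ∈ C a then g hp.choose p else 0
  have hf : ∀ a, ∀ t ∈ C a, ∀ w, f (t, w) = g a (t, w) := fun a t ht w => by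
    have hp : ∃ a, t ∈ C a := ⟨a, ht⟩
    exact (dif_pos hp).trans (hgg _ _ _ _ hp.choose_spec ht)
  choose M hM using fun a => (hg a).bounded
  refine ⟨f, ⟨?_, ⟨Finset.univ.sup M, fun t ht w i hi => ?_⟩, fun t ht => ?_, fun t ht s => ?_,
    fun t ht w hw => ?_⟩, hf⟩
  · rw [Set.iUnion_prod_const]
    refine (locallyFinite_of_finite _).continuousOn_iUnion
      (fun a => (hC a).prod isClosed_univ) fun a => ?_
    exact ((hg a).continuousOn.mono (Set.prod_mono_left (Set.subset_univ _))).congr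
      fun p hp => hf a p.1 hp.1 p.2
  all_goals obtain ⟨a, ha⟩ := Set.mem_iUnion.1 ht
  · rw [hf a t ha]
    exact hM a t trivial w i ((Finset.le_sup (Finset.mem_univ a)).trans hi)
  · simp only [hf a t ha]
    exact (hg a).injective t trivial
  · rw [hf a t ha]
    exact (hg a).boundary t trivial s
  · rw [hf a t ha]
    exact (hg a).pos t trivial w hw

/-- A monotone retraction of `[k]` onto a non-empty subset. -/
theorem exists_retraction {k : ℕ} (S : Finset (Fin (k + 1))) (hS : S.Nonempty) :
    ∃ β : (⦋k⦌ : SimplexCategory) ⟶ ⦋k⦌, (∀ a, β a ∈ S) ∧ ∀ a ∈ S, β a = a := by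
  -- The retraction sends `a` to the largest element of `S` that is at most `a`, or to the minimum
  -- of `S` if there is none.
  let A : Fin (k + 1) → Finset (Fin (k + 1)) := fun a => insert (S.min' hS) (S.filter (· ≤ a))
  have hA : ∀ a, (A a).Nonempty := fun a => Finset.insert_nonempty _ _
  have hAS : ∀ a, A a ⊆ S := fun a =>
    Finset.insert_subset (S.min'_mem hS) (Finset.filter_subset _ _)
  refine ⟨SimplexCategory.Hom.mk ⟨fun a => (A a).max' (hA a), fun a b hab => ?_⟩,
    fun a => hAS a (Finset.max'_mem _ (hA a)), fun a ha => ?_⟩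
  · refine Finset.max'_subset _ (Finset.insert_subset_insert _ fun c hc => ?_)
    rw [Finset.mem_filter] at hc ⊢
    exact ⟨hc.1, hc.2.trans hab⟩
  · refine le_antisymm (Finset.max'_le _ (hA a) _ fun c hc => ?_) (Finset.le_max' _ _ ?_)
    · rcases Finset.mem_insert.1 hc with rfl | hc
      · exact S.min'_le a ha
      · exact (Finset.mem_filter.1 hc).2
    · exact Finset.mem_insert_of_mem (Finset.mem_filter.2 ⟨ha, le_rfl⟩)

/-- Retract onto the support of `t`. A simplex evaluated at `t` then depends only on its restriction
along `β`, which serves to compare the families on different faces at a common point. -/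
theorem exists_retraction_of_point {k : ℕ} (t : Simp ⦋k⦌) :
    ∃ β : (⦋k⦌ : SimplexCategory) ⟶ ⦋k⦌, (∀ a, t (β a) ≠ 0) ∧ simpMap β t = t := by
  classical
  have hne : (Finset.univ.filter fun i => t i ≠ 0).Nonempty := by
    by_contra h0
    rw [Finset.not_nonempty_iff_eq_empty, Finset.filter_eq_empty_iff] at h0
    have h1 := stdSimplex.sum_eq_one t
    rw [Finset.sum_eq_zero fun i hi => not_not.1 (h0 hi)] at h1
    exact zero_ne_one h1
  obtain ⟨β, hβ, hβ'⟩ := exists_retraction _ hne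
  refine ⟨β, fun a => (Finset.mem_filter.1 (hβ a)).2, eq_of_sum_mul_eq fun g => ?_⟩
  rw [sum_map_mul]
  refine Finset.sum_congr rfl fun a _ => ?_
  by_cases ha : t a = 0
  · rw [ha, zero_mul, zero_mul]
  · rw [hβ' a (Finset.mem_filter.2 ⟨Finset.mem_univ _, ha⟩)]

theorem exists_ne_of_coord_eq_zero {k : ℕ} {t : Simp ⦋k⦌} {i : Fin (k + 1)} (ht : t i = 0) :
    ∃ j, i ≠ j := by
  obtain ⟨β, hβ, -⟩ := exists_retraction_of_point t
  exact ⟨β 0, fun hi => hβ 0 (hi ▸ ht)⟩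

theorem simpMap_apply_eq_zero {j : SimplexCategory} {k : ℕ} {θ : j ⟶ ⦋k⦌} {i : Fin (k + 1)}
    (hθ : ∀ a, θ a ≠ i) (t : Simp j) : simpMap θ t i = 0 := by
  have h1 := sum_map_mul θ t (Pi.single i 1)
  have h2 : ∀ a, (Pi.single i 1 : Fin (k + 1) → ℝ) (θ a) = 0 := fun a =>
    Pi.single_eq_of_ne (hθ a) _
  simp only [h2, mul_zero, Finset.sum_const_zero] at h1
  simpa [Pi.single_apply] using h1

theorem stable_map {j k : SimplexCategory} (θ : j ⟶ k) (x : (EmbInf h).obj (op k))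
    (t : Simp j) (w : W) :
    EmbInfSimplex.stable (h := h) (k := j) ((EmbInf h).map θ.op x) (t, w) =
      EmbInfSimplex.stable (h := h) (k := k) x (simpMap θ t, w) :=
  EmbInfSimplex.stable_pullback θ _ t w

variable (h) in
/-- The space of embeddings is trivially fibrant over the point. -/
theorem isTrivFib_EmbInf [NeZero n] [T2Space W] [CompactSpace W]
    [ChartedSpace (EuclideanHalfSpace (2 * n)) W] : IsTrivFib (toPt (EmbInf h)) := by
  rw [isTrivFib_toPt_iff]
  intro k b
  let φ {m : SimplexCategory} (θ : m ⟶ ⦋k⦌) (hθ : ∃ i, ∀ a, θ a ≠ i) :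
      Simp m × W → (ℕ → ℝ) × ℝ :=
    EmbInfSimplex.stable (h := h) (k := m) (b.app _ (bdrySimplex θ hθ))
  have hφ : ∀ {l m : SimplexCategory} (η : l ⟶ m) (θ : m ⟶ ⦋k⦌) (ρ : l ⟶ ⦋k⦌)
      (hθ : ∃ i, ∀ a, θ a ≠ i) (hρ : ∃ i, ∀ a, ρ a ≠ i) (_ : η ≫ θ = ρ) (t : Simp l) (w : W),
      φ ρ hρ (t, w) = φ θ hθ (simpMap η t, w) := by
    rintro l m η θ _ hθ hρ rfl t w
    refine Eq.trans ?_ (stable_map η _ t w)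
    exact congrArg (fun x => EmbInfSimplex.stable (h := h) (k := l) x (t, w))
      (map_bdrySimplex η θ hθ hρ b)
  -- The face opposite `i` is paired with each `j ≠ i` towards which `i` can be moved, so that its
  -- family extends to all of `Δᵏ` through `moveHom`. For `k = 0` there are no pairs, and filling
  -- the empty boundary shows that the space is non-empty.
  let C : {p : Fin (k + 1) × Fin (k + 1) // p.1 ≠ p.2} → Set (Simp ⦋k⦌) :=
    fun p => (fun t => t p.1.1) ⁻¹' {0}
  let g (p : {p : Fin (k + 1) × Fin (k + 1) // p.1 ≠ p.2}) : Simp ⦋k⦌ × W → (ℕ → ℝ) × ℝ :=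
    φ (moveHom p.1.2 p.1.1 p.2) ⟨p.1.1, moveHom_ne p.2⟩
  -- On its face each family equals the one for the support retraction `β`, which does not mention
  -- the face; hence they agree on overlaps.
  have hg : ∀ p t w (β : (⦋k⦌ : SimplexCategory) ⟶ ⦋k⦌) (hβ : ∃ i, ∀ a, β a ≠ i), t ∈ C p →
      (∀ a, t (β a) ≠ 0) → simpMap β t = t → g p (t, w) = φ β hβ (t, w) := by
    intro p t w β hβ ht hβ' hβt
    have h1 := hφ β _ β ⟨p.1.1, moveHom_ne p.2⟩ hβ
      (comp_moveHom p.2 fun a ha => hβ' a (ha ▸ ht)) t w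
    rw [hβt] at h1
    exact h1.symm
  obtain ⟨f, hf, hfg⟩ := exists_isStableFamily_iUnion (h := h) (C := C) (g := g)
    (fun p => isClosed_singleton.preimage (continuous_coord p.1.1))
    (fun p => EmbInfSimplex.isStableFamily _) fun p q t w hp hq => by
      obtain ⟨β, hβ, hβt⟩ := exists_retraction_of_point t
      have hβ' : ∃ i, ∀ a, β a ≠ i := ⟨p.1.1, fun a ha => hβ a (ha ▸ hp)⟩
      rw [hg p t w β hβ' hp hβ hβt, hg q t w β hβ' hq hβ hβt]
  -- The product of the barycentric coordinates vanishes exactly on `∂Δᵏ`.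
  obtain ⟨F, hF, hFf⟩ := hf.exists_extension (l := fun t => ∏ i, t i)
    (continuous_finsetProd _ fun i _ => continuous_coord i)
    (fun t => Finset.prod_nonneg (f := fun i => t i) fun i _ => t.2.1 i) fun t => by
      rw [Finset.prod_eq_zero_iff, Set.mem_iUnion]
      constructor
      · rintro ⟨i, -, hi⟩
        obtain ⟨j, hj⟩ := exists_ne_of_coord_eq_zero hi
        exact ⟨⟨(i, j), hj⟩, hi⟩
      · rintro ⟨p, hp⟩
        exact ⟨p.1.1, Finset.mem_univ _, hp⟩
  obtain ⟨x, hx⟩ := hF.exists_stable_eq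
  refine ⟨x, fun {m} θ hθ => EmbInfSimplex.stable_injective (h := h) (k := m) (funext fun p => ?_)⟩
  obtain ⟨t, w⟩ := p
  refine (stable_map θ _ t w).trans ?_
  obtain ⟨i, hi⟩ := hθ
  -- Any vertex of the image of `θ` can serve as the direction `j`; it differs from the omitted `i`.
  have hp : simpMap θ t ∈ C ⟨(i, θ 0), (hi 0).symm⟩ := simpMap_apply_eq_zero hi t
  rw [hx, hFf _ (Set.mem_iUnion.2 ⟨_, hp⟩), hfg _ _ hp]
  exact (hφ θ _ θ _ _ (comp_moveHom _ hi) t w).symm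

end Filling

end LFEmb

end

theorem mainTheorem9 {n : ℕ} [NeZero n] {W : Type u} [TopologicalSpace W] [T2Space W]
    [CompactSpace W] [ChartedSpace (EuclideanHalfSpace (2 * n)) W] [SimplyConnectedSpace W]
    (h : LFEmb.BdrySphere n ≃ₜ LFEmb.manifoldBoundary (2 * n) W) :
    LFEmb.IsWeaklyContractible (LFEmb.EmbInf h) ∧
    LFEmb.IsLevelwiseFree (LFEmb.TopBdry (2 * n) W) (LFEmb.EmbInf h) ∧
    ∃ (F : LFEmb.EmbInf h ⟶ LFEmb.EG (LFEmb.TopBdry (2 * n) W))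
      (hF : LFEmb.IsEquivariant (LFEmb.TopBdry (2 * n) W) F),
      LFEmb.IsRealizationEquiv (X := LFEmb.orbitSpace (LFEmb.TopBdry (2 * n) W) (LFEmb.EmbInf h))
        (Y := LFEmb.BG (LFEmb.TopBdry (2 * n) W))
        (LFEmb.orbitMap (LFEmb.TopBdry (2 * n) W) F hF) := by
  have hfree := LFEmb.isLevelwiseFree_EmbInf h
  have hX := LFEmb.isTrivFib_EmbInf h
  exact ⟨LFEmb.isWeaklyContractible_of_isTrivFib hX, hfree,
    LFEmb.exists_classifyingMap _ hfree hX⟩
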